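/- Graphs are finite and undirected; the adjacency matrix $(\Gamma_{v,w})$ of a graph $\Gamma$ is taken with $\Gamma_{v,v}=1$. Hilbert spaces are finite-dimensional and complex. A \emph{quantum isomorphism} $(H,P):\Gamma'\to\Gamma$ is a Hilbert space $H$ with self-adjoint operators $P_{x,v}$ on $H$ ($x\in V_{\Gamma'}$, $v\in V_\Gamma$) such that $P_{x,v}P_{x,w}=\delta_{v,w}P_{x,v}$, $\sum_{v}P_{x,v}=1$, $P_{x,v}P_{y,v}=\delta_{x,y}P_{x,v}$, $\sum_x P_{x,v}=1$ and $\sum_{y}\Gamma'_{x,y}P_{y,v}=\sum_{w}P_{x,w}\Gamma_{w,v}$. The graph $\Gamma'$ is \emph{quantum isomorphic} to $\Gamma$ if there is a quantum isomorphism $\Gamma'\to\Gamma$ with $H\neq 0$. $\mathrm{QAut}(\Gamma)$ is the monoidal dagger category whose objects are the quantum isomorphisms $(H,X):\Gamma\to\Gamma$ (including $H=0$), whose morphisms $(H,X)\to(H',X')$ are the linear maps $f:H\to H'$ with $X'_{v,w}f=fX_{v,w}$, whose dagger is the Hilbert space adjoint, and whose tensor product is $(H,X)\otimes(H',X')=(H\otimes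 H',\,(\sum_x X_{x,w}\otimes X'_{v,x})_{v,w})$, with unit $(\mathbb C,\delta_{v,w})$. A \emph{dagger Frobenius monoid} in it is a monoid $(A,m,u)$ with $(m\otimes 1)(1\otimes m^\dagger)=m^\dagger m=(1\otimes m)(m^\dagger\otimes 1)$. It is \emph{simple} if its underlying algebra is, by a unitary preserving multiplication and unit, the endomorphism algebra of some Hilbert space $K\ne0$ of dimension $n$, that is $K\otimes K^*$ with multiplication $(x\otimes f)(y\otimes g)=n^{-1/2}f(y)\,x\otimes g$ and unit $\sqrt n\sum_i e_i\otimes e_i^*$ ($(e_i)$ an orthonormal basis of $K$). Simple dagger Frobenius monoids $A,B$ are \emph{Morita equivalent} if there are bimodules ${}_AM_B$, ${}_BN_A$ in $\mathrm{QAut}(\Gamma)$, compatible with the dagger (each action equals its adjoint with the monoid wire bent by the cap $u^\dagger m$), with $M\otimes_BN\cong A$ and $N\otimes_AM\cong B$ unitarily as bimodules; the relative tensor product over a special monoid is the image of the canonical dagger idempotent on $M\otimes N$. For a simple dagger Frobenius monoid $X$, with underlying space identified with $K\otimes K^*$ as above, let $(X_{v,v})^{ab}_{cd}$ be the coefficient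 of $e_a\otimes e_b^*$ in $X_{v,v}(e_c\otimes e_d^*)$ and put $$d(X)=\frac1{\dim K}\sum_{v\in V_\Gamma}\sum_{a,b,c,d}(X_{v,v})^{ab}_{cd}\,(X_{v,v})^{ca}_{db}$$ (this does not depend on the identification). \textbf{Corollary.} Let $\Gamma$ be a graph. On the simple dagger Frobenius monoids $X$ in $\mathrm{QAut}(\Gamma)$ with $d(X)=|V_\Gamma|$, Morita equivalence is an equivalence relation. Sending a quantum isomorphism $(H,P):\Gamma'\to\Gamma$ with $H\ne0$ to the endomorphism algebra on $(H\otimes H^*,P\circ\overline P)$, where $(P\circ\overline P)_{v,w}=\sum_{x\in V_{\Gamma'}}P_{x,w}\otimes (P_{x,v})^{T}$ with $T^{T}(f)=f\circ T$ for $f\in H^*$, induces a well-defined bijection between (i) isomorphism classes of graphs $\Gamma'$ quantum isomorphic to $\Gamma$, and (ii) Morita equivalence classes of simple dagger Frobenius monoids $X$ in $\mathrm{QAut}(\Gamma)$ with $d(X)=|V_\Gamma|$. -/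

import Mathlib

open CategoryTheory MonoidalCategory
open scoped TensorProduct

universe v u

/-! ## Dagger Frobenius monoids and Morita equivalence in a monoidal dagger category -/

/-- A monoidal dagger category: an involutive, identity-on-objects contravariant functor that is
compatible with the tensor product and for which the structural isomorphisms are unitary. -/
class MonoidalDaggerCategory (C : Type u) [Category.{v} C] [MonoidalCategory C] where
  dagger : ∀ {X Y : C}, (X ⟶ Y) → (Y ⟶ X)
  dagger_id : ∀ X : C, dagger (𝟙 X) = 𝟙 X
  dagger_comp : ∀ {X Y Z : C} (f : X ⟶ Y) (g : Y ⟶ Z), dagger (f ≫ g) = dagger g ≫ dagger f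
  dagger_dagger : ∀ {X Y : C} (f : X ⟶ Y), dagger (dagger f) = f
  dagger_tensorHom : ∀ {X Y X' Y' : C} (f : X ⟶ Y) (g : X' ⟶ Y'),
    dagger (f ⊗ₘ g) = dagger f ⊗ₘ dagger g
  dagger_associator : ∀ X Y Z : C, dagger (α_ X Y Z).hom = (α_ X Y Z).inv
  dagger_leftUnitor : ∀ X : C, dagger (λ_ X).hom = (λ_ X).inv
  dagger_rightUnitor : ∀ X : C, dagger (ρ_ X).hom = (ρ_ X).inv

namespace MonoidalDaggerCategory

open MonObj

variable {C : Type u} [Category.{v} C] [MonoidalCategory C] [MonoidalDaggerCategory C]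

/-- The comultiplication of a monoid: the adjoint of its multiplication. -/
def comul (A : Mon C) : A.X ⟶ A.X ⊗ A.X := dagger μ[A.X]

/-- The counit of a monoid: the adjoint of its unit. -/
def counit (A : Mon C) : A.X ⟶ 𝟙_ C := dagger η[A.X]

/-- The Frobenius equations between a monoid and its adjoint comonoid. -/
structure IsDaggerFrobenius (A : Mon C) : Prop where
  frobenius_left : A.X ◁ comul A ≫ (α_ A.X A.X A.X).inv ≫ μ[A.X] ▷ A.X = μ[A.X] ≫ comul A
  frobenius_right : comul A ▷ A.X ≫ (α_ A.X A.X A.X).hom ≫ A.X ◁ μ[A.X] = μ[A.X] ≫ comul A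

/-- The canonical cap `A ⊗ A ⟶ I`, the multiplication followed by the counit. -/
def cap (A : Mon C) : A.X ⊗ A.X ⟶ 𝟙_ C := μ[A.X] ≫ counit A

/-- The canonical cup `I ⟶ A ⊗ A`, the unit followed by the comultiplication. -/
def cup (A : Mon C) : 𝟙_ C ⟶ A.X ⊗ A.X := η[A.X] ≫ comul A

/-- A bimodule is a dagger bimodule if its actions coincide with the adjoints of its actions, after
bending the wires of the acting monoids with the canonical caps. -/
structure IsDaggerBimod {A B : Mon C} (M : Bimod A B) : Prop where
  left : A.X ◁ dagger M.actLeft ≫ (α_ A.X A.X M.X).inv ≫ cap A ▷ M.X ≫ (λ_ M.X).hom = M.actLeft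
  right : dagger M.actRight ▷ B.X ≫ (α_ M.X B.X B.X).hom ≫ M.X ◁ cap B ≫ (ρ_ M.X).hom = M.actRight

/-- The idempotent on `M ⊗ N` whose image is the relative tensor product of `M` and `N` over `B`:
create a pair of `B`-wires between `M` and `N` and let them act on `M` and on `N`. -/
def relIdempotent {A B D : Mon C} (M : Bimod A B) (N : Bimod B D) : M.X ⊗ N.X ⟶ M.X ⊗ N.X :=
  M.X ◁ ((λ_ N.X).inv ≫ cup B ▷ N.X ≫ (α_ B.X B.X N.X).hom) ≫
    (α_ M.X B.X (B.X ⊗ N.X)).inv ≫ (M.actRight ⊗ₘ N.actLeft)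

/-- The morphism `i : Q ⟶ M ⊗ N` exhibits the bimodule `Q` as a relative tensor product of `M` and
`N`: it is a dagger splitting of the idempotent `relIdempotent M N`, and the actions on `Q` are the
ones induced by the outer actions on `M ⊗ N`. -/
structure IsRelTensor {A B D : Mon C} (M : Bimod A B) (N : Bimod B D) (Q : Bimod A D)
    (i : Q.X ⟶ M.X ⊗ N.X) : Prop where
  isometry : i ≫ dagger i = 𝟙 Q.X
  splits : dagger i ≫ i = relIdempotent M N
  actLeft : A.X ◁ i ≫ (α_ A.X M.X N.X).inv ≫ M.actLeft ▷ N.X ≫ dagger i = Q.actLeft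
  actRight : i ▷ D.X ≫ (α_ M.X N.X D.X).hom ≫ M.X ◁ N.actRight ≫ dagger i = Q.actRight

/-- Morita equivalence: there are dagger bimodules `M` (from `A` to `B`) and `N` (from `B` to `A`)
for which the trivial bimodules `A` and `B` are relative tensor products `M ⊗_B N` and
`N ⊗_A M`, respectively. Relative tensor products are defined up to unitary bimodule isomorphism,
so this says that `M ⊗_B N ≅ A` and `N ⊗_A M ≅ B` unitarily as dagger bimodules. -/
def MoritaEquivalent (A B : Mon C) : Prop :=
  ∃ (M : Bimod A B) (N : Bimod B A), IsDaggerBimod M ∧ IsDaggerBimod N ∧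
    (∃ i, IsRelTensor M N (Bimod.regular A) i) ∧ ∃ j, IsRelTensor N M (Bimod.regular B) j

end MonoidalDaggerCategory

open MonoidalDaggerCategory

/-! ## The dual Hilbert space and endomorphism algebras -/

section Hilbert

variable {H : Type*} [NormedAddCommGroup H] [InnerProductSpace ℂ H] [FiniteDimensional ℂ H]

/-- The canonical inner product on the dual `H*` of a Hilbert space. -/
noncomputable instance dualInnerProductSpace : InnerProductSpace ℂ (StrongDual ℂ H) where
  inner f g := inner ℂ ((InnerProductSpace.toDual ℂ H).symm g)
    ((InnerProductSpace.toDual ℂ H).symm f)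
  norm_sq_eq_re_inner f := by
    rw [← (InnerProductSpace.toDual ℂ H).symm.norm_map f, norm_sq_eq_re_inner (𝕜 := ℂ)]
  conj_inner_symm f g := inner_conj_symm _ _
  add_left f g h := by rw [map_add, inner_add_right]
  smul_left f g r := by
    rw [LinearIsometryEquiv.map_smulₛₗ, inner_smul_right]

/-- The transpose `f ↦ f ∘ T` of a linear map. -/
noncomputable def dualTranspose (T : H →ₗ[ℂ] H) : StrongDual ℂ H →ₗ[ℂ] StrongDual ℂ H where
  toFun f := f ∘L LinearMap.toContinuousLinearMap T
  map_add' _ _ := by ext; simp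
  map_smul' _ _ := by ext; simp

@[simp] theorem dualTranspose_apply (T : H →ₗ[ℂ] H) (f : StrongDual ℂ H) (x : H) :
    dualTranspose T f x = f (T x) := rfl

theorem dualTranspose_one : dualTranspose (1 : H →ₗ[ℂ] H) = 1 := by
  ext; simp

theorem dualTranspose_zero : dualTranspose (0 : H →ₗ[ℂ] H) = 0 := by
  ext; simp

theorem dualTranspose_mul (S T : H →ₗ[ℂ] H) :
    dualTranspose (S * T) = dualTranspose T * dualTranspose S := by
  ext; simp

theorem dualTranspose_sum {J : Type*} (s : Finset J) (T : J → H →ₗ[ℂ] H) :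
    dualTranspose (∑ i ∈ s, T i) = ∑ i ∈ s, dualTranspose (T i) := by
  ext; simp [LinearMap.sum_apply]

theorem dualTranspose_smul (c : ℂ) (T : H →ₗ[ℂ] H) :
    dualTranspose (c • T) = c • dualTranspose T := by
  ext; simp

theorem dualTranspose_adjoint (T : H →ₗ[ℂ] H) :
    LinearMap.adjoint (dualTranspose T) = dualTranspose (LinearMap.adjoint T) := by
  symm
  rw [LinearMap.eq_adjoint_iff]
  have key : ∀ (S : H →ₗ[ℂ] H) (f : StrongDual ℂ H),
      (InnerProductSpace.toDual ℂ H).symm (dualTranspose S f) =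
        LinearMap.adjoint S ((InnerProductSpace.toDual ℂ H).symm f) := by
    intro S f
    refine ext_inner_right ℂ fun y => ?_
    rw [InnerProductSpace.toDual_symm_apply, LinearMap.adjoint_inner_left,
      InnerProductSpace.toDual_symm_apply, dualTranspose_apply]
  intro f g
  change inner ℂ ((InnerProductSpace.toDual ℂ H).symm g)
      ((InnerProductSpace.toDual ℂ H).symm (dualTranspose (LinearMap.adjoint T) f)) =
    inner ℂ ((InnerProductSpace.toDual ℂ H).symm (dualTranspose T g))
      ((InnerProductSpace.toDual ℂ H).symm f)
  rw [key, key, LinearMap.adjoint_adjoint, LinearMap.adjoint_inner_left]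

variable (H) in
/-- The identification of `H ⊗ H*` with `End(H)`, sending `x ⊗ f` to `y ↦ f(y) x`. -/
noncomputable def tensorDualEquivEnd : H ⊗[ℂ] StrongDual ℂ H ≃ₗ[ℂ] (H →ₗ[ℂ] H) :=
  (TensorProduct.comm ℂ H (StrongDual ℂ H)).trans
    ((TensorProduct.congr (LinearMap.toContinuousLinearMap (𝕜 := ℂ) (E := H) (F' := ℂ)).symm
      (LinearEquiv.refl ℂ H)).trans (dualTensorHomEquiv ℂ H H))

@[simp] theorem tensorDualEquivEnd_tmul (x : H) (f : StrongDual ℂ H) (y : H) :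
    tensorDualEquivEnd H (x ⊗ₜ f) y = f y • x := by
  simp [tensorDualEquivEnd]

theorem tensorDualEquivEnd_map (S T : H →ₗ[ℂ] H) (a : H ⊗[ℂ] StrongDual ℂ H) :
    tensorDualEquivEnd H (TensorProduct.map S (dualTranspose T) a) =
      S * tensorDualEquivEnd H a * T := by
  induction a with
  | zero => simp
  | tmul x f => ext y; simp
  | add a b ha hb => simp only [map_add, ha, hb, mul_add, add_mul]

variable (H) in
/-- The multiplication of the endomorphism algebra on `H ⊗ H*`: the middle factors `H* ⊗ H` are
contracted, with normalisation `1 / √(dim H)`. -/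
noncomputable def endMul :
    (H ⊗[ℂ] StrongDual ℂ H) ⊗[ℂ] (H ⊗[ℂ] StrongDual ℂ H) →ₗ[ℂ] H ⊗[ℂ] StrongDual ℂ H :=
  ((√(Module.finrank ℂ H) : ℝ) : ℂ)⁻¹ •
    ((tensorDualEquivEnd H).symm.toLinearMap ∘ₗ LinearMap.mul' ℂ (Module.End ℂ H) ∘ₗ
      TensorProduct.map (tensorDualEquivEnd H).toLinearMap (tensorDualEquivEnd H).toLinearMap)

theorem tensorDualEquivEnd_endMul (a b : H ⊗[ℂ] StrongDual ℂ H) :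
    tensorDualEquivEnd H (endMul H (a ⊗ₜ b)) =
      ((√(Module.finrank ℂ H) : ℝ) : ℂ)⁻¹ • (tensorDualEquivEnd H a * tensorDualEquivEnd H b) := by
  simp [endMul]

theorem endMul_tmul (x y : H) (f g : StrongDual ℂ H) :
    endMul H ((x ⊗ₜ f) ⊗ₜ (y ⊗ₜ g)) =
      (((√(Module.finrank ℂ H) : ℝ) : ℂ)⁻¹ * f y) • (x ⊗ₜ g) := by
  apply (tensorDualEquivEnd H).injective
  rw [tensorDualEquivEnd_endMul]
  ext z
  simp [smul_smul, mul_comm, mul_left_comm]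

variable (H) in
/-- The unit of the endomorphism algebra on `H ⊗ H*`: the vector corresponding to the identity of
`H`, with normalisation `√(dim H)`. -/
noncomputable def endUnit : H ⊗[ℂ] StrongDual ℂ H :=
  ((√(Module.finrank ℂ H) : ℝ) : ℂ) • (tensorDualEquivEnd H).symm 1

theorem tensorDualEquivEnd_endUnit :
    tensorDualEquivEnd H (endUnit H) = ((√(Module.finrank ℂ H) : ℝ) : ℂ) • 1 := by
  rw [endUnit, map_smul, LinearEquiv.apply_symm_apply]

variable (H) in
theorem sqrt_finrank_ne_zero [Nontrivial H] : ((√(Module.finrank ℂ H) : ℝ) : ℂ) ≠ 0 := by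
  have : 0 < Module.finrank ℂ H := Module.finrank_pos
  rw [Complex.ofReal_ne_zero]
  positivity

end Hilbert

/-! ## Graphs and quantum isomorphisms -/

/-- A finite graph. -/
structure FinGraph where
  V : Type u
  [fintype : Fintype V]
  graph : SimpleGraph V

attribute [instance] FinGraph.fintype

open scoped Classical in
/-- The adjacency matrix of a graph, with the convention that every vertex is adjacent to itself. -/
noncomputable def FinGraph.adj (G : FinGraph.{u}) (v w : G.V) : ℂ :=
  if v = w ∨ G.graph.Adj v w then 1 else 0

open scoped Classical in
/-- A quantum isomorphism `(H, P) : G ⟶ G'` between classical graphs: a finite-dimensional Hilbert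
space `H` together with a projective permutation matrix, that is a matrix of projectors on `H` whose
rows and columns are complete orthogonal families and which intertwines the adjacency matrices.
The projectors `P v w` are the components `⟨w| P |v⟩` of the linear map `H ⊗ V_G → V_G' ⊗ H`. The
space `H` may be zero here; quantum isomorphism of graphs requires a nonzero one. -/
structure QuantumIso (G G' : FinGraph.{u}) where
  H : Type
  [normed : NormedAddCommGroup H]
  [innerProduct : InnerProductSpace ℂ H]
  [finite : FiniteDimensional ℂ H]
  P : G.V → G'.V → (H →ₗ[ℂ] H)
  selfAdjoint : ∀ v w, LinearMap.adjoint (P v w) = P v w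
  row_orthogonal : ∀ v w₁ w₂, P v w₁ * P v w₂ = if w₁ = w₂ then P v w₁ else 0
  row_sum : ∀ v, ∑ w, P v w = 1
  col_orthogonal : ∀ v₁ v₂ w, P v₁ w * P v₂ w = if v₁ = v₂ then P v₁ w else 0
  col_sum : ∀ w, ∑ v, P v w = 1
  intertwines : ∀ v w, ∑ v', G.adj v v' • P v' w = ∑ w', G'.adj w' w • P v w'

attribute [instance] QuantumIso.normed QuantumIso.innerProduct QuantumIso.finite

/-- Two graphs are quantum isomorphic if there is a quantum isomorphism on a nonzero space. -/
def QuantumIsomorphic (G G' : FinGraph.{u}) : Prop := ∃ P : QuantumIso G G', Nontrivial P.H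

theorem FinGraph.adj_symm (G : FinGraph.{u}) (v w : G.V) : G.adj v w = G.adj w v := by
  have h : (v = w ∨ G.graph.Adj v w) ↔ (w = v ∨ G.graph.Adj w v) := by
    rw [G.graph.adj_comm, eq_comm]
  classical
  unfold FinGraph.adj
  exact if_congr h rfl rfl

namespace QuantumIso

variable {G₁ G₂ G₃ : FinGraph.{u}}

/-- The composite `Q ∘ P`, on the space `H_Q ⊗ H_P`. -/
noncomputable def comp (P : QuantumIso G₁ G₂) (Q : QuantumIso G₂ G₃) : QuantumIso G₁ G₃ where
  H := Q.H ⊗[ℂ] P.H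
  P v w := ∑ x, TensorProduct.map (Q.P x w) (P.P v x)
  selfAdjoint v w := by
    simp [map_sum, TensorProduct.adjoint_map, P.selfAdjoint, Q.selfAdjoint]
  row_orthogonal v w₁ w₂ := by
    classical
    simp only [Finset.sum_mul_sum, ← TensorProduct.map_mul, P.row_orthogonal]
    have : ∀ x y : G₂.V, TensorProduct.map (Q.P x w₁ * Q.P y w₂) (if x = y then P.P v x else 0) =
        if x = y then TensorProduct.map (Q.P x w₁ * Q.P x w₂) (P.P v x) else 0 := by
      intro x y
      split_ifs with h
      · rw [h]
      · simp
    simp only [this, Finset.sum_ite_eq, Finset.mem_univ, if_true, Q.row_orthogonal]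
    split_ifs with h
    · rfl
    · simp
  row_sum v := by
    rw [Finset.sum_comm]
    have : ∀ x, ∑ w, TensorProduct.map (Q.P x w) (P.P v x) =
        TensorProduct.map 1 (P.P v x) := by
      intro x
      rw [← Q.row_sum x]
      exact (map_sum ((TensorProduct.mapBilinear (.id ℂ) Q.H P.H Q.H P.H).flip (P.P v x)) _ _).symm
    simp only [this]
    have h2 := (map_sum (TensorProduct.mapBilinear (.id ℂ) Q.H P.H Q.H P.H 1)
      (fun x => P.P v x) Finset.univ).symm
    rw [P.row_sum] at h2
    exact h2.trans TensorProduct.map_one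
  col_orthogonal v₁ v₂ w := by
    classical
    simp only [Finset.sum_mul_sum, ← TensorProduct.map_mul, Q.col_orthogonal]
    have : ∀ x y : G₂.V, TensorProduct.map (if x = y then Q.P x w else 0) (P.P v₁ x * P.P v₂ y) =
        if x = y then TensorProduct.map (Q.P x w) (P.P v₁ x * P.P v₂ x) else 0 := by
      intro x y
      split_ifs with h
      · rw [h]
      · simp
    simp only [this, Finset.sum_ite_eq, Finset.mem_univ, if_true, P.col_orthogonal]
    split_ifs with h
    · rfl
    · simp
  col_sum w := by
    rw [Finset.sum_comm]
    have : ∀ x, ∑ v, TensorProduct.map (Q.P x w) (P.P v x) =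
        TensorProduct.map (Q.P x w) 1 := by
      intro x
      rw [← P.col_sum x]
      exact (map_sum (TensorProduct.mapBilinear (.id ℂ) Q.H P.H Q.H P.H (Q.P x w)) _ _).symm
    simp only [this]
    have h2 := (map_sum ((TensorProduct.mapBilinear (.id ℂ) Q.H P.H Q.H P.H).flip 1)
      (fun x => Q.P x w) Finset.univ).symm
    rw [Q.col_sum] at h2
    exact h2.trans TensorProduct.map_one
  intertwines v w := by
    have h1 : ∀ x, ∑ v', G₁.adj v v' • TensorProduct.map (Q.P x w) (P.P v' x) =
        ∑ y, G₂.adj y x • TensorProduct.map (Q.P x w) (P.P v y) := by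
      intro x
      have := congrArg (TensorProduct.mapBilinear (.id ℂ) Q.H P.H Q.H P.H (Q.P x w))
        (P.intertwines v x)
      simpa [map_sum] using this
    have h2 : ∀ y, ∑ x, G₂.adj y x • TensorProduct.map (Q.P x w) (P.P v y) =
        ∑ w', G₃.adj w' w • TensorProduct.map (Q.P y w') (P.P v y) := by
      intro y
      have := congrArg ((TensorProduct.mapBilinear (.id ℂ) Q.H P.H Q.H P.H).flip (P.P v y))
        (Q.intertwines y w)
      simpa [map_sum] using this
    simp only [Finset.smul_sum]
    rw [Finset.sum_comm]
    simp only [h1]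
    rw [Finset.sum_comm]
    simp only [h2]
    rw [Finset.sum_comm]

/-- The dual `P̄ : G₂ ⟶ G₁` of a quantum isomorphism, on the dual space: its components are the
transposes of the components of the adjoint of `P`. -/
noncomputable def dual (P : QuantumIso G₁ G₂) : QuantumIso G₂ G₁ where
  H := StrongDual ℂ P.H
  P w v := dualTranspose (LinearMap.adjoint (P.P v w))
  selfAdjoint w v := by rw [dualTranspose_adjoint, P.selfAdjoint, P.selfAdjoint]
  row_orthogonal w v₁ v₂ := by
    classical
    rw [P.selfAdjoint, P.selfAdjoint, ← dualTranspose_mul, P.col_orthogonal]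
    by_cases h : v₁ = v₂
    · simp [h]
    · simp [h, Ne.symm h, dualTranspose_zero]
  row_sum w := by
    simp only [P.selfAdjoint]
    rw [← dualTranspose_sum, P.col_sum, dualTranspose_one]
  col_orthogonal w₁ w₂ v := by
    classical
    rw [P.selfAdjoint, P.selfAdjoint, ← dualTranspose_mul, P.row_orthogonal]
    by_cases h : w₁ = w₂
    · simp [h]
    · simp [h, Ne.symm h, dualTranspose_zero]
  col_sum v := by
    simp only [P.selfAdjoint]
    rw [← dualTranspose_sum, P.row_sum, dualTranspose_one]
  intertwines w v := by
    have h := congrArg dualTranspose (P.intertwines v w)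
    simp only [dualTranspose_sum, dualTranspose_smul] at h
    simp only [P.selfAdjoint]
    rw [Finset.sum_congr rfl fun w' _ => by rw [G₂.adj_symm w w'], ← h]
    exact Finset.sum_congr rfl fun v' _ => by rw [G₁.adj_symm v v']

open scoped Classical in
/-- The identity quantum isomorphism, on the space `ℂ`. -/
noncomputable def id (G : FinGraph.{u}) : QuantumIso G G where
  H := ℂ
  P v w := if v = w then 1 else 0
  selfAdjoint v w := by split_ifs <;> simp
  row_orthogonal v w₁ w₂ := by
    by_cases h1 : v = w₁ <;> by_cases h2 : w₁ = w₂ <;> simp_all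
  row_sum v := by simp
  col_orthogonal v₁ v₂ w := by
    by_cases h1 : v₁ = w <;> by_cases h2 : v₁ = v₂ <;> simp_all
    intro h; exact absurd h.symm h2
  col_sum w := by simp
  intertwines v w := by simp

/-! ### Intertwiners and the monoidal dagger category of quantum automorphisms -/

/-- An intertwiner of quantum isomorphisms. -/
@[ext]
structure Hom (X Y : QuantumIso G₁ G₂) where
  lin : X.H →ₗ[ℂ] Y.H
  comm : ∀ v w, Y.P v w ∘ₗ lin = lin ∘ₗ X.P v w

noncomputable instance : Category (QuantumIso G₁ G₂) where
  Hom X Y := Hom X Y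
  id X := ⟨LinearMap.id, fun _ _ => rfl⟩
  comp f g := ⟨g.lin ∘ₗ f.lin, fun v w => by
    rw [← LinearMap.comp_assoc, g.comm, LinearMap.comp_assoc, f.comm, LinearMap.comp_assoc]⟩

@[simp] theorem id_lin (X : QuantumIso G₁ G₂) : Hom.lin (𝟙 X) = LinearMap.id := rfl

@[simp] theorem comp_lin {X Y Z : QuantumIso G₁ G₂} (f : X ⟶ Y) (g : Y ⟶ Z) :
    Hom.lin (f ≫ g) = Hom.lin g ∘ₗ Hom.lin f := rfl

@[ext] theorem hom_ext {X Y : QuantumIso G₁ G₂} {f g : X ⟶ Y} (h : Hom.lin f = Hom.lin g) :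
    f = g := Hom.ext h

/-- The adjoint of an intertwiner. -/
noncomputable def Hom.adjoint {X Y : QuantumIso G₁ G₂} (f : X ⟶ Y) : Y ⟶ X where
  lin := LinearMap.adjoint (Hom.lin f)
  comm v w := by
    have h := congrArg LinearMap.adjoint (Hom.comm f v w)
    rw [LinearMap.adjoint_comp, LinearMap.adjoint_comp, X.selfAdjoint, Y.selfAdjoint] at h
    exact h.symm

/-- An isomorphism built from a linear isomorphism that intertwines the projectors. -/
noncomputable def isoOfLinearEquiv {X Y : QuantumIso G₁ G₂} (e : X.H ≃ₗ[ℂ] Y.H)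
    (h : ∀ v w, Y.P v w ∘ₗ e.toLinearMap = e.toLinearMap ∘ₗ X.P v w) : X ≅ Y where
  hom := ⟨e.toLinearMap, h⟩
  inv := ⟨e.symm.toLinearMap, fun v w => by
    ext y
    have := congrArg e.symm (LinearMap.congr_fun (h v w) (e.symm y))
    simpa using this.symm⟩
  hom_inv_id := by ext; simp
  inv_hom_id := by ext; simp

end QuantumIso

/-- Quantum automorphisms of a graph, the objects of `QAut(G)`. -/
abbrev QAut (G : FinGraph.{u}) := QuantumIso G G

namespace QAut

variable {G : FinGraph.{u}}

open QuantumIso MonObj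

theorem sum_comp_lin {E F K : Type*} [AddCommGroup E] [Module ℂ E] [AddCommGroup F] [Module ℂ F]
    [AddCommGroup K] [Module ℂ K] {J : Type*} (s : Finset J) (T : J → F →ₗ[ℂ] K) (S : E →ₗ[ℂ] F) :
    (∑ i ∈ s, T i) ∘ₗ S = ∑ i ∈ s, T i ∘ₗ S := by
  ext; simp

theorem comp_sum_lin {E F K : Type*} [AddCommGroup E] [Module ℂ E] [AddCommGroup F] [Module ℂ F]
    [AddCommGroup K] [Module ℂ K] {J : Type*} (s : Finset J) (S : F →ₗ[ℂ] K) (T : J → E →ₗ[ℂ] F) :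
    S ∘ₗ (∑ i ∈ s, T i) = ∑ i ∈ s, S ∘ₗ T i := by
  ext; simp

theorem map_sum_left {H H' : Type*} [AddCommGroup H] [Module ℂ H] [AddCommGroup H'] [Module ℂ H']
    {J : Type*} (s : Finset J) (T : J → H →ₗ[ℂ] H) (S : H' →ₗ[ℂ] H') :
    TensorProduct.map (∑ i ∈ s, T i) S = ∑ i ∈ s, TensorProduct.map (T i) S :=
  map_sum ((TensorProduct.mapBilinear (.id ℂ) H H' H H').flip S) _ _

theorem map_sum_right {H H' : Type*} [AddCommGroup H] [Module ℂ H] [AddCommGroup H'] [Module ℂ H']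
    {J : Type*} (s : Finset J) (S : H →ₗ[ℂ] H) (T : J → H' →ₗ[ℂ] H') :
    TensorProduct.map S (∑ i ∈ s, T i) = ∑ i ∈ s, TensorProduct.map S (T i) :=
  map_sum (TensorProduct.mapBilinear (.id ℂ) H H' H H' S) _ _

/-- The tensor product of quantum automorphisms is composition, and the tensor product of
intertwiners is the tensor product of the underlying linear maps. -/
noncomputable def tensorHom {X Y X' Y' : QAut G} (f : X ⟶ Y) (g : X' ⟶ Y') :
    QuantumIso.comp X' X ⟶ QuantumIso.comp Y' Y where
  lin := TensorProduct.map (Hom.lin f) (Hom.lin g)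
  comm v w := by
    change (∑ x, TensorProduct.map (Y.P x w) (Y'.P v x)) ∘ₗ _ =
      _ ∘ₗ (∑ x, TensorProduct.map (X.P x w) (X'.P v x))
    refine (sum_comp_lin _ _ _).trans (Eq.trans ?_ (comp_sum_lin _ _ _).symm)
    refine Finset.sum_congr rfl fun x _ => ?_
    rw [← TensorProduct.map_comp, ← TensorProduct.map_comp, Hom.comm f, Hom.comm g]

theorem assoc_intertwines {G : FinGraph.{u}} {E F K : Type*} [AddCommGroup E] [Module ℂ E]
    [AddCommGroup F] [Module ℂ F] [AddCommGroup K] [Module ℂ K] (S : G.V → E →ₗ[ℂ] E)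
    (T : G.V → G.V → F →ₗ[ℂ] F) (U : G.V → K →ₗ[ℂ] K) :
    (∑ x, TensorProduct.map (S x) (∑ y, TensorProduct.map (T y x) (U y))) ∘ₗ
        (TensorProduct.assoc ℂ E F K).toLinearMap =
      (TensorProduct.assoc ℂ E F K).toLinearMap ∘ₗ
        (∑ y, TensorProduct.map (∑ x, TensorProduct.map (S x) (T y x)) (U y)) := by
  simp only [map_sum_left, map_sum_right]
  rw [Finset.sum_comm]
  simp only [sum_comp_lin, comp_sum_lin]
  refine Finset.sum_congr rfl fun y _ => Finset.sum_congr rfl fun x _ => ?_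
  exact TensorProduct.ext_threefold fun a b c => rfl

/-- The associator. -/
noncomputable def assocIso (X Y Z : QAut G) :
    QuantumIso.comp Z (QuantumIso.comp Y X) ≅ QuantumIso.comp (QuantumIso.comp Z Y) X :=
  isoOfLinearEquiv (TensorProduct.assoc ℂ X.H Y.H Z.H) fun v w =>
    assoc_intertwines (fun x => X.P x w) (fun y x => Y.P y x) (fun y => Z.P v y)

open scoped Classical in
theorem lid_intertwines {G : FinGraph.{u}} {E : Type*} [AddCommGroup E] [Module ℂ E]
    (w : G.V) (S : G.V → E →ₗ[ℂ] E) :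
    S w ∘ₗ (TensorProduct.lid ℂ E).toLinearMap = (TensorProduct.lid ℂ E).toLinearMap ∘ₗ
      (∑ x, TensorProduct.map (if x = w then (1 : ℂ →ₗ[ℂ] ℂ) else 0) (S x)) := by
  rw [Finset.sum_eq_single w (fun x _ hx => by simp [hx]) (by simp)]
  refine TensorProduct.ext' fun a b => ?_
  simp

open scoped Classical in
theorem rid_intertwines {G : FinGraph.{u}} {E : Type*} [AddCommGroup E] [Module ℂ E]
    (v : G.V) (S : G.V → E →ₗ[ℂ] E) :
    S v ∘ₗ (TensorProduct.rid ℂ E).toLinearMap = (TensorProduct.rid ℂ E).toLinearMap ∘ₗ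
      (∑ x, TensorProduct.map (S x) (if v = x then (1 : ℂ →ₗ[ℂ] ℂ) else 0)) := by
  rw [Finset.sum_eq_single v (fun x _ hx => by simp [Ne.symm hx]) (by simp)]
  refine TensorProduct.ext' fun a b => ?_
  simp

/-- The left unitor. -/
noncomputable def leftIso (X : QAut G) : QuantumIso.comp X (QuantumIso.id G) ≅ X :=
  isoOfLinearEquiv (TensorProduct.lid ℂ X.H) fun v w => lid_intertwines w (X.P v)

/-- The right unitor. -/
noncomputable def rightIso (X : QAut G) : QuantumIso.comp (QuantumIso.id G) X ≅ X :=
  isoOfLinearEquiv (TensorProduct.rid ℂ X.H) fun v w => rid_intertwines v fun x => X.P x w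

noncomputable instance : MonoidalCategory (QAut G) where
  tensorObj X Y := QuantumIso.comp Y X
  whiskerLeft X _ _ f := tensorHom (𝟙 X) f
  whiskerRight f Y := tensorHom f (𝟙 Y)
  tensorHom f g := tensorHom f g
  tensorUnit := QuantumIso.id G
  associator X Y Z := assocIso X Y Z
  leftUnitor X := leftIso X
  rightUnitor X := rightIso X
  tensorHom_def _ _ := hom_ext (TensorProduct.ext' fun _ _ => rfl)
  id_tensorHom_id _ _ := hom_ext (TensorProduct.ext' fun _ _ => rfl)
  tensorHom_comp_tensorHom _ _ _ _ := hom_ext (TensorProduct.ext' fun _ _ => rfl)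
  whiskerLeft_id _ _ := hom_ext (TensorProduct.ext' fun _ _ => rfl)
  id_whiskerRight _ _ := hom_ext (TensorProduct.ext' fun _ _ => rfl)
  associator_naturality _ _ _ := hom_ext (TensorProduct.ext_threefold fun _ _ _ => rfl)
  leftUnitor_naturality f := hom_ext (TensorProduct.ext' fun a b =>
    ((Hom.lin f).map_smul (a : ℂ) b).symm)
  rightUnitor_naturality f := hom_ext (TensorProduct.ext' fun a b =>
    ((Hom.lin f).map_smul (b : ℂ) a).symm)
  pentagon _ _ _ _ := hom_ext (TensorProduct.ext_fourfold fun _ _ _ _ => rfl)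
  triangle _ _ := hom_ext (TensorProduct.ext_threefold fun a b c =>
    have h : ∀ r : ℂ, a ⊗ₜ[ℂ] (r • c) = (r • a) ⊗ₜ[ℂ] c :=
      fun r => (TensorProduct.smul_tmul r a c).symm
    h b)

noncomputable instance : MonoidalDaggerCategory (QAut G) where
  dagger f := Hom.adjoint f
  dagger_id _ := hom_ext LinearMap.adjoint_id
  dagger_comp _ _ := hom_ext (LinearMap.adjoint_comp _ _)
  dagger_dagger _ := hom_ext (LinearMap.adjoint_adjoint _)
  dagger_tensorHom _ _ := hom_ext (TensorProduct.adjoint_map _ _)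
  dagger_associator X Y Z := hom_ext
    (LinearIsometryEquiv.adjoint_toLinearMap_eq_symm (TensorProduct.assocIsometry ℂ X.H Y.H Z.H))
  dagger_leftUnitor X := hom_ext
    (LinearIsometryEquiv.adjoint_toLinearMap_eq_symm (TensorProduct.lidIsometry ℂ X.H))
  dagger_rightUnitor X := hom_ext
    (LinearIsometryEquiv.adjoint_toLinearMap_eq_symm (TensorProduct.ridIsometry ℂ X.H))

/-! ### Simple dagger Frobenius monoids -/

/-- An identification of the underlying algebra of a monoid in `QAut(G)` with the endomorphism
algebra of a nonzero Hilbert space `K`: a unitary map that preserves multiplication and unit (and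
hence, by unitarity, also comultiplication, counit and involution). -/
structure EndIdentification (A : Mon (QAut G)) where
  K : Type
  [normed : NormedAddCommGroup K]
  [innerProduct : InnerProductSpace ℂ K]
  [finite : FiniteDimensional ℂ K]
  [nontrivial : Nontrivial K]
  equiv : A.X.H ≃ₗᵢ[ℂ] K ⊗[ℂ] StrongDual ℂ K
  map_mul : ∀ a b : A.X.H, equiv (Hom.lin μ[A.X] (a ⊗ₜ[ℂ] b)) = endMul K (equiv a ⊗ₜ[ℂ] equiv b)
  map_one : equiv (Hom.lin η[A.X] (1 : ℂ)) = endUnit K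

attribute [instance] EndIdentification.normed EndIdentification.innerProduct EndIdentification.finite
  EndIdentification.nontrivial

/-- A simple dagger Frobenius monoid in `QAut(G)`: a dagger Frobenius monoid whose underlying
algebra is `*`-isomorphic to an endomorphism algebra. -/
structure IsSimpleDaggerFrobenius (A : Mon (QAut G)) : Prop where
  frobenius : IsDaggerFrobenius A
  simple : Nonempty (EndIdentification A)

namespace EndIdentification

variable {A : Mon (QAut G)} (e : EndIdentification A)

/-- The diagonal component `X_{v,v}`, as an operator on `K ⊗ K*`. -/
noncomputable def diag (v : G.V) :
    e.K ⊗[ℂ] StrongDual ℂ e.K →ₗ[ℂ] e.K ⊗[ℂ] StrongDual ℂ e.K :=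
  e.equiv.toLinearEquiv.toLinearMap ∘ₗ A.X.P v v ∘ₗ e.equiv.symm.toLinearEquiv.toLinearMap

/-- The vector `|a⟩ ⊗ ⟨b|` of `K ⊗ K*` for an orthonormal basis of `K`. -/
noncomputable def ketBra (a b : Fin (Module.finrank ℂ e.K)) : e.K ⊗[ℂ] StrongDual ℂ e.K :=
  stdOrthonormalBasis ℂ e.K a ⊗ₜ[ℂ]
    InnerProductSpace.toDual ℂ e.K (stdOrthonormalBasis ℂ e.K b)

/-- The matrix entry of `X_{v,v}` from the basis vector `|c⟩ ⊗ ⟨d|` to `|a⟩ ⊗ ⟨b|`. -/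
noncomputable def entry (v : G.V) (a b c d : Fin (Module.finrank ℂ e.K)) : ℂ :=
  inner ℂ (e.ketBra a b) (e.diag v (e.ketBra c d))

/-- The expression for the dimension of the centre: for each vertex `v` two copies of `X_{v,v}` are
contracted along the wires of `K` and `K*`. The `K`-output of the second copy is joined to the
`K`-input of the first, the `K`-output of the first to the `K*`-output of the second, the
`K*`-input of the first to the `K`-input of the second, and the `K*`-output of the first to the
`K*`-input of the second. -/
noncomputable def centreDim : ℂ :=
  (Module.finrank ℂ e.K : ℂ)⁻¹ *
    ∑ v, ∑ a, ∑ b, ∑ c, ∑ d, e.entry v a b c d * e.entry v c a d b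

end EndIdentification

/-- The simple dagger Frobenius monoids for which the expression for the dimension of the centre
equals the number of vertices. (The value of the expression does not depend on the choice of the
identification with an endomorphism algebra.) -/
structure IsCommutativeSimple (A : Mon (QAut G)) : Prop extends IsSimpleDaggerFrobenius A where
  centreDim_eq : ∃ e : EndIdentification A, e.centreDim = (Fintype.card G.V : ℂ)

end QAut

/-! ### The Frobenius monoid of a quantum isomorphism -/

namespace QuantumIso

variable {G G' : FinGraph.{u}}

/-- The components of `P ∘ P̄`, as operators on `H ⊗ H*`. -/
theorem comp_dual_apply (P : QuantumIso G' G) (v w : G.V) (a : P.H ⊗[ℂ] StrongDual ℂ P.H) :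
    tensorDualEquivEnd P.H
        ((∑ x, TensorProduct.map (P.P x w) (dualTranspose (LinearMap.adjoint (P.P x v)))) a) =
      ∑ x, P.P x w * tensorDualEquivEnd P.H a * P.P x v := by
  rw [LinearMap.sum_apply, map_sum]
  refine Finset.sum_congr rfl fun x _ => ?_
  rw [tensorDualEquivEnd_map, P.selfAdjoint]

theorem endMul_intertwines (P : QuantumIso G' G) (v w : G.V) (T : G.V → G.V →
      P.H ⊗[ℂ] StrongDual ℂ P.H →ₗ[ℂ] P.H ⊗[ℂ] StrongDual ℂ P.H)
    (hT : ∀ v w, T v w =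
      ∑ x, TensorProduct.map (P.P x w) (dualTranspose (LinearMap.adjoint (P.P x v)))) :
    T v w ∘ₗ endMul P.H = endMul P.H ∘ₗ ∑ z, TensorProduct.map (T z w) (T v z) := by
  classical
  refine TensorProduct.ext' fun a b => ?_
  apply (tensorDualEquivEnd P.H).injective
  rw [LinearMap.comp_apply, LinearMap.comp_apply, LinearMap.sum_apply, map_sum, map_sum, hT,
    comp_dual_apply, tensorDualEquivEnd_endMul]
  simp only [TensorProduct.map_tmul, tensorDualEquivEnd_endMul, hT, comp_dual_apply]
  rw [← Finset.smul_sum]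
  simp only [mul_smul_comm, smul_mul_assoc]
  rw [← Finset.smul_sum]
  congr 1
  have h : ∀ z : G.V, (∑ x, P.P x w * tensorDualEquivEnd P.H a * P.P x z) *
      (∑ y, P.P y z * tensorDualEquivEnd P.H b * P.P y v) =
      ∑ x, P.P x w * tensorDualEquivEnd P.H a * P.P x z * tensorDualEquivEnd P.H b * P.P x v := by
    intro z
    rw [Finset.sum_mul_sum]
    refine Finset.sum_congr rfl fun x _ => ?_
    rw [Finset.sum_eq_single x]
    · rw [mul_assoc (P.P x w * tensorDualEquivEnd P.H a) (P.P x z), ← mul_assoc (P.P x z),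
        ← mul_assoc (P.P x z), P.col_orthogonal, if_pos rfl]
      simp only [mul_assoc]
    · intro y _ hy
      rw [mul_assoc (P.P x w * tensorDualEquivEnd P.H a) (P.P x z), ← mul_assoc (P.P x z),
        ← mul_assoc (P.P x z), P.col_orthogonal, if_neg (Ne.symm hy)]
      simp
    · simp
  rw [Finset.sum_congr rfl fun z _ => h z, Finset.sum_comm]
  refine Finset.sum_congr rfl fun x _ => ?_
  rw [← Finset.sum_mul, ← Finset.sum_mul, ← Finset.mul_sum, P.row_sum, mul_one]
  simp only [mul_assoc]

open scoped Classical in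
theorem endUnit_intertwines (P : QuantumIso G' G) (v w : G.V) :
    (∑ x, TensorProduct.map (P.P x w) (dualTranspose (LinearMap.adjoint (P.P x v)))) ∘ₗ
        LinearMap.toSpanSingleton ℂ _ (endUnit P.H) =
      LinearMap.toSpanSingleton ℂ _ (endUnit P.H) ∘ₗ
        (if v = w then (1 : ℂ →ₗ[ℂ] ℂ) else 0) := by
  refine LinearMap.ext_ring ?_
  rw [LinearMap.comp_apply, LinearMap.comp_apply, LinearMap.toSpanSingleton_apply, one_smul]
  apply (tensorDualEquivEnd P.H).injective
  rw [comp_dual_apply, tensorDualEquivEnd_endUnit]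
  simp only [mul_smul_comm, smul_mul_assoc, mul_one, P.row_orthogonal]
  rw [← Finset.smul_sum]
  by_cases h : v = w
  · subst h
    simp [P.col_sum, tensorDualEquivEnd_endUnit]
  · simp [h, Ne.symm h]

/-- The multiplication `(H ⊗ H*) ⊗ (H ⊗ H*) ⟶ H ⊗ H*` as an intertwiner for `P ∘ P̄`. -/
noncomputable def endMulHom (P : QuantumIso G' G) :
    QuantumIso.comp (QuantumIso.comp P.dual P) (QuantumIso.comp P.dual P) ⟶
      QuantumIso.comp P.dual P where
  lin := endMul P.H
  comm v w := endMul_intertwines P v w (QuantumIso.comp P.dual P).P fun _ _ => rfl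

/-- The unit `ℂ ⟶ H ⊗ H*` as an intertwiner for `P ∘ P̄`. -/
noncomputable def endUnitHom (P : QuantumIso G' G) :
    QuantumIso.id G ⟶ QuantumIso.comp P.dual P where
  lin := LinearMap.toSpanSingleton ℂ _ (endUnit P.H)
  comm v w := endUnit_intertwines P v w

theorem endMul_endUnit_left {H : Type*} [NormedAddCommGroup H] [InnerProductSpace ℂ H]
    [FiniteDimensional ℂ H] [Nontrivial H] (r : ℂ) (a : H ⊗[ℂ] StrongDual ℂ H) :
    endMul H ((r • endUnit H) ⊗ₜ a) = r • a := by
  apply (tensorDualEquivEnd H).injective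
  rw [tensorDualEquivEnd_endMul, map_smul, map_smul, tensorDualEquivEnd_endUnit]
  simp only [smul_mul_assoc, one_mul]
  rw [smul_comm, inv_smul_smul₀ (sqrt_finrank_ne_zero H)]

theorem endMul_endUnit_right {H : Type*} [NormedAddCommGroup H] [InnerProductSpace ℂ H]
    [FiniteDimensional ℂ H] [Nontrivial H] (r : ℂ) (a : H ⊗[ℂ] StrongDual ℂ H) :
    endMul H (a ⊗ₜ (r • endUnit H)) = r • a := by
  apply (tensorDualEquivEnd H).injective
  rw [tensorDualEquivEnd_endMul, map_smul, map_smul, tensorDualEquivEnd_endUnit]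
  simp only [mul_smul_comm, mul_one]
  rw [smul_comm, inv_smul_smul₀ (sqrt_finrank_ne_zero H)]

theorem endMul_assoc {H : Type*} [NormedAddCommGroup H] [InnerProductSpace ℂ H]
    [FiniteDimensional ℂ H] (a b c : H ⊗[ℂ] StrongDual ℂ H) :
    endMul H (endMul H (a ⊗ₜ b) ⊗ₜ c) = endMul H (a ⊗ₜ endMul H (b ⊗ₜ c)) := by
  apply (tensorDualEquivEnd H).injective
  simp only [tensorDualEquivEnd_endMul, smul_mul_assoc, mul_smul_comm, mul_assoc]

/-- The endomorphism algebra of `H`, as a monoid on `(H ⊗ H*, P ∘ P̄)`, for a quantum isomorphism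
`(H, P)` into `G` with `H` nonzero. -/
noncomputable def endMon (P : QuantumIso G' G) [Nontrivial P.H] : Mon (QAut G) where
  X := QuantumIso.comp P.dual P
  mon :=
    { one := P.endUnitHom
      mul := P.endMulHom
      one_mul := hom_ext (TensorProduct.ext' fun r a => endMul_endUnit_left (H := P.H) r a)
      mul_one := hom_ext (TensorProduct.ext' fun a r => endMul_endUnit_right (H := P.H) r a)
      mul_assoc := hom_ext (TensorProduct.ext_threefold fun a b c =>
        endMul_assoc (H := P.H) a b c) }

end QuantumIso

/-! ## The two sets in bijection -/

/-- The graphs that admit a quantum isomorphism to `G`. -/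
def QuantumIsomorphicGraph (G : FinGraph.{u}) := {G' : FinGraph.{u} // QuantumIsomorphic G' G}

/-- Isomorphism of graphs, on the graphs that admit a quantum isomorphism to `G`. -/
instance graphIsoSetoid (G : FinGraph.{u}) : Setoid (QuantumIsomorphicGraph G) where
  r A B := Nonempty (A.1.graph ≃g B.1.graph)
  iseqv :=
    { refl := fun _ => ⟨SimpleGraph.Iso.refl⟩
      symm := fun ⟨f⟩ => ⟨f.symm⟩
      trans := fun ⟨f⟩ ⟨g⟩ => ⟨f.trans g⟩ }

/-- The simple dagger Frobenius monoids in `QAut(G)` for which the expression for the dimension of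
the centre equals the number of vertices of `G`. -/
def CommutativeSimpleMonoid (G : FinGraph.{u}) :=
  {A : Mon (QAut G) // QAut.IsCommutativeSimple A}

/-! ## Actions of a graph on a matrix algebra -/

/-! Everything rests on two facts. First, a simple monoid `A` with d(A) = |V| is the endomorphism
algebra of some quantum isomorphism G' → G (`exists_realization`). Second, if `A` and `B` are
realized in this way from graphs G₁ and G₂, then they are Morita equivalent exactly when G₁ ≅ G₂
(`moritaEquivalent_iff_nonempty_iso`). Together with d = |V| for every realized monoid
(`Realization.centreDim_eq_card`), these give the equivalence relation, the independence of choices,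
and the bijection.

For the first fact, identify `A` with M_n. The blocks X_{v,w}(a), with w as row and v as column,
form a *-representation of M_n on ℂ^V ⊗ ℂ^n. The block-diagonal operators c = (c_v) commuting with
it form a *-algebra, `centralizer`. The same condition says that c, stacked as a column, intertwines
the standard representation with this one, so the algebra is also a multiplicity space. It is
spanned by explicit families K_k satisfying n X_{v,w}(m) = ∑_k K_k(w) m K_k(v)*. This Kraus formula
gives ∑_{v,i,j} ‖[K_i(v), K_j(v)]‖² = 2n³(|V| − d(A)) in Hilbert–Schmidt norm, so d(A) = |V| forces
commutativity. A commutative *-algebra of matrices is ℂ^J, and its minimal projections e_x, x ∈ J,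
have components e_x(v) that form a projective permutation matrix with X_{v,w}(a) = ∑_x e_x(w) a
e_x(v). The adjacency matrix of G acts on the centralizer; in the basis (e_x) it becomes a symmetric
0/1 matrix with unit diagonal, which is the graph G' on J.

For the second fact, let `A` and `B` be realized on H and K from the same graph. Then H ⊗ K* and K ⊗
H* are mutually inverse bimodules: contracting K* ⊗ K, divided by √(dim K), exhibits H ⊗ H* as their
relative tensor product (`isRelTensor_linkBimod`). Conversely, M ⊗_B N ≅ A leaves only scalar
bimodule endomorphisms of M (`eq_smul_one_of_isRelTensor`). Combining the components of M with the
two realizations gives operators L_{x,y} on M that commute with both actions. Hence they are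
scalars, and these scalars form a permutation matrix intertwining the adjacency matrices, that is, a
graph isomorphism G₁ ≅ G₂ (`nonempty_iso_of_intertwiner`). -/

/-- The components, in matrix coordinates, of a quantum automorphism of `G` for which the
multiplication and the unit of a full matrix algebra are intertwiners. -/
structure MatrixAction (G : FinGraph.{u}) (ι : Type*) [Fintype ι] [DecidableEq ι] where
  X : G.V → G.V → Matrix ι ι ℂ →ₗ[ℂ] Matrix ι ι ℂ
  apply_mul : ∀ v w a b, X v w (a * b) = ∑ z, X z w a * X v z b
  apply_one_same : ∀ v, X v v 1 = 1
  trace_adjoint : ∀ v w a b, (a.conjTranspose * X v w b).trace = ((X v w a).conjTranspose * b).trace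
  apply_apply_same : ∀ v w a, X v w (X v w a) = X v w a
  row_orthogonal : ∀ v w₁ w₂ a, w₁ ≠ w₂ → X v w₁ (X v w₂ a) = 0
  col_orthogonal : ∀ v₁ v₂ w a, v₁ ≠ v₂ → X v₁ w (X v₂ w a) = 0
  col_sum : ∀ w a, ∑ v, X v w a = a
  intertwines : ∀ v w a, ∑ v', G.adj v v' • X v' w a = ∑ w', G.adj w' w • X v w' a

namespace MatrixAction

open Matrix
open scoped ComplexOrder

variable {G : FinGraph.{u}} {ι : Type} [Fintype ι] [DecidableEq ι] (A : MatrixAction G ι)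

theorem trace_apply_same (v : G.V) (a : Matrix ι ι ℂ) : (A.X v v a).trace = a.trace := by
  simpa [A.apply_one_same] using A.trace_adjoint v v 1 a

/-- Applying `X w w` to a product does not change its trace. After expansion by multiplicativity,
column orthogonality (for the left side) or row orthogonality (for the right side) leaves one term,
and both sides become the trace of `X z w a * X w z b`. -/
theorem trace_apply_mul (z w : G.V) (a b : Matrix ι ι ℂ) :
    (A.X z w a * b).trace = (a * A.X w z b).trace := by
  have h1 : (A.X z w a * b).trace = (A.X z w a * A.X w z b).trace := by
    rw [← A.trace_apply_same w, A.apply_mul, Finset.sum_eq_single z, A.apply_apply_same]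
    · intro y _ hy
      rw [A.col_orthogonal _ _ _ _ hy, zero_mul]
    · simp
  have h2 : (a * A.X w z b).trace = (A.X z w a * A.X w z b).trace := by
    rw [← A.trace_apply_same w, A.apply_mul, Finset.sum_eq_single z, A.apply_apply_same]
    · intro y _ hy
      rw [A.row_orthogonal _ _ _ _ hy, mul_zero]
    · simp
  rw [h1, h2]

/-- The adjoint of `X v w` for the trace form is itself by `trace_adjoint` in the sesquilinear
version and `X w v` by `trace_apply_mul` in the bilinear one; comparing the two gives the rule. -/
theorem conjTranspose_component (v w : G.V) (a : Matrix ι ι ℂ) :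
    (A.X v w a)ᴴ = A.X w v aᴴ := by
  refine ext_iff_trace_mul_right.mpr fun b => ?_
  rw [← A.trace_adjoint, A.trace_apply_mul]

/-- The families of matrices that intertwine the ranges of the components of the action. -/
def centralizer : Subalgebra ℂ (G.V → Matrix ι ι ℂ) where
  carrier := {c | ∀ v w a, A.X v w a * c v = c w * A.X v w a}
  mul_mem' {c d} hc hd v w a := by
    rw [Pi.mul_apply, Pi.mul_apply, ← mul_assoc, hc, mul_assoc, hd, mul_assoc]
  add_mem' {c d} hc hd v w a := by
    rw [Pi.add_apply, Pi.add_apply, mul_add, hc, hd, add_mul]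
  algebraMap_mem' r v w a := by
    rw [Pi.algebraMap_apply, Pi.algebraMap_apply]
    exact (Algebra.commutes r _).symm

theorem mem_centralizer {c : G.V → Matrix ι ι ℂ} :
    c ∈ A.centralizer ↔ ∀ v w a, A.X v w a * c v = c w * A.X v w a := Iff.rfl

/-- The summed condition says that c, as a map from ℂ^ι to ℂ^V ⊗ ℂ^ι, intertwines the standard
representation with the one given by the blocks `X v w`. To recover the separate equations, replace
`a` by `X v w a`; column orthogonality removes all terms but one. -/
theorem mem_centralizer_iff_sum {c : G.V → Matrix ι ι ℂ} :
    c ∈ A.centralizer ↔ ∀ w a, ∑ v, A.X v w a * c v = c w * a := by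
  refine ⟨fun h w a => ?_, fun h v w a => ?_⟩
  · rw [Finset.sum_congr rfl fun v _ => A.mem_centralizer.mp h v w a, ← Finset.mul_sum, A.col_sum]
  · rw [← h, Finset.sum_eq_single v, A.apply_apply_same]
    · intro y _ hy
      rw [A.col_orthogonal _ _ _ _ hy, zero_mul]
    · simp

theorem star_mem_centralizer {c : G.V → Matrix ι ι ℂ} (hc : c ∈ A.centralizer) :
    star c ∈ A.centralizer := by
  intro v w a
  have := congrArg conjTranspose (A.mem_centralizer.mp hc w v aᴴ)
  rw [conjTranspose_mul, conjTranspose_mul, A.conjTranspose_component, conjTranspose_conjTranspose]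
    at this
  exact this.symm

/-- The columns of the Choi matrix of the action. -/
def kraus (k : G.V × ι × ι) (w : G.V) : Matrix ι ι ℂ :=
  of fun a c => A.X k.1 w (single c k.2.2 1) a k.2.1

theorem apply_expand (v w : G.V) (m : Matrix ι ι ℂ) (a b : ι) :
    A.X v w m a b = ∑ c, ∑ d, m c d * A.X v w (single c d 1) a b := by
  conv_lhs => rw [matrix_eq_sum_single m]
  simp only [map_sum, Matrix.sum_apply]
  refine Finset.sum_congr rfl fun c _ => Finset.sum_congr rfl fun d _ => ?_
  rw [← mul_one (m c d), ← smul_eq_mul (m c d) 1, ← smul_single, map_smul, Matrix.smul_apply]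
  simp

/-- For each f, the factorization E_cd = E_cf E_fd, multiplicativity and the adjoint rule write the
entry as a sum of products of Kraus entries. Adding over all f accounts for the factor n. -/
theorem card_smul_apply_single (v w : G.V) (c d a b : ι) :
    (Fintype.card ι : ℂ) * A.X v w (single c d 1) a b =
      ∑ k, A.kraus k w a c * star (A.kraus k v b d) := by
  have h : ∀ f : ι, A.X v w (single c d 1) a b =
      ∑ u, ∑ e, A.X u w (single c f 1) a e * star (A.X u v (single d f 1) b e) := by
    intro f
    have h0 : single c d (1 : ℂ) = single c f 1 * single f d 1 := by
      rw [single_mul_single_same, mul_one]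
    rw [h0, A.apply_mul, Matrix.sum_apply]
    refine Finset.sum_congr rfl fun u _ => ?_
    rw [Matrix.mul_apply]
    refine Finset.sum_congr rfl fun e _ => ?_
    rw [← Matrix.conjTranspose_apply, A.conjTranspose_component, conjTranspose_single, star_one]
  rw [Fintype.sum_prod_type]
  simp only [Fintype.sum_prod_type, kraus, of_apply]
  rw [← nsmul_eq_mul, ← Finset.card_univ, ← Finset.sum_const,
    Finset.sum_congr rfl fun f _ => h f, Finset.sum_comm]
  exact Finset.sum_congr rfl fun u _ => Finset.sum_comm

theorem card_smul_apply (v w : G.V) (m : Matrix ι ι ℂ) :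
    (Fintype.card ι : ℂ) • A.X v w m = ∑ k, A.kraus k w * m * (A.kraus k v)ᴴ := by
  ext a b
  rw [Matrix.smul_apply, A.apply_expand, Matrix.sum_apply, smul_eq_mul, Finset.mul_sum]
  simp only [Finset.mul_sum, Matrix.mul_apply, mul_left_comm _ (m _ _), card_smul_apply_single,
    Finset.sum_mul, conjTranspose_apply]
  rw [Finset.sum_comm' (t' := Finset.univ) (s' := fun _ => Finset.univ) (by simp)]
  conv_lhs => enter [2, d]; rw [Finset.sum_comm]
  rw [Finset.sum_comm]
  refine Finset.sum_congr rfl fun k _ => Finset.sum_congr rfl fun d _ =>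
    Finset.sum_congr rfl fun c _ => ?_
  ring

/-- In the summed condition, multiplicativity assembles the left side into an entry of the component
at `a * E_cq`. This product is a combination of the matrix units E_iq with coefficients from column
c of `a`, which is the right side. -/
theorem kraus_mem_centralizer (k : G.V × ι × ι) : A.kraus k ∈ A.centralizer := by
  rw [mem_centralizer_iff_sum]
  intro w a
  ext r c
  have h1 : ∀ v, (A.X v w a * A.kraus k v) r c =
      (A.X v w a * A.X k.1 v (single c k.2.2 1)) r k.2.1 := fun v => by
    simp [Matrix.mul_apply, kraus]
  rw [Matrix.sum_apply, Finset.sum_congr rfl fun v _ => h1 v, ← Matrix.sum_apply, ← A.apply_mul,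
    A.apply_expand, Matrix.mul_apply]
  refine Finset.sum_congr rfl fun i _ => ?_
  rw [Finset.sum_eq_single k.2.2]
  · rw [mul_single_apply_same, mul_one, mul_comm]
    rfl
  · intro d _ hd
    rw [mul_single_apply_of_ne (hbj := hd), zero_mul]
  · simp

/-- The Kraus families span the centralizer: evaluate the summed condition at E_ed and read off
column d. Each of the n values of d gives the same entry of `c w`, so their sum is n times it. -/
theorem eq_sum_kraus {c : G.V → Matrix ι ι ℂ} (hc : c ∈ A.centralizer) (w : G.V) :
    (Fintype.card ι : ℂ) • c w = ∑ k : G.V × ι × ι, c k.1 k.2.1 k.2.2 • A.kraus k w := by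
  rw [mem_centralizer_iff_sum] at hc
  ext a e
  rw [Matrix.smul_apply, Matrix.sum_apply]
  simp only [Fintype.sum_prod_type, Matrix.smul_apply, kraus, of_apply]
  have h : ∀ d, c w a e = ∑ v, ∑ b, c v b d • A.X v w (single e d 1) a b := by
    intro d
    have := congrFun (congrFun (hc w (single e d 1)) a) d
    rw [mul_single_apply_same, mul_one, Matrix.sum_apply] at this
    rw [← this]
    refine Finset.sum_congr rfl fun v _ => ?_
    rw [Matrix.mul_apply]
    exact Finset.sum_congr rfl fun b _ => mul_comm _ _
  rw [smul_eq_mul, ← nsmul_eq_mul, ← Finset.card_univ, ← Finset.sum_const,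
    Finset.sum_congr rfl fun f _ => h f, Finset.sum_comm]
  exact Finset.sum_congr rfl fun u _ => Finset.sum_comm

/-- The dimension of the centre of the centralizer, as a contraction of the action. -/
noncomputable def centreDim : ℂ :=
  (Fintype.card ι : ℂ)⁻¹ * ∑ v, ∑ a, ∑ b, ∑ c, ∑ d,
    A.X v v (single c d 1) a b * A.X v v (single d b 1) c a

/-- The Kraus formula is used twice. The sum over i turns K_i K_j K_i* into n X_{v,v}(K_j); after
expanding this in matrix units, the sum over j of an entry of K_j times a conjugate entry is again n
times an entry of X_{v,v}. -/
theorem sum_trace_kraus (v : G.V) :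
    ∑ i, ∑ j, (A.kraus i v * A.kraus j v * (A.kraus i v)ᴴ * (A.kraus j v)ᴴ).trace =
      (Fintype.card ι : ℂ) ^ 2 * ∑ a, ∑ b, ∑ c, ∑ d,
        A.X v v (single c d 1) a b * A.X v v (single d b 1) c a := by
  have h : ∀ j, ∑ i, (A.kraus i v * A.kraus j v * (A.kraus i v)ᴴ * (A.kraus j v)ᴴ).trace =
      ((Fintype.card ι : ℂ) • A.X v v (A.kraus j v) * (A.kraus j v)ᴴ).trace := by
    intro j
    rw [card_smul_apply, Finset.sum_mul, trace_sum]
  rw [Finset.sum_comm, Finset.sum_congr rfl fun j _ => h j, Finset.mul_sum]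
  simp only [trace, diag_apply, Matrix.mul_apply, Matrix.smul_apply, smul_eq_mul,
    conjTranspose_apply]
  rw [Finset.sum_comm]
  refine Finset.sum_congr rfl fun a _ => ?_
  rw [Finset.sum_comm, Finset.mul_sum]
  refine Finset.sum_congr rfl fun b _ => ?_
  simp only [Finset.mul_sum]
  simp only [A.apply_expand v v (A.kraus _ v), Finset.mul_sum, Finset.sum_mul]
  rw [Finset.sum_comm]
  refine Finset.sum_congr rfl fun c _ => ?_
  rw [Finset.sum_comm]
  refine Finset.sum_congr rfl fun d _ => ?_
  have := A.card_smul_apply_single v v d b c a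
  calc _ = (Fintype.card ι : ℂ) * A.X v v (single c d 1) a b *
        ∑ k, A.kraus k v c d * star (A.kraus k v a b) := by
        rw [Finset.mul_sum]; exact Finset.sum_congr rfl fun _ _ => by ring
    _ = _ := by rw [← this]; ring

end MatrixAction

/-! ### Commutativity of the centralizer and its minimal idempotents -/

namespace MatrixAction

open Matrix
open scoped ComplexOrder

variable {G : FinGraph.{u}} {ι : Type} [Fintype ι] [DecidableEq ι] (A : MatrixAction G ι)

theorem sum_kraus_mul_conjTranspose (v : G.V) :
    ∑ k, A.kraus k v * (A.kraus k v)ᴴ = (Fintype.card ι : ℂ) • 1 := by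
  simpa [A.apply_one_same] using (A.card_smul_apply v v 1).symm

theorem sum_trace_kraus_norm (v : G.V) :
    ∑ i, ∑ j, ((A.kraus i v * A.kraus j v)ᴴ * (A.kraus i v * A.kraus j v)).trace =
      (Fintype.card ι : ℂ) ^ 3 := by
  have h : ∀ i, ∑ j, ((A.kraus i v * A.kraus j v)ᴴ * (A.kraus i v * A.kraus j v)).trace =
      (Fintype.card ι : ℂ) * (A.kraus i v * (A.kraus i v)ᴴ).trace := by
    intro i
    have : ∀ j, ((A.kraus i v * A.kraus j v)ᴴ * (A.kraus i v * A.kraus j v)).trace =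
        (A.kraus i v * (A.kraus j v * (A.kraus j v)ᴴ) * (A.kraus i v)ᴴ).trace := by
      intro j
      rw [trace_mul_comm, conjTranspose_mul]
      simp only [mul_assoc]
    rw [Finset.sum_congr rfl fun j _ => this j, ← trace_sum, ← Finset.sum_mul, ← Finset.mul_sum,
      sum_kraus_mul_conjTranspose, mul_smul_comm, mul_one, smul_mul_assoc, trace_smul, smul_eq_mul]
  rw [Finset.sum_congr rfl fun i _ => h i, ← Finset.mul_sum, ← trace_sum,
    sum_kraus_mul_conjTranspose, trace_smul, trace_one, smul_eq_mul]
  ring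

/-- In the expansion of ‖K_i K_j − K_j K_i‖², the two square terms each sum to n³, and the two cross
terms agree after exchanging i and j. -/
theorem sum_trace_kraus_commutator (v : G.V) :
    ∑ i, ∑ j, ((A.kraus i v * A.kraus j v - A.kraus j v * A.kraus i v)ᴴ *
        (A.kraus i v * A.kraus j v - A.kraus j v * A.kraus i v)).trace =
      2 * (Fintype.card ι : ℂ) ^ 3 - 2 *
        ∑ i, ∑ j, (A.kraus i v * A.kraus j v * (A.kraus i v)ᴴ * (A.kraus j v)ᴴ).trace := by
  have h1 : ∑ i, ∑ j, ((A.kraus j v * A.kraus i v)ᴴ * (A.kraus j v * A.kraus i v)).trace =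
      (Fintype.card ι : ℂ) ^ 3 := by
    rw [Finset.sum_comm, sum_trace_kraus_norm]
  have h2 : ∑ i, ∑ j, ((A.kraus j v * A.kraus i v)ᴴ * (A.kraus i v * A.kraus j v)).trace =
      ∑ i, ∑ j, (A.kraus i v * A.kraus j v * (A.kraus i v)ᴴ * (A.kraus j v)ᴴ).trace := by
    refine Finset.sum_congr rfl fun i _ => Finset.sum_congr rfl fun j _ => ?_
    rw [trace_mul_comm, conjTranspose_mul, ← mul_assoc]
  have h3 : ∑ i, ∑ j, ((A.kraus i v * A.kraus j v)ᴴ * (A.kraus j v * A.kraus i v)).trace =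
      ∑ i, ∑ j, (A.kraus i v * A.kraus j v * (A.kraus i v)ᴴ * (A.kraus j v)ᴴ).trace := by
    rw [Finset.sum_comm, h2]
  simp only [conjTranspose_sub, sub_mul, mul_sub, trace_sub, Finset.sum_sub_distrib]
  rw [sum_trace_kraus_norm, h1, h2, h3]
  ring

/-- The squared Hilbert–Schmidt norms of all commutators, summed over the vertices too, add up to
2n³(|V| − d) = 0. Each is nonnegative, so each vanishes. -/
theorem kraus_commute [Nonempty ι] (hA : A.centreDim = Fintype.card G.V) (i j : G.V × ι × ι)
    (v : G.V) : A.kraus i v * A.kraus j v = A.kraus j v * A.kraus i v := by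
  have hc : (Fintype.card ι : ℂ) ≠ 0 := Nat.cast_ne_zero.mpr Fintype.card_ne_zero
  have hsum : ∑ v, ∑ i, ∑ j, ((A.kraus i v * A.kraus j v - A.kraus j v * A.kraus i v)ᴴ *
      (A.kraus i v * A.kraus j v - A.kraus j v * A.kraus i v)).trace = 0 := by
    rw [Finset.sum_congr rfl fun v _ => A.sum_trace_kraus_commutator v]
    simp only [sum_trace_kraus]
    rw [centreDim, inv_mul_eq_iff_eq_mul₀ hc] at hA
    rw [Finset.sum_sub_distrib, ← Finset.mul_sum, ← Finset.mul_sum, ← Finset.mul_sum, hA]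
    simp only [Finset.sum_const, Finset.card_univ, nsmul_eq_mul]
    ring
  have hn : ∀ v i j, 0 ≤ ((A.kraus i v * A.kraus j v - A.kraus j v * A.kraus i v)ᴴ *
      (A.kraus i v * A.kraus j v - A.kraus j v * A.kraus i v)).trace := fun v i j =>
    (posSemidef_conjTranspose_mul_self _).trace_nonneg
  rw [Finset.sum_eq_zero_iff_of_nonneg fun v _ => Finset.sum_nonneg fun i _ =>
    Finset.sum_nonneg fun j _ => hn v i j] at hsum
  have h1 := hsum v (Finset.mem_univ v)
  rw [Finset.sum_eq_zero_iff_of_nonneg fun i _ => Finset.sum_nonneg fun j _ => hn v i j] at h1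
  have h2 := h1 i (Finset.mem_univ i)
  rw [Finset.sum_eq_zero_iff_of_nonneg fun j _ => hn v i j] at h2
  exact sub_eq_zero.mp (trace_conjTranspose_mul_self_eq_zero_iff.mp (h2 j (Finset.mem_univ j)))

theorem centralizer_commute [Nonempty ι] (hA : A.centreDim = Fintype.card G.V)
    {c d : G.V → Matrix ι ι ℂ} (hc : c ∈ A.centralizer) (hd : d ∈ A.centralizer) :
    c * d = d * c := by
  have h0 : (Fintype.card ι : ℂ) ≠ 0 := Nat.cast_ne_zero.mpr Fintype.card_ne_zero
  ext1 v
  -- Two factors n are introduced, one to expand `c` and one to expand `d` in the Kraus families.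
  apply smul_right_injective _ h0
  apply smul_right_injective _ h0
  dsimp only
  rw [Pi.mul_apply, Pi.mul_apply, ← mul_smul_comm, ← smul_mul_assoc, ← smul_mul_assoc,
    ← mul_smul_comm, A.eq_sum_kraus hc, A.eq_sum_kraus hd, Finset.sum_mul_sum, Finset.sum_mul_sum,
    Finset.sum_comm]
  refine Finset.sum_congr rfl fun i _ => Finset.sum_congr rfl fun j _ => ?_
  rw [smul_mul_smul_comm, smul_mul_smul_comm, A.kraus_commute hA, mul_comm]

/-- If c² = 0, then normality of c gives (c*c)² = 0. As c*c is self-adjoint this forces c*c = 0, and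
then c = 0. -/
theorem centralizer_isReduced [Nonempty ι] (hA : A.centreDim = Fintype.card G.V) :
    IsReduced A.centralizer := by
  rw [isReduced_iff_pow_one_lt 2 one_lt_two]
  rintro ⟨c, hc⟩ h
  have h2 : c * c = 0 := by simpa [pow_two] using congrArg Subtype.val h
  refine Subtype.ext (funext fun v => ?_)
  have hs := A.star_mem_centralizer hc
  have h3 : (star c * c) * (star c * c) = 0 := by
    rw [mul_assoc, ← mul_assoc c, A.centralizer_commute hA hc hs, mul_assoc, h2, mul_zero, mul_zero]
  have h4 := congrFun h3 v
  simp only [Pi.mul_apply, Pi.star_apply, Pi.zero_apply, star_eq_conjTranspose] at h4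
  have h5 : (c v)ᴴ * c v = 0 := by
    rw [← conjTranspose_mul_self_eq_zero, conjTranspose_mul, conjTranspose_conjTranspose]
    exact h4
  exact conjTranspose_mul_self_eq_zero.mp h5

/-- The minimal idempotents of the centralizer. -/
theorem exists_idempotents [Nonempty ι] (hA : A.centreDim = Fintype.card G.V) :
    ∃ (J : Type u) (_ : Fintype J) (_ : DecidableEq J) (e : J → G.V → Matrix ι ι ℂ),
      (∀ x, e x ∈ A.centralizer) ∧ (∀ x, e x ≠ 0) ∧ (∀ x y, e x * e y = if x = y then e x else 0) ∧
      (∑ x, e x = 1) ∧ ∀ b ∈ A.centralizer, ∀ x, ∃ r : ℂ, b * e x = r • e x := by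
  classical
  let R := A.centralizer
  let : CommRing R := { A.centralizer.toRing with
    mul_comm := fun a b => Subtype.ext (A.centralizer_commute hA a.2 b.2) }
  have : IsReduced R := A.centralizer_isReduced hA
  let : Algebra ℂ R := A.centralizer.algebra
  have : Module.Finite ℂ R := inferInstanceAs (Module.Finite ℂ (Subalgebra.toSubmodule A.centralizer))
  have : IsArtinianRing R := IsArtinianRing.of_finite ℂ R
  let : Fintype (MaximalSpectrum R) := Fintype.ofFinite _
  let E := IsArtinianRing.equivPi R
  refine ⟨MaximalSpectrum R, inferInstance, inferInstance,
    fun x => (E.symm (Pi.single x 1) : R).1, fun x => (E.symm (Pi.single x 1) : R).2, ?_, ?_, ?_, ?_⟩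
  · intro x hx
    have h1 : E.symm (Pi.single x 1) = 0 := Subtype.ext hx
    rw [EmbeddingLike.map_eq_zero_iff] at h1
    have h2 := congrFun h1 x
    rw [Pi.single_eq_same] at h2
    have := x.isMaximal
    exact one_ne_zero h2
  · intro x y
    have h : E.symm (Pi.single x 1) * E.symm (Pi.single y 1) =
        if x = y then E.symm (Pi.single x 1) else 0 := by
      rw [← map_mul]
      split_ifs with hxy
      · subst hxy
        rw [← Pi.single_mul, one_mul]
      · rw [show (Pi.single x 1 * Pi.single y 1 : ∀ I : MaximalSpectrum R, R ⧸ I.asIdeal) = 0 by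
          ext I
          by_cases hI : I = x
          · subst hI
            simp [Pi.single_eq_of_ne hxy]
          · simp [Pi.single_eq_of_ne hI], map_zero]
    have := congrArg Subtype.val h
    split_ifs at this ⊢ <;> exact this
  · have h : ∑ x, E.symm (Pi.single x 1) = 1 := by
      rw [← map_sum, Finset.univ_sum_single, ← map_one E.symm]
      rfl
    have := congrArg (Subalgebra.val A.centralizer) h
    rw [map_sum] at this
    exact this
  · intro b hb x
    have := x.isMaximal
    let : Field (R ⧸ x.asIdeal) := Ideal.Quotient.field _
    have : Module.Finite ℂ (R ⧸ x.asIdeal) := inferInstance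
    -- The residue field is a finite extension of the algebraically closed field ℂ, hence ℂ itself,
    -- so `b` acts on this block as a scalar.
    obtain ⟨r, hr⟩ := (IsAlgClosed.algebraMap_bijective_of_isIntegral (k := ℂ)
      (K := R ⧸ x.asIdeal)).2 (Ideal.Quotient.mk _ ⟨b, hb⟩)
    refine ⟨r, ?_⟩
    have h : (⟨b, hb⟩ : R) * E.symm (Pi.single x 1) = algebraMap ℂ R r * E.symm (Pi.single x 1) := by
      apply E.injective
      rw [map_mul, map_mul, E.apply_symm_apply]
      ext y
      by_cases hy : y = x
      · subst hy
        simp only [Pi.mul_apply, Pi.single_eq_same, mul_one]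
        exact hr.symm
      · simp [Pi.single_eq_of_ne hy]
    rw [← Algebra.smul_def] at h
    exact congrArg Subtype.val h

end MatrixAction

/-- Matrix rings over a domain are prime: testing on the matrix unit E_jk, with M i j ≠ 0, isolates
row k of `N`. -/
theorem Matrix.eq_zero_of_forall_mul_mul {ι R : Type*} [Fintype ι] [DecidableEq ι] [Ring R]
    [NoZeroDivisors R] {M N : Matrix ι ι R} (hM : M ≠ 0) (h : ∀ a : Matrix ι ι R, M * a * N = 0) :
    N = 0 := by
  obtain ⟨i, j, hij⟩ : ∃ i j, M i j ≠ 0 := by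
    by_contra! hc
    exact hM (Matrix.ext hc)
  ext k l
  have h1 := congrFun (congrFun (h (Matrix.single j k 1)) i) l
  rw [Matrix.mul_apply, Finset.sum_eq_single k, Matrix.mul_single_apply_same, mul_one] at h1
  · exact (mul_eq_zero.mp h1).resolve_left hij
  · intro b _ hb
    rw [Matrix.mul_single_apply_of_ne (hbj := hb), zero_mul]
  · simp

/-- A quantum isomorphism in matrix coordinates, together with the conditions that make it up. -/
structure MatrixQuantumIso (G' G : FinGraph.{u}) (ι : Type*) [Fintype ι] [DecidableEq ι] where
  p : G'.V → G.V → Matrix ι ι ℂ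
  selfAdjoint : ∀ x v, (p x v).conjTranspose = p x v
  row_same : ∀ x v, p x v * p x v = p x v
  row_of_ne : ∀ x v w, v ≠ w → p x v * p x w = 0
  row_sum : ∀ x, ∑ v, p x v = 1
  col_of_ne : ∀ x y v, x ≠ y → p x v * p y v = 0
  col_sum : ∀ v, ∑ x, p x v = 1
  intertwines : ∀ x v, ∑ y, G'.adj x y • p y v = ∑ w, G.adj w v • p x w

/-! ### From minimal projections to a quantum isomorphism -/

namespace MatrixAction

open Matrix
open scoped ComplexOrder

variable {G : FinGraph.{u}} {ι : Type} [Fintype ι] [DecidableEq ι] (A : MatrixAction G ι)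

/-- The components of the minimal idempotents of the centralizer are the entries of a projective
permutation matrix. Orthogonality and completeness over x come from the decomposition of 1; over the
vertices, they come from the formula for `X` by compression with one idempotent. -/
theorem exists_projectors [Nonempty ι] (hA : A.centreDim = Fintype.card G.V) :
    ∃ (J : Type u) (_ : Fintype J) (_ : DecidableEq J) (e : J → G.V → Matrix ι ι ℂ),
      (∀ x, e x ∈ A.centralizer) ∧ (∀ x v, (e x v)ᴴ = e x v) ∧ (∀ x v, e x v * e x v = e x v) ∧
      (∀ x y v, x ≠ y → e x v * e y v = 0) ∧
      (∀ v, ∑ x, e x v = 1) ∧ (∀ x v w, v ≠ w → e x v * e x w = 0) ∧ (∀ x, ∑ v, e x v = 1) ∧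
      (∀ v w a, A.X v w a = ∑ x, e x w * a * e x v) ∧
      ∀ b ∈ A.centralizer, ∀ x, ∃ r : ℂ, ∀ v, b v * e x v = r • e x v := by
  obtain ⟨J, _, _, e, hmem, hne, hmul, hsum, hsc⟩ := A.exists_idempotents hA
  have hcomm : ∀ b ∈ A.centralizer, ∀ x, b * e x = e x * b := fun b hb x =>
    A.centralizer_commute hA hb (hmem x)
  have hsame : ∀ x v, e x v * e x v = e x v := fun x v => by
    simpa using congrFun (hmul x x) v
  have hcol : ∀ x y v, x ≠ y → e x v * e y v = 0 := fun x y v h => by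
    simpa [h] using congrFun (hmul x y) v
  have hcs : ∀ v, ∑ x, e x v = 1 := fun v => by
    simpa using congrFun hsum v
  have hne' : ∀ x, ∃ v, e x v ≠ 0 := fun x => Function.ne_iff.mp (hne x)
  -- The centralizer acts on `e x` by scalars, so e*e = r e, with r ≠ 0 since e ≠ 0. Taking adjoints
  -- gives r e = r̄ e*; multiplying by e gives r e = r̄ r e, so r = 1 and e = e*.
  have hstar : ∀ x, star (e x) = e x := by
    intro x
    obtain ⟨r, hr⟩ := hsc _ (A.star_mem_centralizer (hmem x)) x
    have hr0 : r ≠ 0 := by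
      rintro rfl
      obtain ⟨v, hv⟩ := hne' x
      rw [zero_smul] at hr
      exact hv (conjTranspose_mul_self_eq_zero.mp (congrFun hr v))
    have hr1 : r • e x = star r • star (e x) := by
      have := congrArg star hr
      rw [star_mul, star_star, star_smul] at this
      exact hr.symm.trans this
    have hr2 : r • e x = star r • r • e x := by
      have := congrArg (· * e x) hr1
      simpa [hmul, hr] using this
    have hr3 : star r = 1 := by
      rw [smul_smul] at hr2
      have := smul_left_injective ℂ (hne x) hr2
      exact (mul_eq_right₀ hr0).mp this.symm
    have hr4 : r = 1 := by simpa using congrArg star hr3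
    rw [hr3, hr4, one_smul, one_smul] at hr1
    exact hr1.symm
  -- Each Kraus family and its adjoint act on the block of `e x` as scalars, so compressing the
  -- Kraus formula leaves a multiple of `e x w * a * e x v`. The case v = w, a = 1 later shows that
  -- the multiple is 1.
  have hX : ∀ x, ∃ c : ℂ, ∀ v w a, e x w * A.X v w a = c • (e x w * a * e x v) := by
    intro x
    choose β hβ using fun k => hsc _ (A.star_mem_centralizer (A.kraus_mem_centralizer k)) x
    choose γ hγ using fun k => hsc _ (A.kraus_mem_centralizer k) x
    have hc : (Fintype.card ι : ℂ) ≠ 0 := Nat.cast_ne_zero.mpr Fintype.card_ne_zero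
    refine ⟨(Fintype.card ι : ℂ)⁻¹ * ∑ k, γ k * β k, fun v w a => ?_⟩
    have h1 : e x w * A.X v w a = e x w * A.X v w a * e x v := by
      rw [mul_assoc, A.mem_centralizer.mp (hmem x), ← mul_assoc, hsame]
    rw [mul_smul, eq_inv_smul_iff₀ hc, h1, ← smul_mul_assoc, ← mul_smul_comm, card_smul_apply,
      Finset.mul_sum, Finset.sum_mul, Finset.sum_smul]
    refine Finset.sum_congr rfl fun k _ => ?_
    have h2 : e x w * A.kraus k w = γ k • e x w := by
      rw [← Pi.mul_apply, ← hcomm _ (A.kraus_mem_centralizer k), hγ]; rfl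
    have h3 : (A.kraus k v)ᴴ * e x v = β k • e x v := congrFun (hβ k) v
    rw [← mul_assoc, ← mul_assoc, h2, mul_assoc, h3]
    simp only [smul_mul_assoc, mul_smul_comm, smul_smul]
    rw [mul_comm]
  have hX1 : ∀ x v w a, e x w * A.X v w a = e x w * a * e x v := by
    intro x
    obtain ⟨c, hc⟩ := hX x
    obtain ⟨w, hw⟩ := hne' x
    have h := hc w w 1
    rw [A.apply_one_same, mul_one, hsame] at h
    have h1 : c = 1 := by
      have : (1 : ℂ) • e x w = c • e x w := by rw [one_smul, ← h]
      exact (smul_left_injective ℂ hw this).symm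
    simpa [h1] using hc
  have hact : ∀ v w a, A.X v w a = ∑ x, e x w * a * e x v := by
    intro v w a
    rw [← Finset.sum_congr rfl fun x _ => hX1 x v w a, ← Finset.sum_mul, hcs, one_mul]
  -- For every `a`, e_x(w) a (1 − ∑_v e_x(v)) equals e_x(w)(a − ∑_v X_{v,w}(a)) = 0; primeness of
  -- the matrix ring then applies.
  have hrs : ∀ x, ∑ v, e x v = 1 := by
    intro x
    obtain ⟨w, hw⟩ := hne' x
    refine (sub_eq_zero.mp (eq_zero_of_forall_mul_mul hw fun a => ?_)).symm
    rw [mul_sub, mul_one, Finset.mul_sum, ← Finset.sum_congr rfl fun v _ => hX1 x v w a,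
      ← Finset.mul_sum, A.col_sum, sub_self]
  -- Insert ∑_u e_x(u) = 1. Each term e_x(v) e_x(w) e_x(u) is the compression by e_x(v) of
  -- X_{u,v}(X_{u,w}(1)) = 0.
  have hrow : ∀ x v w, v ≠ w → e x v * e x w = 0 := by
    intro x v w hvw
    rw [← mul_one (e x v * e x w), ← hrs x, Finset.mul_sum]
    refine Finset.sum_eq_zero fun u _ => ?_
    have h1 := A.row_orthogonal u v w 1 hvw
    have h2 := congrArg (e x v * ·) h1
    rw [hX1, mul_zero, mul_assoc, A.mem_centralizer.mp (hmem x), hX1, mul_one, ← mul_assoc] at h2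
    exact h2
  refine ⟨J, inferInstance, inferInstance, e, hmem, fun x v => congrFun (hstar x) v, hsame, hcol,
    hcs, hrow, hrs, hact, fun b hb x => ?_⟩
  obtain ⟨r, hr⟩ := hsc b hb x
  exact ⟨r, fun v => congrFun hr v⟩

/-- In the summed condition, the intertwining relation moves the adjacency matrix from the source
vertex of `X` to its target vertex. -/
theorem adj_mul_mem_centralizer {c : G.V → Matrix ι ι ℂ} (hc : c ∈ A.centralizer) :
    (fun v => ∑ w, G.adj w v • c w) ∈ A.centralizer := by
  rw [mem_centralizer_iff_sum] at hc ⊢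
  intro w a
  simp only [Finset.mul_sum, mul_smul_comm, Finset.sum_mul, smul_mul_assoc]
  simp only [← hc _ a, Finset.smul_sum]
  rw [Finset.sum_comm]
  conv_rhs => rw [Finset.sum_comm]
  refine Finset.sum_congr rfl fun u _ => ?_
  have := congrArg (· * c u) (A.intertwines u w a)
  simpa [Finset.sum_mul] using this

-- The new adjacency matrix γ is that of `G` acting on the centralizer, written in the basis of
-- minimal projections. Its properties are read off from (Γ e_x) e_y = γ_{x,y} e_y and the relations
-- among the components e_x(v).
open scoped Classical in
theorem exists_matrixQuantumIso [Nonempty ι] (hA : A.centreDim = Fintype.card G.V) :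
    ∃ (G' : FinGraph.{u}) (P : MatrixQuantumIso G' G ι),
      ∀ v w a, A.X v w a = ∑ x, P.p x w * a * P.p x v := by
  obtain ⟨J, _, _, e, hmem, hstar, hsame, hcol, hcs, hrow, hrs, hact, hsc⟩ :=
    A.exists_projectors hA
  choose γ hγ using fun x y => hsc _ (A.adj_mul_mem_centralizer (hmem x)) y
  have hne1 : (1 : Matrix ι ι ℂ) ≠ 0 := one_ne_zero
  have hsm : ∀ r s : ℂ, r • (1 : Matrix ι ι ℂ) = s • 1 → r = s := fun r s h =>
    smul_left_injective ℂ hne1 h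
  have hγ1 : ∀ x y, γ x y • (1 : Matrix ι ι ℂ) = ∑ v, ∑ w, G.adj w v • (e x w * e y v) := by
    intro x y
    rw [← hrs y, Finset.smul_sum]
    refine Finset.sum_congr rfl fun v _ => ?_
    rw [← hγ, Finset.sum_mul]
    simp only [smul_mul_assoc]
  have hadj : ∀ v w, star (G.adj v w) = G.adj v w := fun v w => by
    unfold FinGraph.adj; split_ifs <;> simp
  have hadj2 : ∀ v w, G.adj v w * G.adj v w = G.adj v w := fun v w => by
    unfold FinGraph.adj; split_ifs <;> simp
  have hdiag : ∀ x, γ x x = 1 := by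
    intro x
    refine hsm _ _ ?_
    rw [hγ1, one_smul, ← hrs x]
    refine Finset.sum_congr rfl fun v _ => ?_
    rw [Finset.sum_eq_single v, hsame]
    · simp [FinGraph.adj]
    · intro w _ hw
      rw [hrow _ _ _ hw, smul_zero]
    · simp
  -- At each vertex v, ∑_w Γ_{w,v} e_x(w) is idempotent, because Γ has entries 0 and 1 and the
  -- e_x(w) are mutually orthogonal. Its scalar action on e_y(v) is therefore idempotent.
  have hsq : ∀ x y, γ x y * γ x y = γ x y := by
    intro x y
    refine hsm _ _ ?_
    rw [← hrs y, Finset.smul_sum, Finset.smul_sum]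
    refine Finset.sum_congr rfl fun v _ => ?_
    rw [← hγ, mul_smul, ← hγ x y v, ← mul_smul_comm, ← hγ x y v, ← mul_assoc]
    congr 1
    rw [Finset.sum_mul_sum]
    refine Finset.sum_congr rfl fun w _ => ?_
    rw [Finset.sum_eq_single w, smul_mul_smul_comm, hsame, hadj2]
    · intro u _ hu
      rw [smul_mul_smul_comm, hrow _ _ _ hu.symm, smul_zero]
    · simp
  have h01 : ∀ x y, γ x y = 0 ∨ γ x y = 1 := fun x y => by
    rcases eq_or_ne (γ x y) 0 with h | h
    · exact Or.inl h
    · exact Or.inr (mul_left_cancel₀ h ((hsq x y).trans (mul_one _).symm))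
  have hsymm : ∀ x y, γ x y = γ y x := by
    intro x y
    have h1 : star (γ x y) = γ x y := by rcases h01 x y with h | h <;> simp [h]
    refine hsm _ _ ?_
    have h2 := congrArg conjTranspose (hγ1 x y)
    rw [conjTranspose_smul, conjTranspose_one, h1] at h2
    rw [h2, hγ1, Finset.sum_comm, conjTranspose_sum]
    refine Finset.sum_congr rfl fun v _ => ?_
    rw [conjTranspose_sum]
    refine Finset.sum_congr rfl fun w _ => ?_
    rw [conjTranspose_smul, conjTranspose_mul, hstar, hstar, hadj, G.adj_symm]
  -- The unit diagonal of γ is dropped here, since simple graphs have no loops; the convention that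
  -- each vertex is adjacent to itself restores it in `G'.adj`.
  let G' : FinGraph.{u} :=
    { V := J
      graph :=
        { Adj := fun x y => x ≠ y ∧ γ x y = 1
          symm := ⟨fun x y h => ⟨h.1.symm, (hsymm y x).trans h.2⟩⟩
          loopless := ⟨fun x h => h.1 rfl⟩ } }
  have hG' : ∀ x y : J, G'.adj x y = γ x y := by
    intro x y
    unfold FinGraph.adj
    split_ifs with h
    · rcases h with h | h
      · rw [h, hdiag]
      · exact h.2.symm
    · rw [not_or] at h
      rcases h01 x y with h1 | h1
      · exact h1.symm
      · exact absurd ⟨h.1, h1⟩ h.2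
  refine ⟨G', ⟨e, hstar, hsame, hrow, hrs, hcol, hcs, fun x v => ?_⟩, hact⟩
  rw [← mul_one (∑ w, G.adj w v • e x w), ← hcs v, Finset.mul_sum]
  exact Finset.sum_congr rfl fun y _ => by rw [hγ, hG']

end MatrixAction

/-! ### The inner product of K ⊗ K* in matrix coordinates -/

section InnerTensor

variable {K L : Type*} [NormedAddCommGroup K] [InnerProductSpace ℂ K] [NormedAddCommGroup L]
  [InnerProductSpace ℂ L]

theorem inner_tensor_add_right (x a b : K ⊗[ℂ] L) :
    inner ℂ x (a + b) = inner ℂ x a + inner ℂ x b := inner_add_right _ _ _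

theorem inner_tensor_smul_right (x a : K ⊗[ℂ] L) (r : ℂ) :
    inner ℂ x (r • a) = r * inner ℂ x a := by
  rw [TensorProduct.inner_def, map_smul]; rfl

theorem inner_tensor_smul_left (x a : K ⊗[ℂ] L) (r : ℂ) :
    inner ℂ (r • a) x = star r * inner ℂ a x := by
  rw [TensorProduct.inner_def, map_smulₛₗ]; rfl

theorem inner_tensor_sum_right {J : Type*} (s : Finset J) (x : K ⊗[ℂ] L) (f : J → K ⊗[ℂ] L) :
    inner ℂ x (∑ j ∈ s, f j) = ∑ j ∈ s, inner ℂ x (f j) := inner_sum _ _ _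

theorem inner_tensor_sum_left {J : Type*} (s : Finset J) (x : K ⊗[ℂ] L) (f : J → K ⊗[ℂ] L) :
    inner ℂ (∑ j ∈ s, f j) x = ∑ j ∈ s, inner ℂ (f j) x := sum_inner _ _ _

theorem inner_equiv_tensor {E : Type*} [NormedAddCommGroup E] [InnerProductSpace ℂ E]
    (U : E ≃ₗᵢ[ℂ] K ⊗[ℂ] L) (x y : E) : inner ℂ (U x) (U y) = inner ℂ x y :=
  LinearIsometryEquiv.inner_map_map (𝕜 := ℂ) (E := E) (E' := K ⊗[ℂ] L) U x y

end InnerTensor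

section HilbertTensor

variable {H : Type*} [NormedAddCommGroup H] [InnerProductSpace ℂ H] [FiniteDimensional ℂ H]

theorem inner_dual_eq (f g : StrongDual ℂ H) :
    inner ℂ f g = inner ℂ ((InnerProductSpace.toDual ℂ H).symm g)
      ((InnerProductSpace.toDual ℂ H).symm f) := rfl

theorem inner_toDual_left (x : H) (f : StrongDual ℂ H) :
    inner ℂ (InnerProductSpace.toDual ℂ H x) f = f x := by
  rw [inner_dual_eq, LinearIsometryEquiv.symm_apply_apply, InnerProductSpace.toDual_symm_apply]

theorem tensorDualEquivEnd_symm_expand {ι : Type*} [Fintype ι] [DecidableEq ι]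
    (b : OrthonormalBasis ι ℂ H) (a : H →ₗ[ℂ] H) :
    (tensorDualEquivEnd H).symm a = ∑ i, ∑ j, LinearMap.toMatrix b.toBasis b.toBasis a i j •
      (b i ⊗ₜ[ℂ] InnerProductSpace.toDual ℂ H (b j)) := by
  rw [LinearEquiv.symm_apply_eq]
  refine b.toBasis.ext fun l => ?_
  simp only [map_sum, map_smul, LinearMap.sum_apply, LinearMap.smul_apply, tensorDualEquivEnd_tmul,
    InnerProductSpace.toDual_apply_apply, OrthonormalBasis.coe_toBasis,
    orthonormal_iff_ite.mp b.orthonormal, ite_smul, one_smul, zero_smul, smul_ite, smul_zero,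
    Finset.sum_ite_eq', Finset.mem_univ, if_true, LinearMap.toMatrix_apply]
  exact (b.sum_repr (a (b l))).symm

theorem inner_ketBra {ι : Type*} [DecidableEq ι] [Fintype ι] (b : OrthonormalBasis ι ℂ H)
    (i j k l : ι) :
    inner ℂ (b i ⊗ₜ[ℂ] InnerProductSpace.toDual ℂ H (b j))
      (b k ⊗ₜ[ℂ] InnerProductSpace.toDual ℂ H (b l)) =
      (if i = k then 1 else 0) * (if j = l then 1 else 0) := by
  rw [TensorProduct.inner_tmul, inner_toDual_left, InnerProductSpace.toDual_apply_apply,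
    orthonormal_iff_ite.mp b.orthonormal, orthonormal_iff_ite.mp b.orthonormal]
  simp only [eq_comm]

theorem inner_ketBra_left {ι : Type*} [Fintype ι] [DecidableEq ι] (b : OrthonormalBasis ι ℂ H)
    (i j : ι) (a : H →ₗ[ℂ] H) :
    inner ℂ (b i ⊗ₜ[ℂ] InnerProductSpace.toDual ℂ H (b j)) ((tensorDualEquivEnd H).symm a) =
      LinearMap.toMatrix b.toBasis b.toBasis a i j := by
  rw [tensorDualEquivEnd_symm_expand b]
  simp only [inner_tensor_sum_right, inner_tensor_smul_right, inner_ketBra]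
  simp

theorem inner_tensorDualEquivEnd_symm {ι : Type*} [Fintype ι] [DecidableEq ι]
    (b : OrthonormalBasis ι ℂ H) (a a' : H →ₗ[ℂ] H) :
    inner ℂ ((tensorDualEquivEnd H).symm a) ((tensorDualEquivEnd H).symm a') =
      ((LinearMap.toMatrix b.toBasis b.toBasis a).conjTranspose *
        LinearMap.toMatrix b.toBasis b.toBasis a').trace := by
  rw [tensorDualEquivEnd_symm_expand b a]
  simp only [inner_tensor_sum_left, inner_tensor_smul_left, inner_ketBra_left, Matrix.trace, Matrix.mul_apply,
    Matrix.diag_apply, Matrix.conjTranspose_apply]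
  rw [Finset.sum_comm]

theorem tensorDualEquivEnd_ketBra {ι : Type*} [Fintype ι] [DecidableEq ι]
    (b : OrthonormalBasis ι ℂ H) (i j : ι) :
    tensorDualEquivEnd H (b i ⊗ₜ[ℂ] InnerProductSpace.toDual ℂ H (b j)) =
      (LinearMap.toMatrix b.toBasis b.toBasis).symm (Matrix.single i j 1) := by
  have h : (tensorDualEquivEnd H).symm ((LinearMap.toMatrix b.toBasis b.toBasis).symm
      (Matrix.single i j 1)) = b i ⊗ₜ[ℂ] InnerProductSpace.toDual ℂ H (b j) := by
    rw [tensorDualEquivEnd_symm_expand b, LinearEquiv.apply_symm_apply, Finset.sum_eq_single i,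
      Finset.sum_eq_single j]
    · simp
    · intro k _ hk
      simp [hk.symm]
    · simp
    · intro k _ hk
      simp [hk.symm]
    · simp
  rw [← h, LinearEquiv.apply_symm_apply]

end HilbertTensor

/-! ### Simple monoids as matrix algebras with an action of the graph -/

namespace QAut

open QuantumIso MonObj

variable {G : FinGraph.{u}}

namespace EndIdentification

variable {A : Mon (QAut G)} (e : EndIdentification A)

/-- The elements of a simple monoid as operators on the Hilbert space that it acts on, normalised
to preserve multiplication and unit. -/
noncomputable def elem : (e.K →ₗ[ℂ] e.K) ≃ₗ[ℂ] A.X.H :=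
  ((tensorDualEquivEnd e.K).symm.trans e.equiv.symm.toLinearEquiv).trans
    (LinearEquiv.smulOfNeZero ℂ A.X.H _ (sqrt_finrank_ne_zero e.K))

theorem elem_apply (a : e.K →ₗ[ℂ] e.K) :
    e.elem a = ((√(Module.finrank ℂ e.K) : ℝ) : ℂ) • e.equiv.symm ((tensorDualEquivEnd e.K).symm a) :=
  rfl

theorem equiv_elem (a : e.K →ₗ[ℂ] e.K) : e.equiv (e.elem a) =
    ((√(Module.finrank ℂ e.K) : ℝ) : ℂ) • (tensorDualEquivEnd e.K).symm a := by
  rw [elem_apply, map_smul, LinearIsometryEquiv.apply_symm_apply]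

theorem mul_elem (a b : e.K →ₗ[ℂ] e.K) :
    Hom.lin μ[A.X] (e.elem a ⊗ₜ[ℂ] e.elem b) = e.elem (a * b) := by
  apply e.equiv.injective
  rw [e.map_mul, equiv_elem, equiv_elem, equiv_elem]
  apply (tensorDualEquivEnd e.K).injective
  rw [tensorDualEquivEnd_endMul]
  simp only [map_smul, LinearEquiv.apply_symm_apply, smul_mul_assoc, mul_smul_comm]
  rw [inv_smul_smul₀ (sqrt_finrank_ne_zero e.K)]

theorem one_eq_elem : Hom.lin η[A.X] (1 : ℂ) = e.elem 1 := by
  apply e.equiv.injective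
  rw [e.map_one, equiv_elem]
  rfl

/-- The factor √n that makes `elem` multiplicative and unital occurs once in each argument, so the
inner product is n times the Hilbert–Schmidt one. The same n explains the factors n⁻¹ in the
comultiplication. -/
theorem inner_elem {κ : Type*} [Fintype κ] [DecidableEq κ] (b : OrthonormalBasis κ ℂ e.K)
    (a a' : e.K →ₗ[ℂ] e.K) :
    inner ℂ (e.elem a) (e.elem a') = (Module.finrank ℂ e.K : ℂ) *
      ((LinearMap.toMatrix b.toBasis b.toBasis a).conjTranspose *
        LinearMap.toMatrix b.toBasis b.toBasis a').trace := by
  rw [← inner_equiv_tensor e.equiv, equiv_elem, equiv_elem, inner_tensor_smul_left, inner_tensor_smul_right,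
    inner_tensorDualEquivEnd_symm b, ← _root_.mul_assoc, RCLike.star_def, Complex.conj_ofReal, ← Complex.ofReal_mul,
    Real.mul_self_sqrt (Nat.cast_nonneg _), Complex.ofReal_natCast]

end EndIdentification

theorem tensor_comm_component {X Y Z : QAut G} (f : X ⊗ Y ⟶ Z) (v w : G.V) (a : X.H) (b : Y.H) :
    Z.P v w (Hom.lin f (a ⊗ₜ[ℂ] b)) =
      ∑ z, Hom.lin f ((X.P z w a ⊗ₜ[ℂ] Y.P v z b : X.H ⊗[ℂ] Y.H)) := by
  let f' : X.H ⊗[ℂ] Y.H →ₗ[ℂ] Z.H := Hom.lin f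
  have h : Z.P v w ∘ₗ f' = f' ∘ₗ ∑ z, TensorProduct.map (X.P z w) (Y.P v z) := Hom.comm f v w
  have h1 := LinearMap.congr_fun h (a ⊗ₜ[ℂ] b)
  rw [LinearMap.comp_apply, LinearMap.comp_apply, LinearMap.sum_apply, map_sum] at h1
  exact h1

open scoped Classical in
theorem one_comm_component (A : Mon (QAut G)) (v w : G.V) :
    A.X.P v w (Hom.lin η[A.X] (1 : ℂ)) = if v = w then Hom.lin η[A.X] (1 : ℂ) else 0 := by
  have h := LinearMap.congr_fun (Hom.comm η[A.X] v w) (1 : ℂ)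
  refine h.trans ?_
  change Hom.lin η[A.X] ((if v = w then (1 : ℂ →ₗ[ℂ] ℂ) else 0) 1) = _
  split_ifs
  · rfl
  · exact map_zero _

namespace EndIdentification

variable {A : Mon (QAut G)} (e : EndIdentification A)

/-- The elements of a simple monoid as matrices, in an orthonormal basis. -/
noncomputable def matElem :
    Matrix (Fin (Module.finrank ℂ e.K)) (Fin (Module.finrank ℂ e.K)) ℂ ≃ₗ[ℂ] A.X.H :=
  (LinearMap.toMatrix (stdOrthonormalBasis ℂ e.K).toBasis
    (stdOrthonormalBasis ℂ e.K).toBasis).symm.trans e.elem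

theorem mul_matElem (a b : Matrix (Fin (Module.finrank ℂ e.K)) (Fin (Module.finrank ℂ e.K)) ℂ) :
    Hom.lin μ[A.X] (e.matElem a ⊗ₜ[ℂ] e.matElem b) = e.matElem (a * b) := by
  refine (e.mul_elem _ _).trans (congrArg e.elem ?_)
  exact (Matrix.toLin_mul (stdOrthonormalBasis ℂ e.K).toBasis (stdOrthonormalBasis ℂ e.K).toBasis
    (stdOrthonormalBasis ℂ e.K).toBasis a b).symm

theorem one_eq_matElem : Hom.lin η[A.X] (1 : ℂ) = e.matElem 1 := by
  rw [one_eq_elem]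
  refine congrArg e.elem ?_
  exact (Matrix.toLin_one _).symm

theorem inner_matElem (a b : Matrix (Fin (Module.finrank ℂ e.K)) (Fin (Module.finrank ℂ e.K)) ℂ) :
    inner ℂ (e.matElem a) (e.matElem b) =
      (Module.finrank ℂ e.K : ℂ) * (a.conjTranspose * b).trace := by
  refine (e.inner_elem (stdOrthonormalBasis ℂ e.K) ((LinearMap.toMatrix _ _).symm a)
    ((LinearMap.toMatrix _ _).symm b)).trans ?_
  rw [LinearEquiv.apply_symm_apply, LinearEquiv.apply_symm_apply]

/-- The components of the underlying quantum automorphism in matrix coordinates. -/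
noncomputable def comp (v w : G.V) :
    Matrix (Fin (Module.finrank ℂ e.K)) (Fin (Module.finrank ℂ e.K)) ℂ →ₗ[ℂ]
      Matrix (Fin (Module.finrank ℂ e.K)) (Fin (Module.finrank ℂ e.K)) ℂ :=
  e.matElem.symm.toLinearMap ∘ₗ A.X.P v w ∘ₗ e.matElem.toLinearMap

theorem matElem_comp (v w : G.V)
    (a : Matrix (Fin (Module.finrank ℂ e.K)) (Fin (Module.finrank ℂ e.K)) ℂ) :
    e.matElem (e.comp v w a) = A.X.P v w (e.matElem a) := by
  simp [comp]

theorem component_mul_apply (X : QAut G) (v w v' w' : G.V) (a : X.H) :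
    X.P v w (X.P v' w' a) = (X.P v w * X.P v' w') a := rfl

/-- The action of `G` on a matrix algebra that is given by a simple monoid. -/
noncomputable def matrixAction : MatrixAction G (Fin (Module.finrank ℂ e.K)) where
  X := e.comp
  apply_mul v w a b := by
    apply e.matElem.injective
    rw [matElem_comp, ← mul_matElem, tensor_comm_component, map_sum]
    simp only [← matElem_comp, mul_matElem]
  apply_one_same v := by
    apply e.matElem.injective
    rw [matElem_comp, ← one_eq_matElem, one_comm_component, if_pos rfl]
  trace_adjoint v w a b := by
    have hk : (Module.finrank ℂ e.K : ℂ) ≠ 0 := Nat.cast_ne_zero.mpr Module.finrank_pos.ne'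
    apply mul_left_cancel₀ hk
    rw [← inner_matElem, ← inner_matElem, matElem_comp, matElem_comp,
      ← LinearMap.adjoint_inner_left, A.X.selfAdjoint]
  apply_apply_same v w a := by
    apply e.matElem.injective
    rw [matElem_comp, matElem_comp, component_mul_apply, A.X.row_orthogonal, if_pos rfl]
  row_orthogonal v w₁ w₂ a h := by
    apply e.matElem.injective
    rw [matElem_comp, matElem_comp, component_mul_apply, A.X.row_orthogonal, if_neg h, map_zero]
    rfl
  col_orthogonal v₁ v₂ w a h := by
    apply e.matElem.injective
    rw [matElem_comp, matElem_comp, component_mul_apply, A.X.col_orthogonal, if_neg h, map_zero]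
    rfl
  col_sum w a := by
    apply e.matElem.injective
    rw [map_sum]
    simp only [matElem_comp]
    rw [← LinearMap.sum_apply, A.X.col_sum]
    rfl
  intertwines v w a := by
    apply e.matElem.injective
    rw [map_sum, map_sum]
    simp only [map_smul, matElem_comp]
    simpa [LinearMap.sum_apply] using LinearMap.congr_fun (A.X.intertwines v w) (e.matElem a)

theorem equiv_matElem (a : Matrix (Fin (Module.finrank ℂ e.K)) (Fin (Module.finrank ℂ e.K)) ℂ) :
    e.equiv (e.matElem a) = ((√(Module.finrank ℂ e.K) : ℝ) : ℂ) • (tensorDualEquivEnd e.K).symm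
      ((LinearMap.toMatrix (stdOrthonormalBasis ℂ e.K).toBasis
        (stdOrthonormalBasis ℂ e.K).toBasis).symm a) :=
  e.equiv_elem _

theorem matElem_single (c d : Fin (Module.finrank ℂ e.K)) :
    e.matElem (Matrix.single c d 1) =
      ((√(Module.finrank ℂ e.K) : ℝ) : ℂ) • e.equiv.symm (e.ketBra c d) := by
  apply e.equiv.injective
  rw [equiv_matElem, map_smul, LinearIsometryEquiv.apply_symm_apply, ← tensorDualEquivEnd_ketBra,
    LinearEquiv.symm_apply_apply]
  rfl

/-- The normalisation √n enters once and leaves once, so the tensor entries that define d are the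
matrix entries of the action. -/
theorem entry_eq (v : G.V) (a b c d : Fin (Module.finrank ℂ e.K)) :
    e.entry v a b c d = e.matrixAction.X v v (Matrix.single c d 1) a b := by
  have h0 := sqrt_finrank_ne_zero e.K
  have h1 : e.diag v (e.ketBra c d) = ((√(Module.finrank ℂ e.K) : ℝ) : ℂ)⁻¹ •
      e.equiv (e.matElem (e.comp v v (Matrix.single c d 1))) := by
    rw [matElem_comp, matElem_single, map_smul, map_smul, inv_smul_smul₀ h0]
    rfl
  rw [entry, h1, equiv_matElem, inv_smul_smul₀ h0]
  exact (inner_ketBra_left _ _ _ _).trans (by rw [LinearEquiv.apply_symm_apply]; rfl)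

theorem centreDim_eq : e.centreDim = e.matrixAction.centreDim := by
  simp only [centreDim, MatrixAction.centreDim, entry_eq, Fintype.card_fin]

end EndIdentification

end QAut

/-! ### Realizations by quantum isomorphisms -/

namespace QAut

open QuantumIso MonObj

variable {G : FinGraph.{u}}

open scoped Classical in
/-- An identification of a monoid with the endomorphism algebra of a quantum isomorphism from `G'`
to `G`. -/
structure Realization (A : Mon (QAut G)) (G' : FinGraph.{u}) extends EndIdentification A where
  P : G'.V → G.V → (K →ₗ[ℂ] K)
  selfAdjoint : ∀ v w, LinearMap.adjoint (P v w) = P v w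
  row_orthogonal : ∀ v w₁ w₂, P v w₁ * P v w₂ = if w₁ = w₂ then P v w₁ else 0
  row_sum : ∀ v, ∑ w, P v w = 1
  col_orthogonal : ∀ v₁ v₂ w, P v₁ w * P v₂ w = if v₁ = v₂ then P v₁ w else 0
  col_sum : ∀ w, ∑ v, P v w = 1
  intertwines : ∀ v w, ∑ v', G'.adj v v' • P v' w = ∑ w', G.adj w' w • P v w'
  component_elem : ∀ v w a, A.X.P v w (toEndIdentification.elem a) =
    toEndIdentification.elem (∑ x, P x w * a * P x v)

namespace Realization

variable {A : Mon (QAut G)} {G' : FinGraph.{u}} (R : Realization A G')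

/-- The quantum isomorphism of a realization. -/
noncomputable def toQuantumIso : QuantumIso G' G where
  H := R.K
  P := R.P
  selfAdjoint := R.selfAdjoint
  row_orthogonal := R.row_orthogonal
  row_sum := R.row_sum
  col_orthogonal := R.col_orthogonal
  col_sum := R.col_sum
  intertwines := R.intertwines

/-- Realizations can be transported along graph isomorphisms. -/
noncomputable def relabel {G'' : FinGraph.{u}} (f : G''.graph ≃g G'.graph) :
    Realization A G'' where
  toEndIdentification := R.toEndIdentification
  P x v := R.P (f x) v
  selfAdjoint x v := R.selfAdjoint _ _
  row_orthogonal x v w := R.row_orthogonal _ _ _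
  row_sum x := R.row_sum _
  col_orthogonal x y v := by
    rw [R.col_orthogonal]
    by_cases h : x = y
    · simp [h]
    · simp [h, f.injective.ne h]
  col_sum v := (Equiv.sum_comp f.toEquiv fun x => R.P x v).trans (R.col_sum v)
  intertwines x v := by
    rw [← R.intertwines, ← Equiv.sum_comp f.toEquiv]
    refine Finset.sum_congr rfl fun y _ => ?_
    classical
    have h : (x = y ∨ G''.graph.Adj x y) ↔ (f x = f y ∨ G'.graph.Adj (f x) (f y)) := by
      rw [f.map_adj_iff, f.injective.eq_iff]
    exact congrArg (· • R.P (f y) v) (if_congr h rfl rfl)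
  component_elem v w a := by
    rw [R.component_elem, ← Equiv.sum_comp f.toEquiv]
    rfl

end Realization

/-- The projectors found in matrix coordinates are read as operators in the orthonormal basis that
defines those coordinates; orthonormality makes conjugate transposes into adjoints. This is the
source of surjectivity in the main theorem. -/
theorem exists_realization {A : Mon (QAut G)} (hA : IsCommutativeSimple A) :
    ∃ G' : FinGraph.{u}, Nonempty (Realization A G') := by
  obtain ⟨e, he⟩ := hA.centreDim_eq
  have : Nonempty (Fin (Module.finrank ℂ e.K)) := Fin.pos_iff_nonempty.mp Module.finrank_pos
  obtain ⟨G', P, hP⟩ := e.matrixAction.exists_matrixQuantumIso (e.centreDim_eq ▸ he)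
  let b := stdOrthonormalBasis ℂ e.K
  let L := Matrix.toLin b.toBasis b.toBasis
  have hL : ∀ m n, L m * L n = L (m * n) := fun m n => (Matrix.toLin_mul _ _ _ m n).symm
  refine ⟨G', ⟨{
    toEndIdentification := e
    P := fun x v => L (P.p x v)
    selfAdjoint := fun x v => by rw [← Matrix.toLin_conjTranspose, P.selfAdjoint]
    row_orthogonal := fun x v w => ?_
    row_sum := fun x => by rw [← map_sum, P.row_sum]; exact Matrix.toLin_one _
    col_orthogonal := fun x y v => ?_
    col_sum := fun v => by rw [← map_sum, P.col_sum]; exact Matrix.toLin_one _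
    intertwines := fun x v => by simpa using congrArg L (P.intertwines x v)
    component_elem := fun v w a => ?_ }⟩⟩
  · rw [hL]
    split_ifs with h
    · rw [h, P.row_same]
    · rw [P.row_of_ne _ _ _ h, map_zero]
  · rw [hL]
    split_ifs with h
    · rw [h, P.row_same]
    · rw [P.col_of_ne _ _ _ h, map_zero]
  · obtain ⟨m, rfl⟩ := L.surjective a
    have h : e.elem (L (e.comp v w m)) = A.X.P v w (e.elem (L m)) := e.matElem_comp v w m
    have h2 : e.comp v w m = _ := hP v w m
    rw [← h, h2, map_sum]
    simp only [hL]

end QAut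

/-! ## Intertwiners between realizations -/

/-- Idempotent scalars are 0 or 1, so the sum counts the ones. -/
theorem existsUnique_of_sum_eq_one {J : Type*} [Fintype J] (l : J → ℂ) (h : ∀ y, l y * l y = l y)
    (hs : ∑ y, l y = 1) : ∃! y, l y = 1 := by
  classical
  have h01 : ∀ y, l y = if l y = 1 then 1 else 0 := by
    intro y
    split_ifs with h1
    · exact h1
    · by_contra h0
      exact h1 (mul_left_cancel₀ h0 ((h y).trans (mul_one _).symm))
  rw [Finset.sum_congr rfl fun y _ => h01 y, Finset.sum_boole, Nat.cast_eq_one,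
    Finset.card_eq_one] at hs
  obtain ⟨y, hy⟩ := hs
  have hy' : ∀ z, l z = 1 ↔ z = y := fun z => by
    simpa using Finset.ext_iff.mp hy z
  exact ⟨y, (hy' y).mpr rfl, fun z hz => (hy' z).mp hz⟩

/-- A permutation matrix that intertwines the adjacency matrices is a graph isomorphism. -/
theorem FinGraph.nonempty_iso_of_matrix {G₁ G₂ : FinGraph.{u}} (l : G₁.V → G₂.V → ℂ)
    (hl : ∀ x y, l x y * l x y = l x y) (hrow : ∀ x, ∑ y, l x y = 1) (hcol : ∀ y, ∑ x, l x y = 1)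
    (hadj : ∀ x y, ∑ y', l x y' * G₂.adj y' y = ∑ x', G₁.adj x x' * l x' y) :
    Nonempty (G₁.graph ≃g G₂.graph) := by
  classical
  choose f hf hfu using fun x => existsUnique_of_sum_eq_one (l x) (hl x) (hrow x)
  choose g hg hgu using fun y => existsUnique_of_sum_eq_one (fun x => l x y) (fun x => hl x y) (hcol y)
  have h0 : ∀ x y, l x y ≠ 1 → l x y = 0 := fun x y h => by
    by_contra h1
    exact h (mul_left_cancel₀ h1 ((hl x y).trans (mul_one _).symm))
  let F : G₁.V ≃ G₂.V :=
    { toFun := f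
      invFun := g
      left_inv := fun x => (hgu (f x) x (hf x)).symm
      right_inv := fun y => (hfu (g y) y (hg y)).symm }
  have key : ∀ x x', G₂.adj (F x) (F x') = G₁.adj x x' := by
    intro x x'
    have := hadj x (F x')
    rw [Finset.sum_eq_single (F x), Finset.sum_eq_single x'] at this
    · change l x (f x) * _ = _ * l x' (f x') at this
      rw [hf, hf, one_mul, mul_one] at this
      exact this
    · intro z _ hz
      rw [h0, mul_zero]
      intro h
      exact hz (F.injective (hfu z _ h).symm)
    · simp
    · intro z _ hz
      rw [h0, zero_mul]
      intro h
      exact hz (hfu x _ h)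
    · simp
  have hiff : ∀ (G : FinGraph.{u}) (x y : G.V), G.adj x y = 1 ↔ (x = y ∨ G.graph.Adj x y) := by
    intro G x y
    unfold FinGraph.adj
    split_ifs with h <;> simp [h]
  refine ⟨⟨F, fun {x x'} => ?_⟩⟩
  have h := hiff G₂ (F x) (F x')
  rw [key, hiff] at h
  by_cases hx : x = x'
  · subst hx
    simp
  · simpa [hx, F.injective.ne hx] using h.symm

section Twirl

variable {R : Type*} [Ring R] {J V : Type*} [Fintype J] [Fintype V] {p : J → V → R} {N : V → R}

/-- Multiplying the covariance relation at w by `p x w` retains only the summand x, whose last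
factor does not depend on w. Summing over w then moves `a` past the averaged operator. -/
theorem twirl_commute (hp : ∀ x v, p x v * p x v = p x v) (hc : ∀ x y v, x ≠ y → p x v * p y v = 0)
    (hr : ∀ x, ∑ v, p x v = 1) {a : R}
    (hN : ∀ w, N w * a = ∑ x, p x w * a * ∑ z, p x z * N z)
    (x : J) : (∑ z, p x z * N z) * a = a * ∑ z, p x z * N z := by
  have h : ∀ z, p x z * N z * a = p x z * (a * ∑ u, p x u * N u) := by
    intro z
    rw [mul_assoc, hN, Finset.mul_sum, Finset.sum_eq_single x]
    · rw [mul_assoc, ← mul_assoc, hp]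
    · intro y _ hy
      rw [mul_assoc, ← mul_assoc, hc _ _ _ hy.symm, zero_mul]
    · simp
  rw [Finset.sum_mul, Finset.sum_congr rfl fun z _ => h z, ← Finset.sum_mul, hr, one_mul]

end Twirl

/-- Averaging the components `M` against `p` and then against `q` gives operators L_{x,y} = ∑_{v,w}
q_{y,v} p_{x,w} M_{v,w} that commute with both actions, hence are scalars. The relations of the
three projective permutation matrices make these scalars a permutation matrix that intertwines the
adjacency matrices. -/
theorem nonempty_iso_of_intertwiner {G G₁ G₂ : FinGraph.{u}} {R : Type*} [Ring R] [Algebra ℂ R]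
    [Nontrivial R] (p : G₁.V → G.V → R) (q : G₂.V → G.V → R) (M : G.V → G.V → R) (S T : Set R)
    (hp : ∀ x v, p x v * p x v = p x v) (hpc : ∀ x y v, x ≠ y → p x v * p y v = 0)
    (hpr : ∀ x, ∑ v, p x v = 1) (hps : ∀ v, ∑ x, p x v = 1)
    (hpa : ∀ x v, ∑ y, G₁.adj x y • p y v = ∑ w, G.adj w v • p x w)
    (hq : ∀ x v, q x v * q x v = q x v) (hqc : ∀ x y v, x ≠ y → q x v * q y v = 0)
    (hqr : ∀ x, ∑ v, q x v = 1) (hqs : ∀ v, ∑ x, q x v = 1)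
    (hqa : ∀ x v, ∑ y, G₂.adj x y • q y v = ∑ w, G.adj w v • q x w)
    (hpq : ∀ x v y w, p x v * q y w = q y w * p x v)
    (hM : ∀ v w, M v w * M v w = M v w) (hMr : ∀ v, ∑ w, M v w = 1) (hMs : ∀ w, ∑ v, M v w = 1)
    (hMa : ∀ v w, ∑ v', G.adj v v' • M v' w = ∑ w', G.adj w' w • M v w')
    (hS : ∀ a ∈ S, ∀ v w, M v w * a = ∑ x, p x w * a * ∑ z, p x z * M v z)
    (hT : ∀ b ∈ T, ∀ v w, M v w * b = ∑ y, q y v * b * ∑ z, q y z * M z w)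
    (hSq : ∀ a ∈ S, ∀ y v, a * q y v = q y v * a) (hTp : ∀ b ∈ T, ∀ x v, b * p x v = p x v * b)
    (hS1 : 1 ∈ S) (hT1 : 1 ∈ T)
    (hsc : ∀ Φ : R, (∀ a ∈ S, Φ * a = a * Φ) → (∀ b ∈ T, Φ * b = b * Φ) → ∃ c : ℂ, Φ = c • 1) :
    Nonempty (G₁.graph ≃g G₂.graph) := by
  let D : G₁.V → G.V → R := fun x v => ∑ z, p x z * M v z
  let L : G₁.V → G₂.V → R := fun x y => ∑ v, q y v * D x v
  have hMD : ∀ v w, M v w = ∑ x, p x w * D x v := fun v w => by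
    simpa using hS 1 hS1 v w
  have hDS : ∀ a ∈ S, ∀ x v, D x v * a = a * D x v := fun a ha x v =>
    twirl_commute hp hpc hpr (fun w => hS a ha v w) x
  -- The covariance of `M` under `T` passes to `D x`, because `p` commutes with `q` and with `T`.
  -- This permits a second application of `twirl_commute`.
  have hDT : ∀ b ∈ T, ∀ x v, D x v * b = ∑ y, q y v * b * L x y := by
    intro b hb x v
    simp only [D, L, Finset.sum_mul, mul_assoc, hT b hb, Finset.mul_sum]
    rw [Finset.sum_comm]
    refine Finset.sum_congr rfl fun y _ => ?_
    rw [Finset.sum_comm]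
    refine Finset.sum_congr rfl fun z _ => Finset.sum_congr rfl fun u _ => ?_
    rw [← mul_assoc (p x u), hpq, mul_assoc, ← mul_assoc (p x u) b, ← hTp b hb, mul_assoc,
      ← mul_assoc (p x u), hpq, mul_assoc]
  have hDL : ∀ x v, D x v = ∑ y, q y v * L x y := fun x v => by
    simpa using hDT 1 hT1 x v
  have hLT : ∀ b ∈ T, ∀ x y, L x y * b = b * L x y := fun b hb x y =>
    twirl_commute hq hqc hqr (fun w => hDT b hb x w) y
  have hLS : ∀ a ∈ S, ∀ x y, L x y * a = a * L x y := by
    intro a ha x y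
    simp only [L, Finset.sum_mul, Finset.mul_sum]
    refine Finset.sum_congr rfl fun v _ => ?_
    rw [mul_assoc, hDS a ha, ← mul_assoc, ← hSq a ha, mul_assoc]
  choose l hl using fun x y => hsc (L x y) (fun a ha => hLS a ha x y) (fun b hb => hLT b hb x y)
  have hinj : ∀ r s : ℂ, r • (1 : R) = s • 1 → r = s := fun r s h =>
    smul_left_injective ℂ (one_ne_zero (α := R)) h
  have hqD : ∀ x y v, q y v * D x v = l x y • q y v := by
    intro x y v
    rw [hDL, Finset.mul_sum, Finset.sum_eq_single y, ← mul_assoc, hq, hl, mul_smul_comm, mul_one]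
    · intro z _ hz
      rw [← mul_assoc, hqc _ _ _ hz.symm, zero_mul]
    · simp
  have hpM : ∀ x v w, p x w * M v w = p x w * D x v := by
    intro x v w
    rw [hMD, Finset.mul_sum, Finset.sum_eq_single x, ← mul_assoc, hp]
    · intro z _ hz
      rw [← mul_assoc, hpc _ _ _ hz.symm, zero_mul]
    · simp
  -- Each summand of `L x y` is already `l x y` times a product of projectors, so multiplying it
  -- again by `M v w` yields l² = l.
  have hqpM : ∀ x y v w, q y v * (p x w * M v w) = l x y • (q y v * p x w) := by
    intro x y v w
    rw [hpM, ← mul_assoc, ← hpq, mul_assoc, hqD, mul_smul_comm]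
  have hLsum : ∀ x y, L x y = ∑ v, ∑ w, q y v * (p x w * M v w) := fun x y => by
    simp only [L, D, Finset.mul_sum]
  refine FinGraph.nonempty_iso_of_matrix l (fun x y => hinj _ _ ?_) (fun x => hinj _ _ ?_)
    (fun y => hinj _ _ ?_) (fun x y => hinj _ _ ?_)
  · rw [mul_smul, ← hl, hLsum, Finset.smul_sum]
    refine Finset.sum_congr rfl fun v _ => ?_
    rw [Finset.smul_sum]
    refine Finset.sum_congr rfl fun w _ => ?_
    calc l x y • (q y v * (p x w * M v w)) = l x y • (q y v * p x w) * M v w := by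
          rw [smul_mul_assoc, mul_assoc]
      _ = q y v * (p x w * (M v w * M v w)) := by rw [← hqpM]; simp only [mul_assoc]
      _ = _ := by rw [hM]
  · rw [Finset.sum_smul, one_smul]
    simp only [← hl, hLsum]
    rw [Finset.sum_comm]
    conv_lhs => enter [2, v]; rw [Finset.sum_comm]
    simp only [← Finset.sum_mul, hqs, one_mul]
    rw [Finset.sum_comm]
    simp only [← Finset.mul_sum, hMs, mul_one, hpr]
  · rw [Finset.sum_smul, one_smul]
    simp only [← hl, hLsum]
    rw [Finset.sum_comm]
    conv_lhs => enter [2, v]; rw [Finset.sum_comm]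
    simp only [← Finset.mul_sum, ← Finset.sum_mul, hps, one_mul, hMr, mul_one, hqr]
  · rw [Finset.sum_smul, Finset.sum_smul]
    simp only [mul_comm (l _ _), mul_smul, ← hl, hLsum, Finset.smul_sum]
    calc ∑ y', ∑ v, ∑ w, G₂.adj y' y • (q y' v * (p x w * M v w))
        = ∑ v, ∑ w, (∑ u, G.adj u v • q y u) * (p x w * M v w) := by
          rw [Finset.sum_comm]
          refine Finset.sum_congr rfl fun v _ => ?_
          rw [Finset.sum_comm]
          refine Finset.sum_congr rfl fun w _ => ?_
          rw [← hqa, Finset.sum_mul]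
          simp only [G₂.adj_symm y, smul_mul_assoc]
      _ = ∑ u, ∑ w, q y u * (p x w * ∑ v, G.adj u v • M v w) := by
          simp only [Finset.sum_mul, Finset.mul_sum]
          conv_lhs => enter [2, v]; rw [Finset.sum_comm]
          rw [Finset.sum_comm]
          refine Finset.sum_congr rfl fun u _ => ?_
          rw [Finset.sum_comm]
          simp only [smul_mul_assoc, mul_smul_comm]
      _ = ∑ u, ∑ w', q y u * ((∑ w, G.adj w w' • p x w) * M u w') := by
          simp only [hMa, Finset.sum_mul, Finset.mul_sum]
          refine Finset.sum_congr rfl fun u _ => ?_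
          rw [Finset.sum_comm]
          refine Finset.sum_congr rfl fun w' _ => Finset.sum_congr rfl fun w _ => ?_
          simp only [smul_mul_assoc, mul_smul_comm, G.adj_symm w w']
      _ = ∑ x', ∑ v, ∑ w, G₁.adj x x' • (q y v * (p x' w * M v w)) := by
          simp only [← hpa, Finset.sum_mul, Finset.mul_sum]
          conv_lhs => enter [2, v]; rw [Finset.sum_comm]
          rw [Finset.sum_comm]
          simp only [smul_mul_assoc, mul_smul_comm]

/-! ### Bimodules as commuting actions on elements -/

namespace QAut

open QuantumIso MonObj

variable {G : FinGraph.{u}} {A B : Mon (QAut G)}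

/-- The left action of a bimodule, on elements. -/
noncomputable def leftAct (M : Bimod A B) : A.X.H →ₗ[ℂ] Module.End ℂ M.X.H :=
  TensorProduct.curry (Hom.lin M.actLeft : A.X.H ⊗[ℂ] M.X.H →ₗ[ℂ] M.X.H)

/-- The right action of a bimodule, on elements. -/
noncomputable def rightAct (M : Bimod A B) : B.X.H →ₗ[ℂ] Module.End ℂ M.X.H :=
  (TensorProduct.curry (Hom.lin M.actRight : M.X.H ⊗[ℂ] B.X.H →ₗ[ℂ] M.X.H)).flip

/-- The multiplication of a monoid, on elements. -/
noncomputable def mulElem (A : Mon (QAut G)) (a b : A.X.H) : A.X.H :=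
  (Hom.lin μ[A.X] : A.X.H ⊗[ℂ] A.X.H →ₗ[ℂ] A.X.H) (a ⊗ₜ[ℂ] b)

/-- The unit of a monoid, as an element. -/
noncomputable def oneElem (A : Mon (QAut G)) : A.X.H :=
  Hom.lin η[A.X] (1 : ℂ)

variable (M : Bimod A B)

theorem leftAct_one : leftAct M (oneElem A) = 1 := by
  refine LinearMap.ext fun m => ?_
  have h := LinearMap.congr_fun (congrArg Hom.lin M.one_actLeft)
    ((1 : ℂ) ⊗ₜ[ℂ] m : ℂ ⊗[ℂ] M.X.H)
  exact h.trans (one_smul ℂ m)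

theorem rightAct_one : rightAct M (oneElem B) = 1 := by
  refine LinearMap.ext fun m => ?_
  have h := LinearMap.congr_fun (congrArg Hom.lin M.actRight_one)
    (m ⊗ₜ[ℂ] (1 : ℂ) : M.X.H ⊗[ℂ] ℂ)
  exact h.trans (one_smul ℂ m)

theorem leftAct_mul (a b : A.X.H) : leftAct M (mulElem A a b) = leftAct M a * leftAct M b := by
  refine LinearMap.ext fun m => ?_
  exact LinearMap.congr_fun (congrArg Hom.lin M.left_assoc)
    ((a ⊗ₜ[ℂ] b) ⊗ₜ[ℂ] m : (A.X.H ⊗[ℂ] A.X.H) ⊗[ℂ] M.X.H)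

theorem rightAct_mul (a b : B.X.H) : rightAct M (mulElem B a b) = rightAct M b * rightAct M a := by
  refine LinearMap.ext fun m => ?_
  exact LinearMap.congr_fun (congrArg Hom.lin M.right_assoc)
    (m ⊗ₜ[ℂ] (a ⊗ₜ[ℂ] b) : M.X.H ⊗[ℂ] (B.X.H ⊗[ℂ] B.X.H))

theorem leftAct_rightAct (a : A.X.H) (b : B.X.H) :
    rightAct M b * leftAct M a = leftAct M a * rightAct M b := by
  refine LinearMap.ext fun m => ?_
  exact LinearMap.congr_fun (congrArg Hom.lin M.middle_assoc)
    ((a ⊗ₜ[ℂ] m) ⊗ₜ[ℂ] b : (A.X.H ⊗[ℂ] M.X.H) ⊗[ℂ] B.X.H)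

theorem component_mul_leftAct (v w : G.V) (a : A.X.H) :
    M.X.P v w * leftAct M a = ∑ z, leftAct M (A.X.P z w a) * M.X.P v z := by
  refine LinearMap.ext fun m => ?_
  rw [LinearMap.sum_apply]
  exact tensor_comm_component M.actLeft v w a m

theorem component_mul_rightAct (v w : G.V) (b : B.X.H) :
    M.X.P v w * rightAct M b = ∑ z, rightAct M (B.X.P v z b) * M.X.P z w := by
  refine LinearMap.ext fun m => ?_
  rw [LinearMap.sum_apply]
  exact tensor_comm_component M.actRight v w m b

theorem EndIdentification.mulElem_elem (e : EndIdentification A) (a b : e.K →ₗ[ℂ] e.K) :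
    mulElem A (e.elem a) (e.elem b) = e.elem (a * b) := e.mul_elem a b

theorem EndIdentification.oneElem_eq (e : EndIdentification A) : oneElem A = e.elem 1 :=
  e.one_eq_elem

/-- If all bimodule endomorphisms of a bimodule are scalar, then it is given by a graph
isomorphism. -/
theorem nonempty_iso_of_bimod {G₁ G₂ : FinGraph.{u}} (R : Realization A G₁) (S : Realization B G₂)
    [Nontrivial M.X.H]
    (hsc : ∀ Φ : Module.End ℂ M.X.H, (∀ a, Φ * leftAct M a = leftAct M a * Φ) →
      (∀ b, Φ * rightAct M b = rightAct M b * Φ) → ∃ c : ℂ, Φ = c • 1) :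
    Nonempty (G₁.graph ≃g G₂.graph) := by
  classical
  let l : Module.End ℂ R.K →ₗ[ℂ] Module.End ℂ M.X.H := leftAct M ∘ₗ R.elem.toLinearMap
  let r : Module.End ℂ S.K →ₗ[ℂ] Module.End ℂ M.X.H := rightAct M ∘ₗ S.elem.toLinearMap
  have hl : ∀ a b, l (a * b) = l a * l b := fun a b => by
    change leftAct M (R.elem _) = leftAct M (R.elem _) * leftAct M (R.elem _)
    rw [← leftAct_mul, R.mulElem_elem]
  have hr : ∀ a b, r (a * b) = r b * r a := fun a b => by
    change rightAct M (S.elem _) = rightAct M (S.elem _) * rightAct M (S.elem _)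
    rw [← rightAct_mul, S.mulElem_elem]
  have hl1 : l 1 = 1 := by
    change leftAct M (R.elem 1) = 1
    rw [← R.oneElem_eq, leftAct_one]
  have hr1 : r 1 = 1 := by
    change rightAct M (S.elem 1) = 1
    rw [← S.oneElem_eq, rightAct_one]
  have hlr : ∀ a b, r b * l a = l a * r b := fun a b => leftAct_rightAct M _ _
  refine nonempty_iso_of_intertwiner (G := G) (fun x v => l (R.P x v)) (fun y v => r (S.P y v))
    (fun v w => M.X.P v w) (Set.range l) (Set.range r) ?_ ?_ ?_ ?_ ?_ ?_ ?_ ?_ ?_ ?_ ?_ ?_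
    M.X.row_sum M.X.col_sum M.X.intertwines ?_ ?_ ?_ ?_ ⟨1, hl1⟩ ⟨1, hr1⟩ ?_
  · intro x v
    rw [← hl, R.row_orthogonal, if_pos rfl]
  · intro x y v h
    rw [← hl, R.col_orthogonal, if_neg h, map_zero]
  · intro x
    rw [← map_sum, R.row_sum, hl1]
  · intro v
    rw [← map_sum, R.col_sum, hl1]
  · intro x v
    simpa using congrArg l (R.intertwines x v)
  · intro x v
    rw [← hr, S.row_orthogonal, if_pos rfl]
  · intro x y v h
    rw [← hr, S.col_orthogonal, if_neg h.symm, map_zero]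
  · intro x
    rw [← map_sum, S.row_sum, hr1]
  · intro v
    rw [← map_sum, S.col_sum, hr1]
  · intro x v
    simpa using congrArg r (S.intertwines x v)
  · intro x v y w
    exact (hlr _ _).symm
  · intro v w
    rw [M.X.row_orthogonal, if_pos rfl]
  · rintro _ ⟨a, rfl⟩ v w
    change M.X.P v w * leftAct M (R.elem a) = _
    rw [component_mul_leftAct]
    have : ∀ z, leftAct M (A.X.P z w (R.elem a)) = ∑ x, l (R.P x w) * l a * l (R.P x z) := by
      intro z
      rw [R.component_elem]
      change l _ = _
      simp only [map_sum, hl]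
    simp only [this, Finset.sum_mul, Finset.mul_sum]
    rw [Finset.sum_comm]
    simp only [_root_.mul_assoc]
  · rintro _ ⟨b, rfl⟩ v w
    change M.X.P v w * rightAct M (S.elem b) = _
    rw [component_mul_rightAct]
    have : ∀ z, rightAct M (B.X.P v z (S.elem b)) = ∑ y, r (S.P y v) * r b * r (S.P y z) := by
      intro z
      rw [S.component_elem]
      change r _ = _
      simp only [map_sum, hr, _root_.mul_assoc]
    simp only [this, Finset.sum_mul, Finset.mul_sum]
    rw [Finset.sum_comm]
    simp only [_root_.mul_assoc]
  · rintro _ ⟨a, rfl⟩ y v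
    exact (hlr _ _).symm
  · rintro _ ⟨b, rfl⟩ x v
    exact hlr _ _
  · intro Φ h1 h2
    refine hsc Φ (fun a => ?_) (fun b => ?_)
    · obtain ⟨a, rfl⟩ := R.elem.surjective a
      exact h1 _ ⟨a, rfl⟩
    · obtain ⟨b, rfl⟩ := S.elem.surjective b
      exact h2 _ ⟨b, rfl⟩

end QAut

/-! ### Comultiplication, Frobenius equations and the relative idempotent -/

section InnerTensor

variable {E F : Type*} [NormedAddCommGroup E] [InnerProductSpace ℂ E] [NormedAddCommGroup F]
  [InnerProductSpace ℂ F]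

theorem tensor_ext_inner {s t : E ⊗[ℂ] F}
    (h : ∀ x y, inner ℂ (x ⊗ₜ[ℂ] y) s = inner ℂ (x ⊗ₜ[ℂ] y) t) : s = t := by
  refine ext_inner_left ℂ fun r => ?_
  induction r with
  | zero => rw [inner_zero_left, inner_zero_left]
  | tmul x y => exact h x y
  | add a b ha hb => rw [inner_add_left, inner_add_left, ha, hb]

theorem eq_zero_of_tmul_eq_zero {x : E} {y : F} (h : x ⊗ₜ[ℂ] y = 0) (hy : y ≠ 0) : x = 0 := by
  have h1 : inner ℂ (x ⊗ₜ[ℂ] y) (x ⊗ₜ[ℂ] y) = (0 : ℂ) := by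
    rw [h, inner_zero_left]
  rw [TensorProduct.inner_tmul] at h1
  exact inner_self_eq_zero.mp ((mul_eq_zero.mp h1).resolve_right (inner_self_ne_zero.mpr hy))

end InnerTensor

theorem Matrix.single_mul_single_eq_ite {ι : Type*} [Fintype ι] [DecidableEq ι] (i j k l : ι) :
    Matrix.single i j (1 : ℂ) * Matrix.single k l 1 =
      if j = k then Matrix.single i l 1 else 0 := by
  split_ifs with h
  · subst h
    rw [Matrix.single_mul_single_same, mul_one]
  · exact Matrix.single_mul_single_of_ne (h := h) ..

namespace QAut

open QuantumIso MonObj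

variable {G : FinGraph.{u}} {A B : Mon (QAut G)}

/-- The comultiplication of a monoid, on elements. -/
noncomputable def comulElem (A : Mon (QAut G)) : A.X.H →ₗ[ℂ] A.X.H ⊗[ℂ] A.X.H :=
  Hom.lin (comul A)

/-- The multiplication of a monoid, as a linear map. -/
noncomputable def mulLin (A : Mon (QAut G)) : A.X.H ⊗[ℂ] A.X.H →ₗ[ℂ] A.X.H :=
  Hom.lin μ[A.X]

theorem inner_comulElem (x y a : A.X.H) :
    inner ℂ (x ⊗ₜ[ℂ] y) (comulElem A a) = inner ℂ (mulElem A x y) a :=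
  LinearMap.adjoint_inner_right (mulLin A) (x ⊗ₜ[ℂ] y) a

namespace EndIdentification

variable (e : EndIdentification A)

theorem mulElem_matElem (a b : Matrix (Fin (Module.finrank ℂ e.K)) (Fin (Module.finrank ℂ e.K)) ℂ) :
    mulElem A (e.matElem a) (e.matElem b) = e.matElem (a * b) := e.mul_matElem a b

theorem oneElem_matElem : oneElem A = e.matElem 1 := e.one_eq_matElem

theorem finrank_ne_zero : (Module.finrank ℂ e.K : ℂ) ≠ 0 :=
  Nat.cast_ne_zero.mpr Module.finrank_pos.ne'

/-- Comultiplication is determined by pairing with `x ⊗ y`, and the matrix units E_ij and E_ji are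
dual bases for the trace. Two inner products on one side against one on the other leave n⁻¹. -/
theorem comulElem_matElem_left
    (a : Matrix (Fin (Module.finrank ℂ e.K)) (Fin (Module.finrank ℂ e.K)) ℂ) :
    comulElem A (e.matElem a) = (Module.finrank ℂ e.K : ℂ)⁻¹ • ∑ i, ∑ j,
      e.matElem (a * Matrix.single i j 1) ⊗ₜ[ℂ] e.matElem (Matrix.single j i 1) := by
  refine tensor_ext_inner fun x y => ?_
  obtain ⟨x, rfl⟩ := e.matElem.surjective x
  obtain ⟨y, rfl⟩ := e.matElem.surjective y
  rw [inner_comulElem, mulElem_matElem, inner_matElem, inner_tensor_smul_right,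
    eq_inv_mul_iff_mul_eq₀ e.finrank_ne_zero]
  simp only [inner_tensor_sum_right, TensorProduct.inner_tmul, inner_matElem, Matrix.trace_mul_single,
    ← Matrix.mul_assoc, MulOpposite.op_one, one_smul]
  rw [Matrix.conjTranspose_mul, Matrix.mul_assoc, Matrix.trace_mul_comm]
  simp only [Matrix.trace, Matrix.diag_apply, Matrix.mul_apply (M := x.conjTranspose * a),
    Finset.mul_sum]
  rw [Finset.sum_comm]
  exact Finset.sum_congr rfl fun i _ => Finset.sum_congr rfl fun j _ => by ring

/-- The same tensor with `a` on the right leg. Each of the two forms makes one Frobenius equation an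
instance of associativity. -/
theorem comulElem_matElem_right
    (a : Matrix (Fin (Module.finrank ℂ e.K)) (Fin (Module.finrank ℂ e.K)) ℂ) :
    comulElem A (e.matElem a) = (Module.finrank ℂ e.K : ℂ)⁻¹ • ∑ i, ∑ j,
      e.matElem (Matrix.single i j 1) ⊗ₜ[ℂ] e.matElem (Matrix.single j i 1 * a) := by
  refine tensor_ext_inner fun x y => ?_
  obtain ⟨x, rfl⟩ := e.matElem.surjective x
  obtain ⟨y, rfl⟩ := e.matElem.surjective y
  rw [inner_comulElem, mulElem_matElem, inner_matElem, inner_tensor_smul_right,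
    eq_inv_mul_iff_mul_eq₀ e.finrank_ne_zero]
  have h : ∀ i j, (y.conjTranspose * (Matrix.single j i 1 * a)).trace = (a * y.conjTranspose) i j := by
    intro i j
    rw [← Matrix.mul_assoc, Matrix.trace_mul_comm, ← Matrix.mul_assoc, Matrix.trace_mul_single]
    simp
  simp only [inner_tensor_sum_right, TensorProduct.inner_tmul, inner_matElem, Matrix.trace_mul_single,
    h, MulOpposite.op_one, one_smul]
  rw [Matrix.conjTranspose_mul, Matrix.mul_assoc, Matrix.trace_mul_comm, Matrix.mul_assoc]
  simp only [Matrix.trace, Matrix.diag_apply, Matrix.mul_apply (M := x.conjTranspose),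
    Finset.mul_sum]
  rw [Finset.sum_comm]
  exact Finset.sum_congr rfl fun i _ => Finset.sum_congr rfl fun j _ => by ring

end EndIdentification

theorem lin_whiskerLeft_comul (A : Mon (QAut G)) (a b : A.X.H) :
    Hom.lin (A.X ◁ comul A ≫ (α_ A.X A.X A.X).inv ≫ μ[A.X] ▷ A.X) (a ⊗ₜ[ℂ] b : A.X.H ⊗[ℂ] A.X.H) =
      TensorProduct.map (mulLin A ∘ₗ TensorProduct.mk ℂ A.X.H A.X.H a) LinearMap.id
        (comulElem A b) := by
  change TensorProduct.map (mulLin A) LinearMap.id ((TensorProduct.assoc ℂ A.X.H A.X.H A.X.H).symm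
    (a ⊗ₜ[ℂ] comulElem A b)) = _
  generalize comulElem A b = t
  induction t with
  | zero => simp
  | tmul x y => rfl
  | add s t hs ht => rw [TensorProduct.tmul_add, map_add, map_add, map_add, hs, ht]

theorem lin_whiskerRight_comul (A : Mon (QAut G)) (a b : A.X.H) :
    Hom.lin (comul A ▷ A.X ≫ (α_ A.X A.X A.X).hom ≫ A.X ◁ μ[A.X]) (a ⊗ₜ[ℂ] b : A.X.H ⊗[ℂ] A.X.H) =
      TensorProduct.map LinearMap.id (mulLin A ∘ₗ (TensorProduct.mk ℂ A.X.H A.X.H).flip b)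
        (comulElem A a) := by
  change TensorProduct.map LinearMap.id (mulLin A) (TensorProduct.assoc ℂ A.X.H A.X.H A.X.H
    (comulElem A a ⊗ₜ[ℂ] b)) = _
  generalize comulElem A a = t
  induction t with
  | zero => simp
  | tmul x y => rfl
  | add s t hs ht => rw [TensorProduct.add_tmul, map_add, map_add, map_add, hs, ht]

theorem EndIdentification.isDaggerFrobenius (e : EndIdentification A) : IsDaggerFrobenius A where
  frobenius_left := by
    refine hom_ext (TensorProduct.ext' fun a b => ?_)
    refine (lin_whiskerLeft_comul A a b).trans ?_
    change _ = comulElem A (mulElem A a b)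
    obtain ⟨x, rfl⟩ := e.matElem.surjective a
    obtain ⟨y, rfl⟩ := e.matElem.surjective b
    rw [e.mulElem_matElem, e.comulElem_matElem_left, e.comulElem_matElem_left]
    simp only [map_smul, map_sum, TensorProduct.map_tmul]
    refine congrArg _ (Finset.sum_congr rfl fun i _ => Finset.sum_congr rfl fun j _ => ?_)
    exact congrArg₂ _ ((e.mulElem_matElem _ _).trans (by rw [Matrix.mul_assoc])) rfl
  frobenius_right := by
    refine hom_ext (TensorProduct.ext' fun a b => ?_)
    refine (lin_whiskerRight_comul A a b).trans ?_
    change _ = comulElem A (mulElem A a b)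
    obtain ⟨x, rfl⟩ := e.matElem.surjective a
    obtain ⟨y, rfl⟩ := e.matElem.surjective b
    rw [e.mulElem_matElem, e.comulElem_matElem_right, e.comulElem_matElem_right]
    simp only [map_smul, map_sum, TensorProduct.map_tmul]
    refine congrArg _ (Finset.sum_congr rfl fun i _ => Finset.sum_congr rfl fun j _ => ?_)
    exact congrArg₂ _ rfl ((e.mulElem_matElem _ _).trans (by rw [Matrix.mul_assoc]))

section RelIdempotent

variable {D : Mon (QAut G)} (M : Bimod A B) (N : Bimod B D)

/-- The idempotent for the relative tensor product, as a linear map. -/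
noncomputable def relLin : M.X.H ⊗[ℂ] N.X.H →ₗ[ℂ] M.X.H ⊗[ℂ] N.X.H :=
  Hom.lin (relIdempotent M N)

/-- The cup is the comultiplication of 1, that is n⁻¹ ∑ E_ij ⊗ E_ji, and its two legs act on `M` and
on `N`. -/
theorem relLin_eq (e : EndIdentification B) :
    relLin M N = (Module.finrank ℂ e.K : ℂ)⁻¹ • ∑ i, ∑ j,
      TensorProduct.map (rightAct M (e.matElem (Matrix.single i j 1)))
        (leftAct N (e.matElem (Matrix.single j i 1))) := by
  let mR : M.X.H ⊗[ℂ] B.X.H →ₗ[ℂ] M.X.H := Hom.lin M.actRight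
  let nL : B.X.H ⊗[ℂ] N.X.H →ₗ[ℂ] N.X.H := Hom.lin N.actLeft
  refine TensorProduct.ext' fun m n => ?_
  have h : relLin M N (m ⊗ₜ[ℂ] n) = TensorProduct.map mR nL
      ((TensorProduct.assoc ℂ M.X.H B.X.H (B.X.H ⊗[ℂ] N.X.H)).symm
        (m ⊗ₜ[ℂ] (TensorProduct.assoc ℂ B.X.H B.X.H N.X.H
          (comulElem B (oneElem B) ⊗ₜ[ℂ] n)))) := rfl
  have key : ∀ t : B.X.H ⊗[ℂ] B.X.H, TensorProduct.map mR nL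
      ((TensorProduct.assoc ℂ M.X.H B.X.H (B.X.H ⊗[ℂ] N.X.H)).symm
        (m ⊗ₜ[ℂ] (TensorProduct.assoc ℂ B.X.H B.X.H N.X.H (t ⊗ₜ[ℂ] n)))) =
      TensorProduct.map (mR ∘ₗ TensorProduct.mk ℂ M.X.H B.X.H m)
        (nL ∘ₗ (TensorProduct.mk ℂ B.X.H N.X.H).flip n) t := by
    intro t
    induction t with
    | zero => simp
    | tmul x y => rfl
    | add s t hs ht => rw [TensorProduct.add_tmul, map_add, TensorProduct.tmul_add, map_add,
        map_add, map_add, hs, ht]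
  rw [h, key, e.oneElem_matElem, e.comulElem_matElem_left]
  simp only [map_smul, map_sum, Matrix.one_mul, LinearMap.smul_apply, LinearMap.sum_apply]
  rfl

end RelIdempotent

end QAut

/-! ### A Morita equivalence bimodule has only scalar endomorphisms -/

namespace QAut

open QuantumIso

variable {G : FinGraph.{u}} {A B D : Mon (QAut G)}

theorem lin_actLeft_tensor (M : Bimod A B) (N : Bimod B D) (a : A.X.H) (t : M.X.H ⊗[ℂ] N.X.H) :
    Hom.lin ((α_ A.X M.X N.X).inv ≫ M.actLeft ▷ N.X)
        (a ⊗ₜ[ℂ] t : A.X.H ⊗[ℂ] (M.X.H ⊗[ℂ] N.X.H)) =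
      TensorProduct.map (leftAct M a) (LinearMap.id : N.X.H →ₗ[ℂ] N.X.H) t := by
  let mL : A.X.H ⊗[ℂ] M.X.H →ₗ[ℂ] M.X.H := Hom.lin M.actLeft
  change TensorProduct.map mL LinearMap.id
    ((TensorProduct.assoc ℂ A.X.H M.X.H N.X.H).symm (a ⊗ₜ[ℂ] t)) = _
  induction t with
  | zero => simp
  | tmul x y => rfl
  | add s t hs ht => rw [TensorProduct.tmul_add, map_add, map_add, map_add, hs, ht]

theorem lin_actRight_tensor (M : Bimod A B) (N : Bimod B D) (d : D.X.H) (t : M.X.H ⊗[ℂ] N.X.H) :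
    Hom.lin ((α_ M.X N.X D.X).hom ≫ M.X ◁ N.actRight)
        (t ⊗ₜ[ℂ] d : (M.X.H ⊗[ℂ] N.X.H) ⊗[ℂ] D.X.H) =
      TensorProduct.map (LinearMap.id : M.X.H →ₗ[ℂ] M.X.H) (rightAct N d) t := by
  let nR : N.X.H ⊗[ℂ] D.X.H →ₗ[ℂ] N.X.H := Hom.lin N.actRight
  change TensorProduct.map LinearMap.id nR
    (TensorProduct.assoc ℂ M.X.H N.X.H D.X.H (t ⊗ₜ[ℂ] d)) = _
  induction t with
  | zero => simp
  | tmul x y => rfl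
  | add s t hs ht => rw [TensorProduct.add_tmul, map_add, map_add, map_add, hs, ht]

theorem EndIdentification.nontrivial_space (e : EndIdentification A) : Nontrivial A.X.H :=
  e.elem.symm.toEquiv.nontrivial

theorem EndIdentification.mem_span_one_of_commute (e : EndIdentification A) (z : A.X.H)
    (h : ∀ a, mulElem A a z = mulElem A z a) : ∃ c : ℂ, z = c • oneElem A := by
  obtain ⟨m, rfl⟩ := e.matElem.surjective z
  have hm : m ∈ Set.range (Matrix.scalar (Fin (Module.finrank ℂ e.K))) := by
    refine Matrix.mem_range_scalar_of_commute_single fun i j _ => ?_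
    have := h (e.matElem (Matrix.single i j 1))
    rw [e.mulElem_matElem, e.mulElem_matElem] at this
    exact e.matElem.injective this
  obtain ⟨c, rfl⟩ := hm
  refine ⟨c, ?_⟩
  rw [e.oneElem_matElem, ← map_smul]
  congr 1
  rw [Matrix.scalar_apply, Matrix.smul_one_eq_diagonal]

theorem mulElem_zero_left (a : A.X.H) : mulElem A 0 a = 0 :=
  (congrArg (mulLin A) (TensorProduct.zero_tmul _ _)).trans (map_zero (mulLin A))

section Scalar

variable (M : Bimod A B) (N : Bimod B A) {i : (Bimod.regular A).X ⟶ M.X ⊗ N.X}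
  (h : IsRelTensor M N (Bimod.regular A) i)

include h

theorem nontrivial_of_isRelTensor (e : EndIdentification A) :
    Nontrivial M.X.H ∧ Nontrivial N.X.H := by
  let iL : A.X.H →ₗ[ℂ] M.X.H ⊗[ℂ] N.X.H := Hom.lin i
  let jL : M.X.H ⊗[ℂ] N.X.H →ₗ[ℂ] A.X.H := Hom.lin (dagger i)
  have h1 : ∀ q, jL (iL q) = q := fun q => LinearMap.congr_fun (congrArg Hom.lin h.isometry) q
  have hi : Function.Injective iL := Function.LeftInverse.injective h1
  have := e.nontrivial_space
  have hMN := hi.nontrivial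
  constructor
  · by_contra hM
    rw [not_nontrivial_iff_subsingleton] at hM
    exact not_subsingleton (M.X.H ⊗[ℂ] N.X.H) inferInstance
  · by_contra hN
    rw [not_nontrivial_iff_subsingleton] at hN
    exact not_subsingleton (M.X.H ⊗[ℂ] N.X.H) inferInstance

/-- Φ ⊗ 1 commutes with the relative idempotent r and so induces a bimodule endomorphism of `A`.
This is multiplication by a central element, hence a scalar c, and (Φ ⊗ 1) r = c r. Conjugates of r
by operators on `N`, which commute with Φ ⊗ 1, sum to a multiple of the identity; thus Φ ⊗ 1 = c,
and `N` is nonzero. -/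
theorem eq_smul_one_of_isRelTensor (eA : EndIdentification A) (eB : EndIdentification B)
    (Φ : Module.End ℂ M.X.H) (hl : ∀ a, Φ * leftAct M a = leftAct M a * Φ)
    (hr : ∀ b, Φ * rightAct M b = rightAct M b * Φ) : ∃ c : ℂ, Φ = c • 1 := by
  let iL : A.X.H →ₗ[ℂ] M.X.H ⊗[ℂ] N.X.H := Hom.lin i
  let jL : M.X.H ⊗[ℂ] N.X.H →ₗ[ℂ] A.X.H := Hom.lin (dagger i)
  let T : Module.End ℂ M.X.H → Module.End ℂ N.X.H → Module.End ℂ (M.X.H ⊗[ℂ] N.X.H) :=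
    fun x y => TensorProduct.map x y
  have hT : ∀ x y x' y', T x y * T x' y' = T (x * x') (y * y') := fun x y x' y' =>
    (TensorProduct.map_mul x x' y y').symm
  let r : Module.End ℂ (M.X.H ⊗[ℂ] N.X.H) := relLin M N
  have hr0 : (Module.finrank ℂ eB.K : ℂ) • r = ∑ i, ∑ j,
      T (rightAct M (eB.matElem (Matrix.single i j 1)))
        (leftAct N (eB.matElem (Matrix.single j i 1))) := by
    rw [inv_smul_eq_iff₀ eB.finrank_ne_zero |>.mp (relLin_eq M N eB).symm |>.symm]
  have hrT : ∀ x y, (∀ b, x * rightAct M b = rightAct M b * x) →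
      (∀ b, y * leftAct N b = leftAct N b * y) → r * T x y = T x y * r := by
    intro x y hx hy
    apply smul_right_injective _ eB.finrank_ne_zero
    change (_ : ℂ) • (r * T x y) = (_ : ℂ) • (T x y * r)
    rw [← smul_mul_assoc, ← mul_smul_comm, hr0, Finset.sum_mul, Finset.mul_sum]
    refine Finset.sum_congr rfl fun i _ => ?_
    rw [Finset.sum_mul, Finset.mul_sum]
    refine Finset.sum_congr rfl fun j _ => ?_
    rw [hT, hT, hx, hy]
  have h1 : ∀ q, jL (iL q) = q := fun q => LinearMap.congr_fun (congrArg Hom.lin h.isometry) q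
  have h2 : ∀ t, iL (jL t) = r t := fun t => LinearMap.congr_fun (congrArg Hom.lin h.splits) t
  have hri : ∀ q, r (iL q) = iL q := fun q => by rw [← h2, h1]
  have h3 : ∀ a q, jL (T (leftAct M a) 1 (iL q)) = mulElem A a q := fun a q =>
    (congrArg jL (lin_actLeft_tensor M N a (iL q)).symm).trans
      (LinearMap.congr_fun (congrArg Hom.lin h.actLeft) (a ⊗ₜ[ℂ] q : A.X.H ⊗[ℂ] A.X.H))
  have h4 : ∀ a q, jL (T 1 (rightAct N a) (iL q)) = mulElem A q a := fun a q =>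
    (congrArg jL (lin_actRight_tensor M N a (iL q)).symm).trans
      (LinearMap.congr_fun (congrArg Hom.lin h.actRight) (q ⊗ₜ[ℂ] a : A.X.H ⊗[ℂ] A.X.H))
  have hla : ∀ a, r * T (leftAct M a) 1 = T (leftAct M a) 1 * r := fun a =>
    hrT _ _ (fun b => (leftAct_rightAct M a b).symm) fun b => by rw [one_mul, mul_one]
  have hra : ∀ a, r * T 1 (rightAct N a) = T 1 (rightAct N a) * r := fun a =>
    hrT _ _ (fun b => by rw [one_mul, mul_one]) fun b => leftAct_rightAct N b a
  have hΦ : r * T Φ 1 = T Φ 1 * r := hrT _ _ hr fun b => by rw [one_mul, mul_one]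
  have h5 : ∀ a q, T (leftAct M a) 1 (iL q) = iL (mulElem A a q) := fun a q => by
    rw [← h3, h2]
    exact (congrArg (T (leftAct M a) 1) (hri q)).symm.trans
      (LinearMap.congr_fun (hla a) (iL q)).symm
  have h6 : ∀ a q, T 1 (rightAct N a) (iL q) = iL (mulElem A q a) := fun a q => by
    rw [← h4, h2]
    exact (congrArg (T 1 (rightAct N a)) (hri q)).symm.trans
      (LinearMap.congr_fun (hra a) (iL q)).symm
  have hone : ∀ a, mulElem A a (oneElem A) = a ∧ mulElem A (oneElem A) a = a := by
    intro a
    obtain ⟨a, rfl⟩ := eA.matElem.surjective a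
    rw [eA.oneElem_matElem, eA.mulElem_matElem, eA.mulElem_matElem, mul_one, one_mul]
    exact ⟨rfl, rfl⟩
  -- The image of the unit under the endomorphism of `A` induced by Φ ⊗ 1. Left linearity makes that
  -- endomorphism right multiplication by `z`, and right linearity makes it left multiplication, so
  -- `z` is central.
  let z := jL (T Φ 1 (iL (oneElem A)))
  have hz : iL z = T Φ 1 (iL (oneElem A)) := by
    rw [h2]
    exact (LinearMap.congr_fun hΦ (iL (oneElem A))).trans (congrArg _ (hri _))
  have hΦl : ∀ a, T Φ 1 * T (leftAct M a) 1 = T (leftAct M a) 1 * T Φ 1 := fun a => by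
    rw [hT, hT, hl]
  have hΦr : ∀ a, T Φ 1 * T 1 (rightAct N a) = T 1 (rightAct N a) * T Φ 1 := fun a => by
    rw [hT, hT, one_mul, one_mul, mul_one, mul_one]
  have h7 : ∀ a, T Φ 1 (iL a) = iL (mulElem A a z) := fun a => by
    rw [← h5, hz]
    refine Eq.trans ?_ (LinearMap.congr_fun (hΦl a) (iL (oneElem A)))
    rw [Module.End.mul_apply, h5, (hone a).1]
  have h8 : ∀ a, T Φ 1 (iL a) = iL (mulElem A z a) := fun a => by
    rw [← h6, hz]
    refine Eq.trans ?_ (LinearMap.congr_fun (hΦr a) (iL (oneElem A)))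
    rw [Module.End.mul_apply, h6, (hone a).2]
  have hi : Function.Injective iL := Function.LeftInverse.injective h1
  obtain ⟨c, hc⟩ := eA.mem_span_one_of_commute z fun a => hi ((h7 a).symm.trans (h8 a))
  have h9 : T Φ 1 * r = c • r := by
    refine LinearMap.ext fun t => ?_
    have : mulElem A (jL t) (c • oneElem A) = c • mulElem A (jL t) (oneElem A) :=
      map_smul (mulLin A ∘ₗ TensorProduct.mk ℂ _ _ (jL t)) _ _
    rw [Module.End.mul_apply, LinearMap.smul_apply, ← h2, h7, hc, this, (hone _).1, map_smul]
  refine ⟨c, ?_⟩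
  let E : Fin (Module.finrank ℂ eB.K) → Fin (Module.finrank ℂ eB.K) → B.X.H :=
    fun p q => eB.matElem (Matrix.single p q 1)
  have hE : ∀ p q p' q', mulElem B (E p q) (E p' q') = if q = p' then E p q' else 0 := by
    intro p q p' q'
    rw [eB.mulElem_matElem, Matrix.single_mul_single_eq_ite]
    split_ifs
    · rfl
    · exact map_zero _
  -- E_lm E_ji E_ml vanishes unless i = j = m, when it is E_ll; only one term of r survives. Over
  -- all m and l these operators add up to the identity.
  have h10 : ∀ m l, T (rightAct M (E m m)) (leftAct N (E l l)) = (Module.finrank ℂ eB.K : ℂ) •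
      (T 1 (leftAct N (E l m)) * r * T 1 (leftAct N (E m l))) := by
    intro m l
    rw [← smul_mul_assoc, ← mul_smul_comm, hr0]
    simp only [Finset.sum_mul, Finset.mul_sum, hT, one_mul, mul_one, ← leftAct_mul]
    rw [Finset.sum_eq_single m, Finset.sum_eq_single m]
    · change _ = T (rightAct M (E m m))
        (leftAct N (mulElem B (mulElem B (E l m) (E m m)) (E m l)))
      simp only [hE, if_true]
    · intro j _ hj
      change T _ (leftAct N (mulElem B (mulElem B (E l m) (E j m)) (E m l))) = 0
      rw [hE, if_neg hj.symm]
      rw [mulElem_zero_left, map_zero]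
      exact TensorProduct.map_zero_right _
    · simp
    · intro i _ hi
      refine Finset.sum_eq_zero fun j _ => ?_
      change T _ (leftAct N (mulElem B (mulElem B (E l m) (E j i)) (E m l))) = 0
      have : mulElem B (mulElem B (E l m) (E j i)) (E m l) = 0 := by
        rw [hE]
        split_ifs
        · rw [hE, if_neg hi]
        · exact mulElem_zero_left _
      rw [this, map_zero]
      exact TensorProduct.map_zero_right _
    · simp
  have hsum : ∑ m, E m m = oneElem B := by
    rw [eB.oneElem_matElem, ← map_sum]
    rw [Matrix.sum_single_one]
  have h11 : (1 : Module.End ℂ (M.X.H ⊗[ℂ] N.X.H)) =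
      ∑ m, ∑ l, T (rightAct M (E m m)) (leftAct N (E l l)) := by
    have h12 : ∀ m, ∑ l, T (rightAct M (E m m)) (leftAct N (E l l)) = T (rightAct M (E m m)) 1 := by
      intro m
      rw [← leftAct_one N, ← hsum, map_sum]
      exact (map_sum_right _ _ _).symm
    simp only [h12]
    rw [← TensorProduct.map_one, ← rightAct_one M, ← hsum, map_sum]
    exact map_sum_left _ _ _
  have h13 : T Φ 1 = c • 1 := by
    have : T Φ 1 * 1 = c • 1 := by
      rw [h11, Finset.mul_sum, Finset.smul_sum]
      refine Finset.sum_congr rfl fun m _ => ?_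
      rw [Finset.mul_sum, Finset.smul_sum]
      refine Finset.sum_congr rfl fun l _ => ?_
      rw [h10, mul_smul_comm, smul_comm c, ← mul_assoc, ← mul_assoc]
      have : T Φ 1 * T 1 (leftAct N (E l m)) = T 1 (leftAct N (E l m)) * T Φ 1 := by
        rw [hT, hT, one_mul, mul_one, one_mul, mul_one]
      rw [this, mul_assoc _ (T Φ 1), h9, mul_smul_comm, smul_mul_assoc]
    rwa [mul_one] at this
  have := (nontrivial_of_isRelTensor M N h eA).2
  obtain ⟨y, hy⟩ := exists_ne (0 : N.X.H)
  refine LinearMap.ext fun x => ?_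
  have h14 := LinearMap.congr_fun h13 (x ⊗ₜ[ℂ] y)
  rw [← sub_eq_zero]
  refine eq_zero_of_tmul_eq_zero (y := y) ?_ hy
  rw [TensorProduct.sub_tmul, sub_eq_zero]
  exact h14.trans (TensorProduct.smul_tmul' c x y).symm

end Scalar

theorem nonempty_iso_of_moritaEquivalent {G₁ G₂ : FinGraph.{u}} (R : Realization A G₁)
    (S : Realization B G₂) (h : MoritaEquivalent A B) : Nonempty (G₁.graph ≃g G₂.graph) := by
  obtain ⟨M, N, -, -, ⟨i, hi⟩, -⟩ := h
  have := (nontrivial_of_isRelTensor M N hi R.toEndIdentification).1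
  exact nonempty_iso_of_bimod M R S
    (eq_smul_one_of_isRelTensor M N hi R.toEndIdentification S.toEndIdentification)

end QAut

/-! ### Dagger bimodules from actions on elements -/

namespace QAut

open QuantumIso MonObj

variable {G : FinGraph.{u}} {A B : Mon (QAut G)}

theorem tensor_threefold_ext {E F K T : Type*} [AddCommGroup E] [Module ℂ E] [AddCommGroup F]
    [Module ℂ F] [AddCommGroup K] [Module ℂ K] [AddCommGroup T] [Module ℂ T]
    {f g : E ⊗[ℂ] (F ⊗[ℂ] K) →ₗ[ℂ] T}
    (h : ∀ x y z, f (x ⊗ₜ[ℂ] (y ⊗ₜ[ℂ] z)) = g (x ⊗ₜ[ℂ] (y ⊗ₜ[ℂ] z))) : f = g := by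
  refine TensorProduct.ext (LinearMap.ext fun x => TensorProduct.ext' fun y z => ?_)
  exact h x y z

theorem lin_one_act {X : QAut G} (l : A.X.H →ₗ[ℂ] Module.End ℂ X.H) (h : l (oneElem A) = 1)
    (c : ℂ) (m : X.H) : l (Hom.lin η[A.X] (c : ℂ)) m = c • m := by
  have h1 : Hom.lin η[A.X] (c : ℂ) = c • oneElem A := by
    refine Eq.trans ?_ ((Hom.lin η[A.X] : ℂ →ₗ[ℂ] A.X.H).map_smul c (1 : ℂ))
    exact congrArg (Hom.lin η[A.X] : ℂ →ₗ[ℂ] A.X.H) (_root_.mul_one c).symm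
  rw [h1, map_smul, h]
  rfl

/-- A bimodule from commuting actions on elements. -/
noncomputable def bimodOfAct (X : QAut G) (l : A.X.H →ₗ[ℂ] Module.End ℂ X.H)
    (r : B.X.H →ₗ[ℂ] Module.End ℂ X.H) (l_one : l (oneElem A) = 1)
    (l_mul : ∀ a b, l (mulElem A a b) = l a * l b) (r_one : r (oneElem B) = 1)
    (r_mul : ∀ a b, r (mulElem B a b) = r b * r a) (l_r : ∀ a b, r b * l a = l a * r b)
    (l_comm : ∀ v w a, X.P v w * l a = ∑ z, l (A.X.P z w a) * X.P v z)
    (r_comm : ∀ v w b, X.P v w * r b = ∑ z, r (B.X.P v z b) * X.P z w) : Bimod A B where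
  X := X
  actLeft :=
    { lin := (TensorProduct.lift l : A.X.H ⊗[ℂ] X.H →ₗ[ℂ] X.H)
      comm v w := by
        change X.P v w ∘ₗ (TensorProduct.lift l : A.X.H ⊗[ℂ] X.H →ₗ[ℂ] X.H) =
          TensorProduct.lift l ∘ₗ ∑ z, TensorProduct.map (A.X.P z w) (X.P v z)
        refine TensorProduct.ext' fun a m => ?_
        rw [LinearMap.comp_apply, LinearMap.comp_apply, LinearMap.sum_apply, map_sum]
        refine (LinearMap.congr_fun (l_comm v w a) m).trans ?_
        rw [LinearMap.sum_apply]
        rfl }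
  one_actLeft := hom_ext (TensorProduct.ext' (lin_one_act l l_one))
  left_assoc := hom_ext (TensorProduct.ext_threefold fun a b m =>
    LinearMap.congr_fun (l_mul a b) m)
  actRight :=
    { lin := (TensorProduct.lift r.flip : X.H ⊗[ℂ] B.X.H →ₗ[ℂ] X.H)
      comm v w := by
        change X.P v w ∘ₗ (TensorProduct.lift r.flip : X.H ⊗[ℂ] B.X.H →ₗ[ℂ] X.H) =
          TensorProduct.lift r.flip ∘ₗ ∑ z, TensorProduct.map (X.P z w) (B.X.P v z)
        refine TensorProduct.ext' fun m b => ?_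
        rw [LinearMap.comp_apply, LinearMap.comp_apply, LinearMap.sum_apply, map_sum]
        refine (LinearMap.congr_fun (r_comm v w b) m).trans ?_
        rw [LinearMap.sum_apply]
        rfl }
  actRight_one := hom_ext (TensorProduct.ext' fun m c => lin_one_act r r_one c m)
  right_assoc := hom_ext (tensor_threefold_ext fun m a b => LinearMap.congr_fun (r_mul a b) m)
  middle_assoc := hom_ext (TensorProduct.ext_threefold fun a m b =>
    LinearMap.congr_fun (l_r a b) m)

theorem EndIdentification.inner_oneElem_mulElem (e : EndIdentification A)
    (m : Matrix (Fin (Module.finrank ℂ e.K)) (Fin (Module.finrank ℂ e.K)) ℂ) (x : A.X.H) :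
    inner ℂ (oneElem A) (mulElem A (e.matElem m) x) = inner ℂ (e.matElem m.conjTranspose) x := by
  obtain ⟨x, rfl⟩ := e.matElem.surjective x
  rw [e.oneElem_matElem, e.mulElem_matElem, e.inner_matElem, e.inner_matElem]
  simp

theorem EndIdentification.inner_oneElem_mulElem' (e : EndIdentification A)
    (m : Matrix (Fin (Module.finrank ℂ e.K)) (Fin (Module.finrank ℂ e.K)) ℂ) (x : A.X.H) :
    inner ℂ (oneElem A) (mulElem A x (e.matElem m)) = inner ℂ (e.matElem m.conjTranspose) x := by
  obtain ⟨x, rfl⟩ := e.matElem.surjective x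
  rw [e.oneElem_matElem, e.mulElem_matElem, e.inner_matElem, e.inner_matElem,
    Matrix.conjTranspose_one, Matrix.one_mul, Matrix.conjTranspose_conjTranspose,
    Matrix.trace_mul_comm]

theorem lin_cap (a b : A.X.H) :
    Hom.lin (cap A) (a ⊗ₜ[ℂ] b : A.X.H ⊗[ℂ] A.X.H) = inner ℂ (oneElem A) (mulElem A a b) := by
  have h := LinearMap.adjoint_inner_right (Hom.lin η[A.X] : ℂ →ₗ[ℂ] A.X.H) (1 : ℂ) (mulElem A a b)
  have h1 : ∀ z : ℂ, inner ℂ (1 : ℂ) z = z := fun z => by simp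
  exact (h1 _).symm.trans h

/-- Pairing against the cap replaces an element by its conjugate transpose. Bending the wire of the
adjoint of an action therefore returns the adjoint of the operator by which the conjugate transpose
acts, and the dagger condition is that both actions respect adjoints. -/
theorem isDaggerBimod_of_adjoint (M : Bimod A B) (eA : EndIdentification A)
    (eB : EndIdentification B)
    (hl : ∀ m, LinearMap.adjoint (leftAct M (eA.matElem m)) =
      leftAct M (eA.matElem m.conjTranspose))
    (hr : ∀ m, LinearMap.adjoint (rightAct M (eB.matElem m)) =
      rightAct M (eB.matElem m.conjTranspose)) : IsDaggerBimod M where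
  left := by
    let mL : A.X.H ⊗[ℂ] M.X.H →ₗ[ℂ] M.X.H := Hom.lin M.actLeft
    let c : A.X.H ⊗[ℂ] A.X.H →ₗ[ℂ] ℂ := Hom.lin (cap A)
    refine hom_ext (TensorProduct.ext' fun a m => ?_)
    change TensorProduct.lid ℂ M.X.H (TensorProduct.map c LinearMap.id
      ((TensorProduct.assoc ℂ A.X.H A.X.H M.X.H).symm (a ⊗ₜ[ℂ] LinearMap.adjoint mL m))) =
      leftAct M a m
    obtain ⟨a, rfl⟩ := eA.matElem.surjective a
    have key : ∀ (t : A.X.H ⊗[ℂ] M.X.H) (m' : M.X.H),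
        inner ℂ m' (TensorProduct.lid ℂ M.X.H (TensorProduct.map c LinearMap.id
          ((TensorProduct.assoc ℂ A.X.H A.X.H M.X.H).symm (eA.matElem a ⊗ₜ[ℂ] t)))) =
        inner ℂ (eA.matElem a.conjTranspose ⊗ₜ[ℂ] m') t := by
      intro t m'
      induction t with
      | zero => simp
      | tmul x y =>
        rw [TensorProduct.assoc_symm_tmul, TensorProduct.map_tmul, TensorProduct.lid_tmul,
          inner_smul_right, TensorProduct.inner_tmul]
        congr 1
        exact (lin_cap _ _).trans (eA.inner_oneElem_mulElem _ _)
      | add s t hs ht =>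
        rw [TensorProduct.tmul_add, map_add, map_add, map_add, inner_add_right, hs, ht,
          inner_add_right]
    refine ext_inner_left ℂ fun m' => ?_
    rw [key, LinearMap.adjoint_inner_right]
    change inner ℂ (leftAct M (eA.matElem a.conjTranspose) m') m = _
    rw [← hl, LinearMap.adjoint_inner_left]
  right := by
    let mR : M.X.H ⊗[ℂ] B.X.H →ₗ[ℂ] M.X.H := Hom.lin M.actRight
    let c : B.X.H ⊗[ℂ] B.X.H →ₗ[ℂ] ℂ := Hom.lin (cap B)
    refine hom_ext (TensorProduct.ext' fun m a => ?_)
    change TensorProduct.rid ℂ M.X.H (TensorProduct.map LinearMap.id c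
      (TensorProduct.assoc ℂ M.X.H B.X.H B.X.H (LinearMap.adjoint mR m ⊗ₜ[ℂ] a))) =
      rightAct M a m
    obtain ⟨a, rfl⟩ := eB.matElem.surjective a
    have key : ∀ (t : M.X.H ⊗[ℂ] B.X.H) (m' : M.X.H),
        inner ℂ m' (TensorProduct.rid ℂ M.X.H (TensorProduct.map LinearMap.id c
          (TensorProduct.assoc ℂ M.X.H B.X.H B.X.H (t ⊗ₜ[ℂ] eB.matElem a)))) =
        inner ℂ (m' ⊗ₜ[ℂ] eB.matElem a.conjTranspose) t := by
      intro t m'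
      induction t with
      | zero => simp
      | tmul x y =>
        rw [TensorProduct.assoc_tmul, TensorProduct.map_tmul, TensorProduct.rid_tmul,
          inner_smul_right, TensorProduct.inner_tmul, mul_comm]
        congr 1
        exact (lin_cap _ _).trans (eB.inner_oneElem_mulElem' _ _)
      | add s t hs ht =>
        rw [TensorProduct.add_tmul, map_add, map_add, map_add, inner_add_right, hs, ht,
          inner_add_right]
    refine ext_inner_left ℂ fun m' => ?_
    rw [key, LinearMap.adjoint_inner_right]
    change inner ℂ (rightAct M (eB.matElem a.conjTranspose) m') m = _
    rw [← hr, LinearMap.adjoint_inner_left]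

end QAut

/-! ### Contraction and insertion of the two inner tensor factors -/

section Contraction

variable {K D L J : Type*} [AddCommGroup K] [Module ℂ K] [AddCommGroup D] [Module ℂ D]
  [AddCommGroup L] [Module ℂ L] [AddCommGroup J] [Module ℂ J]

variable (K J) in
/-- The contraction of the two inner factors of a fourfold tensor product. -/
noncomputable def contraction (ev : D →ₗ[ℂ] L →ₗ[ℂ] ℂ) :
    (K ⊗[ℂ] D) ⊗[ℂ] (L ⊗[ℂ] J) →ₗ[ℂ] K ⊗[ℂ] J :=
  TensorProduct.map LinearMap.id ((TensorProduct.lid ℂ J).toLinearMap ∘ₗ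
    TensorProduct.map (TensorProduct.lift ev) LinearMap.id ∘ₗ
      (TensorProduct.assoc ℂ D L J).symm.toLinearMap) ∘ₗ
    (TensorProduct.assoc ℂ K D (L ⊗[ℂ] J)).toLinearMap

theorem contraction_tmul (ev : D →ₗ[ℂ] L →ₗ[ℂ] ℂ) (k : K) (d : D) (l : L) (j : J) :
    contraction K J ev ((k ⊗ₜ[ℂ] d) ⊗ₜ[ℂ] (l ⊗ₜ[ℂ] j)) = ev d l • (k ⊗ₜ[ℂ] j) := by
  simp [contraction]

variable (K J) in
/-- The insertion of a vector between the factors of a tensor product. -/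
noncomputable def insertion {κ : Type*} [Fintype κ] (d : κ → D) (l : κ → L) :
    K ⊗[ℂ] J →ₗ[ℂ] (K ⊗[ℂ] D) ⊗[ℂ] (L ⊗[ℂ] J) :=
  ∑ i, TensorProduct.map ((TensorProduct.mk ℂ K D).flip (d i)) (TensorProduct.mk ℂ L J (l i))

theorem insertion_tmul {κ : Type*} [Fintype κ] (d : κ → D) (l : κ → L) (k : K) (j : J) :
    insertion K J d l (k ⊗ₜ[ℂ] j) = ∑ i, (k ⊗ₜ[ℂ] d i) ⊗ₜ[ℂ] (l i ⊗ₜ[ℂ] j) := by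
  simp [insertion, LinearMap.sum_apply]

theorem tensor_fourfold_ext {F : Type*} [AddCommGroup F] [Module ℂ F]
    {f g : (K ⊗[ℂ] D) ⊗[ℂ] (L ⊗[ℂ] J) →ₗ[ℂ] F}
    (h : ∀ k d l j, f ((k ⊗ₜ[ℂ] d) ⊗ₜ[ℂ] (l ⊗ₜ[ℂ] j)) = g ((k ⊗ₜ[ℂ] d) ⊗ₜ[ℂ] (l ⊗ₜ[ℂ] j))) :
    f = g := by
  refine TensorProduct.ext (TensorProduct.ext' fun k d => TensorProduct.ext' fun l j => ?_)
  exact h k d l j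

end Contraction

section InnerTensor

variable {K L : Type*} [NormedAddCommGroup K] [InnerProductSpace ℂ K] [NormedAddCommGroup L]
  [InnerProductSpace ℂ L]

theorem inner_tensor_add_left (x a b : K ⊗[ℂ] L) :
    inner ℂ (a + b) x = inner ℂ a x + inner ℂ b x := inner_add_left _ _ _

theorem inner_tensor_zero_left (x : K ⊗[ℂ] L) : inner ℂ 0 x = (0 : ℂ) := inner_zero_left _

theorem inner_tensor_zero_right (x : K ⊗[ℂ] L) : inner ℂ x 0 = (0 : ℂ) := inner_zero_right _

end InnerTensor

/-- The hypothesis says that `ev` is the inner product with the vector ∑ d_i ⊗ l_i, and inserting a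
vector is adjoint to pairing with it. -/
theorem contraction_eq_adjoint {K D L J κ : Type*} [NormedAddCommGroup K] [InnerProductSpace ℂ K]
    [NormedAddCommGroup D] [InnerProductSpace ℂ D] [NormedAddCommGroup L] [InnerProductSpace ℂ L]
    [NormedAddCommGroup J] [InnerProductSpace ℂ J] [FiniteDimensional ℂ K] [FiniteDimensional ℂ D]
    [FiniteDimensional ℂ L] [FiniteDimensional ℂ J] [Fintype κ] (ev : D →ₗ[ℂ] L →ₗ[ℂ] ℂ)
    (d : κ → D) (l : κ → L) (h : ∀ x y, ev x y = ∑ i, inner ℂ (d i) x * inner ℂ (l i) y) :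
    insertion K J d l = LinearMap.adjoint (𝕜 := ℂ)
      (E := (K ⊗[ℂ] D) ⊗[ℂ] (L ⊗[ℂ] J)) (F := K ⊗[ℂ] J) (contraction K J ev) := by
  have key : ∀ k d' l' j k' j', inner ℂ (insertion K J d l (k' ⊗ₜ[ℂ] j'))
      ((k ⊗ₜ[ℂ] d') ⊗ₜ[ℂ] (l' ⊗ₜ[ℂ] j)) = inner ℂ (k' ⊗ₜ[ℂ] j')
      (contraction K J ev ((k ⊗ₜ[ℂ] d') ⊗ₜ[ℂ] (l' ⊗ₜ[ℂ] j))) := by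
    intro k d' l' j k' j'
    rw [insertion_tmul, contraction_tmul, inner_tensor_smul_right, h, inner_tensor_sum_left,
      Finset.sum_mul]
    refine Finset.sum_congr rfl fun i _ => ?_
    simp only [TensorProduct.inner_tmul]
    ring
  refine (LinearMap.eq_adjoint_iff (𝕜 := ℂ) (E := K ⊗[ℂ] J)
    (F := (K ⊗[ℂ] D) ⊗[ℂ] (L ⊗[ℂ] J)) _ _).mpr fun s t => ?_
  induction s with
  | zero => simp only [map_zero, inner_tensor_zero_left]
  | add a b ha hb => rw [map_add, inner_tensor_add_left, inner_tensor_add_left, ha, hb]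
  | tmul k' j' =>
    induction t with
    | zero => simp only [map_zero, inner_tensor_zero_right]
    | add a b ha hb => rw [map_add, inner_tensor_add_right, inner_tensor_add_right, ha, hb]
    | tmul x y =>
      induction x with
      | zero => simp only [map_zero, TensorProduct.zero_tmul, inner_tensor_zero_right]
      | add a b ha hb => rw [TensorProduct.add_tmul, map_add, inner_tensor_add_right, inner_tensor_add_right,
          ha, hb]
      | tmul k d' =>
        induction y with
        | zero => simp only [map_zero, TensorProduct.tmul_zero, inner_tensor_zero_right]
        | add a b ha hb => rw [TensorProduct.tmul_add, map_add, inner_tensor_add_right, inner_tensor_add_right,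
ha, hb]
        | tmul l' j => exact key k d' l' j k' j'

/-! ### The bimodule joining two realizations from one graph -/

namespace QAut

open QuantumIso

variable {G G' : FinGraph.{u}} {A B : Mon (QAut G)}

/-- Operators on the first factor of a tensor product. -/
noncomputable def onLeft (K L : Type*) [AddCommGroup K] [Module ℂ K] [AddCommGroup L] [Module ℂ L] :
    Module.End ℂ K →ₗ[ℂ] Module.End ℂ (K ⊗[ℂ] L) :=
  (TensorProduct.mapBilinear (.id ℂ) K L K L).flip LinearMap.id

/-- Operators on the second factor of a tensor product. -/
noncomputable def onRight (K L : Type*) [AddCommGroup K] [Module ℂ K] [AddCommGroup L] [Module ℂ L] :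
    Module.End ℂ L →ₗ[ℂ] Module.End ℂ (K ⊗[ℂ] L) :=
  TensorProduct.mapBilinear (.id ℂ) K L K L LinearMap.id

/-- The transpose, as a linear map. -/
noncomputable def dualTransposeLin (H : Type*) [NormedAddCommGroup H] [InnerProductSpace ℂ H]
    [FiniteDimensional ℂ H] : Module.End ℂ H →ₗ[ℂ] Module.End ℂ (StrongDual ℂ H) where
  toFun := dualTranspose
  map_add' S T := by ext f x; exact map_add f (S x) (T x)
  map_smul' := dualTranspose_smul

section OnTensor

variable {K L : Type*} [AddCommGroup K] [Module ℂ K] [AddCommGroup L] [Module ℂ L]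

theorem onLeft_tmul (a : Module.End ℂ K) (x : K) (y : L) :
    onLeft K L a (x ⊗ₜ[ℂ] y) = a x ⊗ₜ[ℂ] y := rfl

theorem onRight_tmul (a : Module.End ℂ L) (x : K) (y : L) :
    onRight K L a (x ⊗ₜ[ℂ] y) = x ⊗ₜ[ℂ] a y := rfl

end OnTensor

section LinkComm

variable {V W K D : Type*} [Fintype V] [Fintype W] [AddCommGroup K] [Module ℂ K]
  [AddCommGroup D] [Module ℂ D] [DecidableEq W]

/-- Equivariance of the left action on K ⊗ D. The orthogonality P_{x,z} P_{y,z} = δ_{x,y} P_{x,z}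
collapses the product of two sums over W to its diagonal, and then ∑_z P_{x,z} = 1 removes the
intermediate vertex z. -/
theorem link_comm_left (P : W → V → Module.End ℂ K) (T : W → V → Module.End ℂ D)
    (hsum : ∀ x, ∑ v, P x v = 1)
    (horth : ∀ x y v, P x v * P y v = if x = y then P x v else 0) (v w : V) (a : Module.End ℂ K) :
    ((∑ x, TensorProduct.map (P x w) (T x v) : Module.End ℂ (K ⊗[ℂ] D)) * onLeft K D a) =
      ∑ z, onLeft K D (∑ x, P x w * a * P x z) *
        (∑ x, TensorProduct.map (P x z) (T x v) : Module.End ℂ (K ⊗[ℂ] D)) := by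
  have h : ∀ z, onLeft K D (∑ x, P x w * a * P x z) *
        (∑ x, TensorProduct.map (P x z) (T x v) : Module.End ℂ (K ⊗[ℂ] D)) =
      ∑ x, TensorProduct.map (P x w * a * P x z) (T x v) := by
    intro z
    rw [map_sum, Finset.sum_mul_sum]
    refine Finset.sum_congr rfl fun x _ => ?_
    rw [Finset.sum_eq_single x]
    · refine (TensorProduct.map_mul _ _ _ _).symm.trans ?_
      rw [mul_assoc, horth, if_pos rfl]
      rfl
    · intro y _ hy
      refine (TensorProduct.map_mul _ _ _ _).symm.trans ?_
      rw [mul_assoc, horth, if_neg hy.symm, mul_zero, TensorProduct.map_zero_left]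
    · simp
  simp only [h]
  rw [Finset.sum_comm, Finset.sum_mul]
  refine Finset.sum_congr rfl fun x _ => ?_
  rw [← map_sum_left, ← Finset.mul_sum, hsum, mul_one]
  exact (TensorProduct.map_mul _ _ _ _).symm

theorem link_comm_right (P : W → V → Module.End ℂ K) (T : W → V → Module.End ℂ D)
    (hsum : ∀ x, ∑ v, T x v = 1)
    (horth : ∀ x y v, T x v * T y v = if x = y then T x v else 0) (v w : V) (b : Module.End ℂ D) :
    ((∑ x, TensorProduct.map (P x w) (T x v) : Module.End ℂ (K ⊗[ℂ] D)) * onRight K D b) =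
      ∑ z, onRight K D (∑ x, T x v * b * T x z) *
        (∑ x, TensorProduct.map (P x w) (T x z) : Module.End ℂ (K ⊗[ℂ] D)) := by
  have h : ∀ z, onRight K D (∑ x, T x v * b * T x z) *
        (∑ x, TensorProduct.map (P x w) (T x z) : Module.End ℂ (K ⊗[ℂ] D)) =
      ∑ x, TensorProduct.map (P x w) (T x v * b * T x z) := by
    intro z
    rw [map_sum, Finset.sum_mul_sum]
    refine Finset.sum_congr rfl fun x _ => ?_
    rw [Finset.sum_eq_single x]
    · refine (TensorProduct.map_mul _ _ _ _).symm.trans ?_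
      rw [mul_assoc, horth, if_pos rfl]
      rfl
    · intro y _ hy
      refine (TensorProduct.map_mul _ _ _ _).symm.trans ?_
      rw [mul_assoc, horth, if_neg hy.symm, mul_zero, TensorProduct.map_zero_right]
    · simp
  simp only [h]
  rw [Finset.sum_comm, Finset.sum_mul]
  refine Finset.sum_congr rfl fun x _ => ?_
  rw [← map_sum_right, ← Finset.mul_sum, hsum, mul_one]
  exact (TensorProduct.map_mul _ _ _ _).symm

end LinkComm

variable (R : Realization A G') (S : Realization B G')

/-- The bimodule between two monoids that are realized by quantum isomorphisms from the same
graph. -/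
noncomputable def linkBimod : Bimod A B :=
  bimodOfAct (QuantumIso.comp S.toQuantumIso.dual R.toQuantumIso)
    (onLeft R.K (StrongDual ℂ S.K) ∘ₗ R.elem.symm.toLinearMap)
    (onRight R.K (StrongDual ℂ S.K) ∘ₗ dualTransposeLin S.K ∘ₗ S.elem.symm.toLinearMap)
    (by
      refine TensorProduct.ext' fun x y => ?_
      rw [R.oneElem_eq]
      change R.elem.symm (R.elem 1) x ⊗ₜ[ℂ] y = _
      rw [LinearEquiv.symm_apply_apply]
      rfl)
    (fun a b => by
      obtain ⟨a, rfl⟩ := R.elem.surjective a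
      obtain ⟨b, rfl⟩ := R.elem.surjective b
      rw [R.mulElem_elem]
      refine TensorProduct.ext' fun x y => ?_
      change R.elem.symm (R.elem (a * b)) x ⊗ₜ[ℂ] y =
        R.elem.symm (R.elem a) (R.elem.symm (R.elem b) x) ⊗ₜ[ℂ] y
      simp only [LinearEquiv.symm_apply_apply]
      rfl)
    (by
      refine TensorProduct.ext' fun x y => ?_
      rw [S.oneElem_eq]
      change x ⊗ₜ[ℂ] dualTranspose (S.elem.symm (S.elem 1)) y = _
      rw [LinearEquiv.symm_apply_apply, dualTranspose_one]
      rfl)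
    (fun a b => by
      obtain ⟨a, rfl⟩ := S.elem.surjective a
      obtain ⟨b, rfl⟩ := S.elem.surjective b
      rw [S.mulElem_elem]
      refine TensorProduct.ext' fun x y => ?_
      change x ⊗ₜ[ℂ] dualTranspose (S.elem.symm (S.elem (a * b))) y =
        x ⊗ₜ[ℂ] dualTranspose (S.elem.symm (S.elem b))
          (dualTranspose (S.elem.symm (S.elem a)) y)
      simp only [LinearEquiv.symm_apply_apply, dualTranspose_mul]
      rfl)
    (fun a b => TensorProduct.ext' fun x y => rfl)
    (fun v w a => by
      classical
      obtain ⟨a, rfl⟩ := R.elem.surjective a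
      have h : ∀ z, R.elem.symm (A.X.P z w (R.elem a)) = ∑ x, R.P x w * a * R.P x z := by
        intro z
        rw [R.component_elem, LinearEquiv.symm_apply_apply]
      have key := link_comm_left R.P (fun x v => S.toQuantumIso.dual.P v x) R.row_sum
        R.col_orthogonal v w a
      refine Eq.trans ?_ (key.trans ?_)
      · change _ * onLeft R.K (StrongDual ℂ S.K) (R.elem.symm (R.elem a)) = _
        rw [LinearEquiv.symm_apply_apply]
        rfl
      · simp only [← h]
        rfl)
    (fun v w b => by
      classical
      let T : G'.V → G.V → Module.End ℂ (StrongDual ℂ S.K) :=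
        fun x v => S.toQuantumIso.dual.P v x
      obtain ⟨b, rfl⟩ := S.elem.surjective b
      have h : ∀ z, S.elem.symm (B.X.P v z (S.elem b)) = ∑ x, S.P x z * b * S.P x v := by
        intro z
        rw [S.component_elem, LinearEquiv.symm_apply_apply]
      have h' : ∀ z, dualTranspose (S.elem.symm (B.X.P v z (S.elem b))) =
          ∑ x, T x v * dualTranspose b * T x z := by
        intro z
        rw [h, dualTranspose_sum]
        refine Finset.sum_congr rfl fun x _ => ?_
        rw [dualTranspose_mul, dualTranspose_mul, ← mul_assoc]
        change _ = dualTranspose (LinearMap.adjoint (S.P x v)) * dualTranspose b *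
          dualTranspose (LinearMap.adjoint (S.P x z))
        rw [S.selfAdjoint, S.selfAdjoint]
      have key := link_comm_right R.P T
        S.toQuantumIso.dual.col_sum (fun x y v => S.toQuantumIso.dual.row_orthogonal v x y) v w
        (dualTranspose b)
      refine Eq.trans ?_ (key.trans ?_)
      · change _ * onRight R.K (StrongDual ℂ S.K) (dualTranspose (S.elem.symm (S.elem b))) = _
        rw [LinearEquiv.symm_apply_apply]
        rfl
      · simp only [← h']
        rfl)

theorem leftAct_linkBimod (a : Module.End ℂ R.K) :
    leftAct (linkBimod R S) (R.elem a) = onLeft R.K (StrongDual ℂ S.K) a := by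
  refine TensorProduct.ext' fun x y => ?_
  change R.elem.symm (R.elem a) x ⊗ₜ[ℂ] y = _
  rw [LinearEquiv.symm_apply_apply]
  rfl

theorem rightAct_linkBimod (b : Module.End ℂ S.K) :
    rightAct (linkBimod R S) (S.elem b) = onRight R.K (StrongDual ℂ S.K) (dualTranspose b) := by
  refine TensorProduct.ext' fun x y => ?_
  change x ⊗ₜ[ℂ] dualTranspose (S.elem.symm (S.elem b)) y = _
  rw [LinearEquiv.symm_apply_apply]
  rfl

theorem isDaggerBimod_linkBimod : IsDaggerBimod (linkBimod R S) := by
  refine isDaggerBimod_of_adjoint _ R.toEndIdentification S.toEndIdentification (fun m => ?_)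
    fun m => ?_
  · change LinearMap.adjoint (leftAct _ (R.elem _)) = leftAct _ (R.elem _)
    rw [leftAct_linkBimod, leftAct_linkBimod]
    exact (TensorProduct.adjoint_map (𝕜 := ℂ) _ (LinearMap.id : StrongDual ℂ S.K →ₗ[ℂ] _)).trans
      (congrArg₂ TensorProduct.map (Matrix.toLin_conjTranspose (stdOrthonormalBasis ℂ R.K)
        (stdOrthonormalBasis ℂ R.K) m).symm LinearMap.adjoint_id)
  · change LinearMap.adjoint (rightAct _ (S.elem _)) = rightAct _ (S.elem _)
    rw [rightAct_linkBimod, rightAct_linkBimod]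
    exact (TensorProduct.adjoint_map (𝕜 := ℂ) (LinearMap.id : R.K →ₗ[ℂ] _) _).trans
      (congrArg₂ TensorProduct.map LinearMap.adjoint_id ((dualTranspose_adjoint _).trans
        (congrArg dualTranspose (Matrix.toLin_conjTranspose (stdOrthonormalBasis ℂ S.K)
          (stdOrthonormalBasis ℂ S.K) m).symm)))

end QAut

section Contraction

variable {K D L J : Type*} [AddCommGroup K] [Module ℂ K] [AddCommGroup D] [Module ℂ D]
  [AddCommGroup L] [Module ℂ L] [AddCommGroup J] [Module ℂ J]

/-- Composing the components on the two factors sums over an intermediate vertex z; by hypothesis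
the pairing then retains only x = y. For dual families of projectors this is column orthogonality
followed by row completeness. -/
theorem contraction_comm {V W : Type*} [Fintype V] [Fintype W] [DecidableEq W]
    (ev : D →ₗ[ℂ] L →ₗ[ℂ] ℂ) (P : W → Module.End ℂ K) (T : W → V → Module.End ℂ D)
    (Q : W → V → Module.End ℂ L) (U : W → Module.End ℂ J)
    (h : ∀ x y d l, ∑ z, ev (T x z d) (Q y z l) = if x = y then ev d l else 0)
    (t : (K ⊗[ℂ] D) ⊗[ℂ] (L ⊗[ℂ] J)) :
    (∑ x, TensorProduct.map (P x) (U x)) (contraction K J ev t) =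
      contraction K J ev ((∑ z, TensorProduct.map (∑ x, TensorProduct.map (P x) (T x z))
        (∑ y, TensorProduct.map (Q y z) (U y))) t) := by
  refine LinearMap.congr_fun (f := (∑ x, TensorProduct.map (P x) (U x)) ∘ₗ contraction K J ev)
    (g := contraction K J ev ∘ₗ (∑ z, TensorProduct.map (∑ x, TensorProduct.map (P x) (T x z))
      (∑ y, TensorProduct.map (Q y z) (U y)))) (tensor_fourfold_ext fun k d l j => ?_) t
  rw [LinearMap.comp_apply, LinearMap.comp_apply, contraction_tmul, map_smul, LinearMap.sum_apply,
    LinearMap.sum_apply, map_sum]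
  simp only [TensorProduct.map_tmul, LinearMap.sum_apply, TensorProduct.sum_tmul,
    TensorProduct.tmul_sum, map_sum, contraction_tmul]
  rw [Finset.smul_sum, Finset.sum_comm]
  have h1 : ∀ y, ∑ z, ∑ x, ev (T x z d) (Q y z l) • (P x k ⊗ₜ[ℂ] U y j) =
      ev d l • (P y k ⊗ₜ[ℂ] U y j) := by
    intro y
    rw [Finset.sum_comm]
    simp only [← Finset.sum_smul, h, ite_smul, zero_smul, Finset.sum_ite_eq', Finset.mem_univ,
      if_true]
  exact Finset.sum_congr rfl fun y _ => (h1 y).symm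

theorem contraction_insertion {κ : Type*} [Fintype κ] (ev : D →ₗ[ℂ] L →ₗ[ℂ] ℂ) (d : κ → D)
    (l : κ → L) (t : K ⊗[ℂ] J) :
    contraction K J ev (insertion K J d l t) = (∑ i, ev (d i) (l i)) • t := by
  induction t with
  | zero => simp
  | add s t hs ht => rw [map_add, map_add, hs, ht, smul_add]
  | tmul k j => simp only [insertion_tmul, map_sum, contraction_tmul, Finset.sum_smul]

theorem insertion_onLeft {κ : Type*} [Fintype κ] (d : κ → D) (l : κ → L) (a : Module.End ℂ K)
    (t : K ⊗[ℂ] J) :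
    TensorProduct.map (QAut.onLeft K D a) LinearMap.id (insertion K J d l t) =
      insertion K J d l (QAut.onLeft K J a t) := by
  induction t with
  | zero => simp only [map_zero]
  | add s t hs ht => simp only [map_add, hs, ht]
  | tmul k j =>
    simp only [QAut.onLeft_tmul, insertion_tmul, map_sum, TensorProduct.map_tmul,
      LinearMap.id_apply]

theorem insertion_onRight {κ : Type*} [Fintype κ] (d : κ → D) (l : κ → L) (a : Module.End ℂ J)
    (t : K ⊗[ℂ] J) :
    TensorProduct.map LinearMap.id (QAut.onRight L J a) (insertion K J d l t) =
      insertion K J d l (QAut.onRight K J a t) := by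
  induction t with
  | zero => simp only [map_zero]
  | add s t hs ht => simp only [map_add, hs, ht]
  | tmul k j =>
    simp only [QAut.onRight_tmul, insertion_tmul, map_sum, TensorProduct.map_tmul,
      LinearMap.id_apply]

/-- Contracting and then inserting is a sum of rank-one operators on the two inner factors, namely
matrix units E_ij paired with E_ji, as in the formula for the relative idempotent. The resolution of
the identity `hφ` reconstructs the contracted scalar. -/
theorem insertion_contraction {κ : Type*} [Fintype κ] (ev : D →ₗ[ℂ] L →ₗ[ℂ] ℂ) (d : κ → D)
    (l : κ → L) (E : κ → κ → Module.End ℂ D) (F : κ → κ → Module.End ℂ L) (φ : κ → L →ₗ[ℂ] ℂ)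
    (hE : ∀ i j f, E i j f = ev f (l i) • d j) (hF : ∀ i j x, F j i x = φ i x • l j)
    (hφ : ∀ x, ∑ i, φ i x • l i = x) :
    insertion K J d l ∘ₗ contraction K J ev = ∑ i, ∑ j,
      TensorProduct.map (QAut.onRight K D (E i j)) (QAut.onLeft L J (F j i)) := by
  refine tensor_fourfold_ext fun k f x g => ?_
  simp only [LinearMap.comp_apply, contraction_tmul, map_smul, insertion_tmul, LinearMap.sum_apply,
    TensorProduct.map_tmul, QAut.onLeft_tmul, QAut.onRight_tmul, hE, hF]
  rw [Finset.sum_comm, Finset.smul_sum]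
  refine Finset.sum_congr rfl fun j _ => ?_
  simp only [TensorProduct.tmul_smul, ← TensorProduct.smul_tmul', smul_smul]
  rw [← Finset.sum_smul]
  congr 1
  have h := congrArg (ev f) (hφ x)
  rw [map_sum] at h
  simp only [map_smul, smul_eq_mul] at h
  exact h.symm.trans (Finset.sum_congr rfl fun i _ => by ring)

end Contraction

theorem adjoint_contraction_apply {K D L J E κ : Type*} [NormedAddCommGroup K]
    [InnerProductSpace ℂ K] [NormedAddCommGroup D] [InnerProductSpace ℂ D] [NormedAddCommGroup L]
    [InnerProductSpace ℂ L] [NormedAddCommGroup J] [InnerProductSpace ℂ J] [NormedAddCommGroup E]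
    [InnerProductSpace ℂ E] [FiniteDimensional ℂ K] [FiniteDimensional ℂ D]
    [FiniteDimensional ℂ L] [FiniteDimensional ℂ J] [FiniteDimensional ℂ E] [Fintype κ]
    (ev : D →ₗ[ℂ] L →ₗ[ℂ] ℂ) (d : κ → D) (l : κ → L)
    (h : ∀ x y, ev x y = ∑ i, inner ℂ (d i) x * inner ℂ (l i) y) (U : E ≃ₗᵢ[ℂ] K ⊗[ℂ] J) (c : ℂ)
    (hc : star c = c) (q : E) :
    LinearMap.adjoint (𝕜 := ℂ) (E := (K ⊗[ℂ] D) ⊗[ℂ] (L ⊗[ℂ] J)) (F := E)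
      (U.symm.toLinearEquiv.toLinearMap ∘ₗ (c • contraction K J ev)) q =
        c • insertion K J d l (U q) := by
  refine (LinearMap.congr_fun ((LinearMap.eq_adjoint_iff (𝕜 := ℂ) (E := E)
    (F := (K ⊗[ℂ] D) ⊗[ℂ] (L ⊗[ℂ] J)) (c • insertion K J d l ∘ₗ U.toLinearEquiv.toLinearMap)
      _).mpr fun s t => ?_) q).symm
  change inner ℂ (c • insertion K J d l (U s)) t = inner ℂ s (U.symm (c • contraction K J ev t))
  rw [inner_tensor_smul_left, hc, ← inner_equiv_tensor U, LinearIsometryEquiv.apply_symm_apply,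
    inner_tensor_smul_right, contraction_eq_adjoint ev d l h]
  exact congrArg _ (LinearMap.adjoint_inner_left (𝕜 := ℂ) (E := (K ⊗[ℂ] D) ⊗[ℂ] (L ⊗[ℂ] J))
    (F := K ⊗[ℂ] J) _ _ _)

/-! ### The relative tensor product of the joining bimodules -/

namespace QAut

open QuantumIso

variable {G G' : FinGraph.{u}} {A B : Mon (QAut G)}

theorem EndIdentification.equiv_symm_eq (e : EndIdentification A)
    (s : e.K ⊗[ℂ] StrongDual ℂ e.K) :
    e.equiv.symm s = ((√(Module.finrank ℂ e.K) : ℝ) : ℂ)⁻¹ • e.elem (tensorDualEquivEnd e.K s) := by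
  rw [e.elem_apply, LinearEquiv.symm_apply_apply, inv_smul_smul₀ (sqrt_finrank_ne_zero e.K)]

theorem EndIdentification.mulElem_equiv_symm_left (e : EndIdentification A) (a : Module.End ℂ e.K)
    (s : e.K ⊗[ℂ] StrongDual ℂ e.K) :
    mulElem A (e.elem a) (e.equiv.symm s) =
      e.equiv.symm (onLeft e.K (StrongDual ℂ e.K) a s) := by
  have h : tensorDualEquivEnd e.K (onLeft e.K (StrongDual ℂ e.K) a s) =
      a * tensorDualEquivEnd e.K s := by
    have := tensorDualEquivEnd_map a 1 s
    rw [dualTranspose_one, mul_one] at this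
    exact this
  rw [equiv_symm_eq, equiv_symm_eq, h, ← e.mulElem_elem]
  exact map_smul (mulLin A ∘ₗ TensorProduct.mk ℂ _ _ (e.elem a)) _ _

theorem EndIdentification.mulElem_equiv_symm_right (e : EndIdentification A)
    (a : Module.End ℂ e.K) (s : e.K ⊗[ℂ] StrongDual ℂ e.K) :
    mulElem A (e.equiv.symm s) (e.elem a) =
      e.equiv.symm (onRight e.K (StrongDual ℂ e.K) (dualTranspose a) s) := by
  have h : tensorDualEquivEnd e.K (onRight e.K (StrongDual ℂ e.K) (dualTranspose a) s) =
      tensorDualEquivEnd e.K s * a := by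
    have := tensorDualEquivEnd_map 1 a s
    rw [one_mul] at this
    exact this
  rw [equiv_symm_eq, equiv_symm_eq, h, ← e.mulElem_elem]
  exact map_smul (mulLin A ∘ₗ (TensorProduct.mk ℂ _ _).flip (e.elem a)) _ _

theorem Realization.component_equiv_symm (R : Realization A G') (v w : G.V)
    (s : R.K ⊗[ℂ] StrongDual ℂ R.K) :
    A.X.P v w (R.equiv.symm s) =
      R.equiv.symm ((∑ x, TensorProduct.map (R.P x w) (dualTranspose (R.P x v))) s) := by
  have h : tensorDualEquivEnd R.K
      ((∑ x, TensorProduct.map (R.P x w) (dualTranspose (R.P x v))) s) =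
      ∑ x, R.P x w * tensorDualEquivEnd R.K s * R.P x v := by
    rw [LinearMap.sum_apply, map_sum]
    exact Finset.sum_congr rfl fun x _ => tensorDualEquivEnd_map _ _ _
  rw [R.equiv_symm_eq, R.equiv_symm_eq, h, map_smul, R.component_elem]

/-- The evaluation pairing between a Hilbert space and its dual. -/
noncomputable def evalPairing (L : Type*) [NormedAddCommGroup L] [InnerProductSpace ℂ L] :
    StrongDual ℂ L →ₗ[ℂ] L →ₗ[ℂ] ℂ :=
  ContinuousLinearMap.coeLM ℂ

theorem evalPairing_apply {L : Type*} [NormedAddCommGroup L] [InnerProductSpace ℂ L]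
    (f : StrongDual ℂ L) (x : L) : evalPairing L f x = f x := rfl

variable (R : Realization A G') (S : Realization B G')

/-- The contraction of the product of two link bimodules, normalised to be a coisometry. -/
noncomputable def linkLin :
    (R.K ⊗[ℂ] StrongDual ℂ S.K) ⊗[ℂ] (S.K ⊗[ℂ] StrongDual ℂ R.K) →ₗ[ℂ] A.X.H :=
  R.equiv.symm.toLinearEquiv.toLinearMap ∘ₗ (((√(Module.finrank ℂ S.K) : ℝ) : ℂ)⁻¹ •
    contraction R.K (StrongDual ℂ R.K) (evalPairing S.K))

/-- The contraction of the product of two link bimodules, as an intertwiner. -/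
noncomputable def linkHom :
    (linkBimod R S).X ⊗ (linkBimod S R).X ⟶ (Bimod.regular A).X where
  lin := linkLin R S
  comm v w := by
    classical
    have h := contraction_comm (evalPairing S.K) (fun x => R.P x w)
      (fun x z => dualTranspose (LinearMap.adjoint (S.P x z))) S.P
      (fun x => dualTranspose (LinearMap.adjoint (R.P x v))) (by
        intro x y f l
        have : ∀ z, evalPairing S.K (dualTranspose (LinearMap.adjoint (S.P x z)) f) (S.P y z l) =
            f ((if x = y then S.P x z else 0) l) := by
          intro z
          rw [← S.col_orthogonal, S.selfAdjoint]
          rfl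
        simp only [this]
        split_ifs
        · rw [← map_sum, ← LinearMap.sum_apply, S.row_sum]
          rfl
        · simp)
    refine LinearMap.ext fun t => ?_
    have h1 : A.X.P v w (linkLin R S t) = _ := R.component_equiv_symm v w _
    refine h1.trans (congrArg R.equiv.symm ?_)
    refine Eq.trans ?_ (congrArg (((√(Module.finrank ℂ S.K) : ℝ) : ℂ)⁻¹ • ·) (h t))
    simp only [R.selfAdjoint]
    exact LinearMap.map_smul (∑ x, TensorProduct.map (R.P x w) (dualTranspose (R.P x v))) _ _

theorem linkHom_dagger_apply (q : A.X.H) :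
    Hom.lin (dagger (linkHom R S)) q = ((√(Module.finrank ℂ S.K) : ℝ) : ℂ)⁻¹ •
      insertion R.K (StrongDual ℂ R.K)
        (fun i => InnerProductSpace.toDual ℂ S.K (stdOrthonormalBasis ℂ S.K i))
        (stdOrthonormalBasis ℂ S.K) (R.equiv q) := by
  refine adjoint_contraction_apply (evalPairing S.K) _ _ (fun f x => ?_) R.equiv _ ?_ q
  · simp only [inner_toDual_left]
    conv_lhs => rw [← (stdOrthonormalBasis ℂ S.K).sum_repr' x]
    rw [map_sum]
    refine Finset.sum_congr rfl fun i _ => ?_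
    rw [map_smul, smul_eq_mul, mul_comm]
    rfl
  · rw [star_inv₀, RCLike.star_def, Complex.conj_ofReal]

theorem inv_sqrt_mul_inv_sqrt (n : ℕ) :
    (((√n : ℝ) : ℂ)⁻¹ * ((√n : ℝ) : ℂ)⁻¹) = (n : ℂ)⁻¹ := by
  rw [← mul_inv, ← Complex.ofReal_mul, Real.mul_self_sqrt (Nat.cast_nonneg _),
    Complex.ofReal_natCast]

/-- Contracting the inserted vector ∑ b_i* ⊗ b_i gives dim S.K, which the two factors (dim
S.K)^{-1/2} cancel. -/
theorem linkLin_insertion (s : R.K ⊗[ℂ] StrongDual ℂ R.K) :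
    linkLin R S (((√(Module.finrank ℂ S.K) : ℝ) : ℂ)⁻¹ • insertion R.K (StrongDual ℂ R.K)
        (fun i => InnerProductSpace.toDual ℂ S.K (stdOrthonormalBasis ℂ S.K i))
        (stdOrthonormalBasis ℂ S.K) s) = R.equiv.symm s := by
  have h : ∑ i, evalPairing S.K (InnerProductSpace.toDual ℂ S.K (stdOrthonormalBasis ℂ S.K i))
      (stdOrthonormalBasis ℂ S.K i) = (Module.finrank ℂ S.K : ℂ) := by
    simp only [evalPairing_apply, InnerProductSpace.toDual_apply_apply,
      orthonormal_iff_ite.mp (stdOrthonormalBasis ℂ S.K).orthonormal, if_true]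
    simp
  change R.equiv.symm (((√(Module.finrank ℂ S.K) : ℝ) : ℂ)⁻¹ •
    contraction R.K (StrongDual ℂ R.K) (evalPairing S.K) _) = _
  rw [LinearMap.map_smul (contraction R.K (StrongDual ℂ R.K) (evalPairing S.K)), contraction_insertion, h, smul_smul, smul_smul,
    inv_sqrt_mul_inv_sqrt, inv_mul_cancel₀ S.finrank_ne_zero, one_smul]

theorem dagger_dagger_linkHom : dagger (dagger (linkHom R S)) = linkHom R S := dagger_dagger _

theorem toLin_single_apply {H ι : Type*} [NormedAddCommGroup H] [InnerProductSpace ℂ H]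
    [FiniteDimensional ℂ H] [Fintype ι] [DecidableEq ι] (b : OrthonormalBasis ι ℂ H) (i j : ι)
    (x : H) : Matrix.toLin b.toBasis b.toBasis (Matrix.single i j 1) x = inner ℂ (b j) x • b i := by
  have h := LinearMap.congr_fun (tensorDualEquivEnd_ketBra b i j) x
  rw [tensorDualEquivEnd_tmul] at h
  exact h.symm

/-- The adjoint of the normalised contraction inserts the unit vector (dim S.K)^{-1/2} ∑ b_i* ⊗ b_i,
hence is an isometry. Its range projection is (dim S.K)⁻¹ ∑ E_ij ⊗ E_ji on the inner factors, which
is the relative idempotent. The outer actions do not touch the inner factors and become left and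
right multiplication. -/
theorem isRelTensor_linkBimod :
    IsRelTensor (linkBimod R S) (linkBimod S R) (Bimod.regular A) (dagger (linkHom R S)) where
  isometry := by
    rw [dagger_dagger_linkHom]
    refine hom_ext (LinearMap.ext fun q => ?_)
    refine (congrArg (linkLin R S) (linkHom_dagger_apply R S q)).trans ?_
    rw [linkLin_insertion]
    exact R.equiv.symm_apply_apply q
  splits := by
    rw [dagger_dagger_linkHom]
    refine hom_ext ?_
    let b := stdOrthonormalBasis ℂ S.K
    have h1 := insertion_contraction (K := R.K) (J := StrongDual ℂ R.K) (evalPairing S.K)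
      (fun i => InnerProductSpace.toDual ℂ S.K (b i)) b
      (fun i j => dualTranspose (Matrix.toLin b.toBasis b.toBasis (Matrix.single i j 1)))
      (fun i j => Matrix.toLin b.toBasis b.toBasis (Matrix.single i j 1))
      (fun i => (InnerProductSpace.toDual ℂ S.K (b i)).toLinearMap) (by
        intro i j f
        ext x
        change f (Matrix.toLin b.toBasis b.toBasis (Matrix.single i j 1) x) =
          f (b i) * inner ℂ (b j) x
        rw [toLin_single_apply, map_smul, smul_eq_mul, mul_comm]) (fun i j x =>
        toLin_single_apply b j i x) (fun x => b.sum_repr' x)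
    refine Eq.trans ?_ (relLin_eq (linkBimod R S) (linkBimod S R) S.toEndIdentification).symm
    have h2 : ∀ i j, rightAct (linkBimod R S) (S.matElem (Matrix.single i j 1)) = onRight _ _ _ :=
      fun i j => rightAct_linkBimod R S _
    have h3 : ∀ i j, leftAct (linkBimod S R) (S.matElem (Matrix.single i j 1)) = onLeft _ _ _ :=
      fun i j => leftAct_linkBimod S R _
    simp only [h2, h3]
    refine Eq.trans ?_ (congrArg ((Module.finrank ℂ S.K : ℂ)⁻¹ • ·) h1)
    refine LinearMap.ext fun t => (linkHom_dagger_apply R S (linkLin R S t)).trans ?_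
    change ((√(Module.finrank ℂ S.K) : ℝ) : ℂ)⁻¹ • insertion R.K (StrongDual ℂ R.K) _ _
      (R.equiv (R.equiv.symm (((√(Module.finrank ℂ S.K) : ℝ) : ℂ)⁻¹ •
        contraction R.K (StrongDual ℂ R.K) (evalPairing S.K) t))) = _
    rw [LinearIsometryEquiv.apply_symm_apply, map_smul, smul_smul, inv_sqrt_mul_inv_sqrt]
    rfl
  actLeft := by
    rw [dagger_dagger_linkHom]
    refine hom_ext (TensorProduct.ext' fun a q => ?_)
    refine (congrArg (linkLin R S) (lin_actLeft_tensor (linkBimod R S) (linkBimod S R) a _)).trans ?_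
    change _ = mulElem A a q
    obtain ⟨a, rfl⟩ := R.elem.surjective a
    rw [leftAct_linkBimod]
    refine (congrArg (fun t => linkLin R S (TensorProduct.map _ _ t))
      (linkHom_dagger_apply R S q)).trans ?_
    have h := (congrArg (mulElem A (R.elem a)) (R.equiv.symm_apply_apply q)).symm.trans
      (R.mulElem_equiv_symm_left a (R.equiv q))
    refine Eq.trans (congrArg (linkLin R S) ?_) ((linkLin_insertion R S _).trans h.symm)
    refine (LinearMap.map_smul _ _ _).trans ?_
    exact congrArg _ (insertion_onLeft _ _ a _)
  actRight := by
    rw [dagger_dagger_linkHom]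
    refine hom_ext (TensorProduct.ext' fun q a => ?_)
    refine (congrArg (linkLin R S) (lin_actRight_tensor (linkBimod R S) (linkBimod S R) a _)).trans ?_
    change _ = mulElem A q a
    obtain ⟨a, rfl⟩ := R.elem.surjective a
    rw [rightAct_linkBimod]
    refine (congrArg (fun t => linkLin R S (TensorProduct.map _ _ t))
      (linkHom_dagger_apply R S q)).trans ?_
    have h := (congrArg (mulElem A · (R.elem a)) (R.equiv.symm_apply_apply q)).symm.trans
      (R.mulElem_equiv_symm_right a (R.equiv q))
    refine Eq.trans (congrArg (linkLin R S) ?_) ((linkLin_insertion R S _).trans h.symm)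
    refine (LinearMap.map_smul _ _ _).trans ?_
    exact congrArg _ (insertion_onRight _ _ _ _)

theorem moritaEquivalent_of_realization (R : Realization A G') (S : Realization B G') :
    MoritaEquivalent A B :=
  ⟨linkBimod R S, linkBimod S R, isDaggerBimod_linkBimod R S, isDaggerBimod_linkBimod S R,
    ⟨_, isRelTensor_linkBimod R S⟩, ⟨_, isRelTensor_linkBimod S R⟩⟩

end QAut

/-- The fourfold sum is ∑_{x,y} tr(p_x p_y p_x p_y). By orthogonality only x = y contributes,
leaving ∑_x tr p_x = tr 1. -/
theorem Matrix.sum_sum_mul_sum_eq_card {ι X : Type*} [Fintype ι] [DecidableEq ι] [Fintype X]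
    [DecidableEq X] (p : X → Matrix ι ι ℂ) (hp : ∀ x y, p x * p y = if x = y then p x else 0)
    (hs : ∑ x, p x = 1) :
    ∑ a, ∑ b, ∑ c, ∑ d, (∑ x, p x a c * p x d b) * (∑ x, p x c d * p x b a) = Fintype.card ι := by
  have swap : ∀ f : X → ι → ι → ι → ι → ℂ,
      ∑ a, ∑ b, ∑ c, ∑ d, ∑ x, f x a b c d = ∑ x, ∑ a, ∑ b, ∑ c, ∑ d, f x a b c d := by
    intro f
    rw [Finset.sum_comm (t := (Finset.univ : Finset ι)) (s := (Finset.univ : Finset X))]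
    refine Finset.sum_congr rfl fun a _ => ?_
    rw [Finset.sum_comm (t := (Finset.univ : Finset ι)) (s := (Finset.univ : Finset X))]
    refine Finset.sum_congr rfl fun b _ => ?_
    rw [Finset.sum_comm (t := (Finset.univ : Finset ι)) (s := (Finset.univ : Finset X))]
    refine Finset.sum_congr rfl fun c _ => ?_
    rw [Finset.sum_comm (t := (Finset.univ : Finset ι)) (s := (Finset.univ : Finset X))]
  have h1 : ∀ x y, (p x * p y * p x * p y).trace =
      ∑ a, ∑ b, ∑ c, ∑ d, p x a c * p x d b * (p y c d * p y b a) := by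
    intro x y
    simp only [Matrix.trace, Matrix.diag_apply, Matrix.mul_apply, Finset.sum_mul]
    refine Finset.sum_congr rfl fun a _ => Finset.sum_congr rfl fun b _ => ?_
    rw [Finset.sum_comm]
    exact Finset.sum_congr rfl fun c _ => Finset.sum_congr rfl fun d _ => by ring
  have h2 : ∀ x, ∑ y, (p x * p y * p x * p y).trace = (p x).trace := by
    intro x
    rw [Finset.sum_eq_single x]
    · simp [hp]
    · intro y _ hy
      simp [hp, hy.symm]
    · simp
  simp only [Finset.sum_mul_sum, swap]
  simp only [← h1, h2]
  rw [← Matrix.trace_sum, hs, Matrix.trace_one]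

/-! ### The value of d on realized monoids, and the classification -/

namespace QAut

open QuantumIso

variable {G G' : FinGraph.{u}} {A : Mon (QAut G)}

theorem Realization.comp_eq (R : Realization A G') (v w : G.V)
    (m : Matrix (Fin (Module.finrank ℂ R.K)) (Fin (Module.finrank ℂ R.K)) ℂ) :
    R.comp v w m = ∑ x, LinearMap.toMatrix (stdOrthonormalBasis ℂ R.K).toBasis
        (stdOrthonormalBasis ℂ R.K).toBasis (R.P x w) * m *
      LinearMap.toMatrix (stdOrthonormalBasis ℂ R.K).toBasis
        (stdOrthonormalBasis ℂ R.K).toBasis (R.P x v) := by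
  apply R.matElem.injective
  rw [R.matElem_comp]
  let L := (LinearMap.toMatrix (stdOrthonormalBasis ℂ R.K).toBasis
    (stdOrthonormalBasis ℂ R.K).toBasis).symm
  have h : ∀ m, R.matElem m = R.elem (L m) := fun m => rfl
  rw [h, h, R.component_elem, map_sum L]
  refine congrArg R.elem (Finset.sum_congr rfl fun x _ => ?_)
  have hL : ∀ m n, L (m * n) = L m * L n := fun m n =>
    Matrix.toLin_mul (stdOrthonormalBasis ℂ R.K).toBasis (stdOrthonormalBasis ℂ R.K).toBasis
      (stdOrthonormalBasis ℂ R.K).toBasis m n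
  have hLt : ∀ T, L (LinearMap.toMatrix (stdOrthonormalBasis ℂ R.K).toBasis
    (stdOrthonormalBasis ℂ R.K).toBasis T) = T := LinearEquiv.symm_apply_apply _
  rw [hL, hL, hLt, hLt]

/-- Every vertex contributes n = dim K to the contraction, and the prefactor n⁻¹ leaves the number
of vertices. -/
theorem Realization.centreDim_eq_card (R : Realization A G') :
    R.centreDim = Fintype.card G.V := by
  classical
  let p : G'.V → G.V → Matrix (Fin (Module.finrank ℂ R.K)) (Fin (Module.finrank ℂ R.K)) ℂ :=
    fun x v => LinearMap.toMatrix (stdOrthonormalBasis ℂ R.K).toBasis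
      (stdOrthonormalBasis ℂ R.K).toBasis (R.P x v)
  have hp : ∀ x y v, p x v * p y v = if x = y then p x v else 0 := by
    intro x y v
    change LinearMap.toMatrix _ _ _ * LinearMap.toMatrix _ _ _ = _
    rw [← LinearMap.toMatrix_mul, R.col_orthogonal]
    split_ifs
    · rfl
    · exact map_zero _
  have hs : ∀ v, ∑ x, p x v = 1 := by
    intro v
    change ∑ x, LinearMap.toMatrix _ _ _ = _
    rw [← map_sum, R.col_sum]
    exact LinearMap.toMatrix_one _
  have hentry : ∀ v a b c d, R.entry v a b c d = ∑ x, p x v a c * p x v d b := by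
    intro v a b c d
    rw [R.entry_eq]
    change R.comp v v _ a b = _
    rw [R.comp_eq, Matrix.sum_apply]
    refine Finset.sum_congr rfl fun x _ => ?_
    rw [Matrix.mul_assoc, Matrix.mul_apply, Finset.sum_eq_single c]
    · simp [p]
    · intro e _ he
      simp [he]
    · simp
  have hv : ∀ v, ∑ a, ∑ b, ∑ c, ∑ d, R.entry v a b c d * R.entry v c a d b =
      (Module.finrank ℂ R.K : ℂ) := by
    intro v
    simp only [hentry]
    rw [Matrix.sum_sum_mul_sum_eq_card (fun x => p x v) (fun x y => hp x y v) (hs v),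
      Fintype.card_fin]
  rw [EndIdentification.centreDim, Finset.sum_congr rfl fun v _ => hv v, Finset.sum_const,
    nsmul_eq_mul, Finset.card_univ, mul_left_comm, inv_mul_cancel₀ R.finrank_ne_zero, mul_one]

/-- The endomorphism algebra of a quantum isomorphism is realized by it. -/
noncomputable def endMonRealization (P : QuantumIso G' G) [Nontrivial P.H] :
    Realization P.endMon G' where
  K := P.H
  equiv := LinearIsometryEquiv.refl ℂ (P.H ⊗[ℂ] StrongDual ℂ P.H)
  map_mul _ _ := rfl
  map_one := one_smul ℂ (endUnit P.H)
  P := P.P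
  selfAdjoint := P.selfAdjoint
  row_orthogonal := P.row_orthogonal
  row_sum := P.row_sum
  col_orthogonal := P.col_orthogonal
  col_sum := P.col_sum
  intertwines := P.intertwines
  component_elem v w a := by
    apply (tensorDualEquivEnd P.H).injective
    let c : ℂ := ((√(Module.finrank ℂ P.H) : ℝ) : ℂ)
    refine (P.comp_dual_apply v w (c • (tensorDualEquivEnd P.H).symm a)).trans ?_
    change _ = tensorDualEquivEnd P.H (c • (tensorDualEquivEnd P.H).symm _)
    simp only [map_smul, LinearEquiv.apply_symm_apply, mul_smul_comm, smul_mul_assoc,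
      Finset.smul_sum]

theorem Realization.isCommutativeSimple (R : Realization A G') : IsCommutativeSimple A where
  frobenius := R.isDaggerFrobenius
  simple := ⟨R.toEndIdentification⟩
  centreDim_eq := ⟨R.toEndIdentification, R.centreDim_eq_card⟩

/-- For the converse, relabelling along the isomorphism makes both monoids realized from the same
graph, and the joining bimodules apply. -/
theorem moritaEquivalent_iff_nonempty_iso {B : Mon (QAut G)} {G₁ G₂ : FinGraph.{u}}
    (R : Realization A G₁) (S : Realization B G₂) :
    MoritaEquivalent A B ↔ Nonempty (G₁.graph ≃g G₂.graph) :=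
  ⟨nonempty_iso_of_moritaEquivalent R S, fun ⟨f⟩ =>
    moritaEquivalent_of_realization R (S.relabel f)⟩

/-- Through realizations the relation becomes isomorphism of graphs, so transitivity needs no
composition of bimodules. -/
theorem equivalence_moritaEquivalent (G : FinGraph.{u}) :
    Equivalence fun A B : CommutativeSimpleMonoid G => MoritaEquivalent A.1 B.1 where
  refl A := by
    obtain ⟨G', ⟨R⟩⟩ := exists_realization A.2
    exact moritaEquivalent_of_realization R R
  symm {A B} h := by
    obtain ⟨G₁, ⟨R⟩⟩ := exists_realization A.2
    obtain ⟨G₂, ⟨S⟩⟩ := exists_realization B.2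
    obtain ⟨f⟩ := (moritaEquivalent_iff_nonempty_iso R S).mp h
    exact (moritaEquivalent_iff_nonempty_iso S R).mpr ⟨f.symm⟩
  trans {A B D} h h' := by
    obtain ⟨G₁, ⟨R⟩⟩ := exists_realization A.2
    obtain ⟨G₂, ⟨S⟩⟩ := exists_realization B.2
    obtain ⟨G₃, ⟨T⟩⟩ := exists_realization D.2
    obtain ⟨f⟩ := (moritaEquivalent_iff_nonempty_iso R S).mp h
    obtain ⟨g⟩ := (moritaEquivalent_iff_nonempty_iso S T).mp h'
    exact (moritaEquivalent_iff_nonempty_iso R T).mpr ⟨f.trans g⟩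

end QAut

/-- Let `G` be a finite graph. On the simple dagger Frobenius monoids in `QAut(G)` for which the
expression for the dimension of the centre equals the number of vertices of `G`, Morita equivalence
is an equivalence relation, and there is a bijection `Φ` from the isomorphism classes of graphs that
admit a quantum isomorphism to `G` to the Morita equivalence classes of such monoids. It is induced
by sending a quantum isomorphism `(H, P) : G' ⟶ G` to the endomorphism algebra of `H` on the
composite `(H ⊗ H*, P ∘ P̄)`. -/
theorem mainTheorem5 (G : FinGraph.{u}) :
    ∃ hM : Equivalence fun A B : CommutativeSimpleMonoid G => MoritaEquivalent A.1 B.1,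
      ∃ Φ : Quotient (graphIsoSetoid G) ≃ Quotient (Setoid.mk _ hM),
        ∀ (G' : FinGraph.{u}) (P : QuantumIso G' G) (hP : Nontrivial P.H),
          ∃ hA : QAut.IsCommutativeSimple P.endMon,
            Φ (Quotient.mk (graphIsoSetoid G) ⟨G', P, hP⟩) =
              Quotient.mk (Setoid.mk _ hM) ⟨P.endMon, hA⟩ := by
  have hM := QAut.equivalence_moritaEquivalent G
  have hA : ∀ (G' : FinGraph.{u}) (P : QuantumIso G' G) (hP : Nontrivial P.H),
      QAut.IsCommutativeSimple P.endMon :=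
    fun G' P hP => (QAut.endMonRealization P).isCommutativeSimple
  -- An arbitrary quantum isomorphism is chosen for each graph. The choice does not affect the
  -- Morita class, since any two monoids realized from the same graph are Morita equivalent.
  let F : QuantumIsomorphicGraph G → CommutativeSimpleMonoid G := fun X =>
    haveI : Nontrivial X.2.choose.H := X.2.choose_spec
    ⟨X.2.choose.endMon, hA X.1 X.2.choose X.2.choose_spec⟩
  have hF : ∀ X : QuantumIsomorphicGraph G, Nonempty (QAut.Realization (F X).1 X.1) := fun X =>
    haveI : Nontrivial X.2.choose.H := X.2.choose_spec
    ⟨QAut.endMonRealization X.2.choose⟩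
  have hiff : ∀ X Y, MoritaEquivalent (F X).1 (F Y).1 ↔ Nonempty (X.1.graph ≃g Y.1.graph) :=
    fun X Y => by
      obtain ⟨R⟩ := hF X
      obtain ⟨S⟩ := hF Y
      exact QAut.moritaEquivalent_iff_nonempty_iso R S
  let φ : Quotient (graphIsoSetoid G) → Quotient (Setoid.mk _ hM) :=
    Quotient.lift (fun X => Quotient.mk (Setoid.mk _ hM) (F X)) fun X Y h =>
      Quotient.sound ((hiff X Y).mpr h)
  have hφ : Function.Bijective φ := by
    constructor
    · rintro ⟨X⟩ ⟨Y⟩ h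
      exact Quotient.sound ((hiff X Y).mp (Quotient.exact h))
    · rintro ⟨A⟩
      obtain ⟨G', ⟨R⟩⟩ := QAut.exists_realization A.2
      let X : QuantumIsomorphicGraph G := ⟨G', R.toQuantumIso, R.nontrivial⟩
      obtain ⟨S⟩ := hF X
      exact ⟨Quotient.mk _ X, Quotient.sound (QAut.moritaEquivalent_of_realization S R)⟩
  refine ⟨hM, Equiv.ofBijective φ hφ, fun G' P hP => ⟨hA G' P hP, ?_⟩⟩
  obtain ⟨S⟩ := hF ⟨G', P, hP⟩
  exact Quotient.sound (QAut.moritaEquivalent_of_realization S (QAut.endMonRealization P))
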